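/- **Setting.** Let $(\Omega,\mathcal F,\mathbb P)$ be a complete probability space with an ergodic measure-preserving action $(\tau_x)_{x\in\mathbb R}$ of $\mathbb R$: $\tau_0=\mathrm{id}$, $\tau_{x+y}=\tau_x\circ\tau_y$, every $\tau_x$ is measurable and preserves $\mathbb P$, and every measurable $\varphi:\Omega\to\mathbb R$ such that, for each $x\in\mathbb R$, $\varphi\circ\tau_x=\varphi$ almost surely, is almost surely constant. Let $a:\mathbb R\times\Omega\to[0,1]$ and $H:\mathbb R\times\mathbb R\times\Omega\to\mathbb R$ be jointly measurable and stationary, i.e. $a(x+y,\omega)=a(x,\tau_y\omega)$ and $H(x+y,p,\omega)=H(x,p,\tau_y\omega)$ for all $x,y,p,\omega$. Let $\kappa,\alpha_0,\alpha_1,\eta>0$ and $\gamma>2$ be constants such that * for a.e. $\omega$, $a(\cdot,\omega)\not\equiv0$ and $\min_{\mathbb R}a(\cdot,\omega)=0$; for every $\omega$, $\sqrt{a(\cdot,\omega)}$ is $\kappa$-Lipschitz; * for all $x,y,p,q,\omega$: $\alpha_0|p|^\gamma-1/\alpha_0\le H(x,p,\omega)\le\alpha_1(|p|^\gamma+1)$,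 $\;|H(x,p,\omega)-H(x,q,\omega)|\le\alpha_1(|p|+|q|+1)^{\gamma-1}|p-q|$, $\;|H(x,p,\omega)-H(y,p,\omega)|\le\alpha_1(|p|^\gamma+1)|x-y|$; * for all $x,\omega$: $H(x,(1-s)p_0+sp_1,\omega)<\max\{H(x,p_0,\omega),H(x,p_1,\omega)\}$ for all $p_0\ne p_1$, $s\in(0,1)$, and, with $\hat p(x,\omega)$ the minimizer of $H(x,\cdot,\omega)$, $H(x,p_1,\omega)-H(x,p_2,\omega)\ge\eta|p_1-p_2|$ for $p_1<p_2\le\hat p(x,\omega)$ and $H(x,p_2,\omega)-H(x,p_1,\omega)\ge\eta|p_1-p_2|$ for $p_2>p_1\ge\hat p(x,\omega)$. For $\lambda\in\mathbb R$ consider the equation $$a(x,\omega)u''+H(x,u',\omega)=\lambda\quad\text{in }\mathbb R,\tag{$\mathrm{HJ}_\lambda(\omega)$}$$ whose solutions, sub- and supersolutions are continuous and understood in the viscosity sense (a $C^2$ supersolution satisfies $au''+H\le\lambda$), and put $\lambda_0(\omega):=\inf\{\lambda:\ (\mathrm{HJ}_\lambda(\omega))\text{ has a supersolution}\}$. **Theorem.**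 The function $\lambda_0(\cdot)$ is almost surely equal to a constant $\lambda_0\in\mathbb R$. The set $\Omega_{0}$ of all $\omega$ such that $\lambda_0(\omega)=\lambda_0$, $a(\cdot,\omega)\not\equiv0$ and every connected component of $\{a(\cdot,\omega)>0\}$ is bounded has probability $1$ and is invariant under all $\tau_z$. Let $\hat\Omega\subseteq\Omega_{0}$ be any set of probability $1$. For every $\omega\in\hat\Omega$ there is a Lipschitz solution $u_{\lambda_0}(\cdot,\omega)$ of $(\mathrm{HJ}_{\lambda_0}(\omega))$ with $u_{\lambda_0}(0,\omega)=0$. Choose one for each $\omega\in\hat\Omega$ in an arbitrary way, and set $u_{\lambda_0}(\cdot,\omega)\equiv0$ for $\omega\notin\hat\Omega$. For $\lambda>\lambda_0$ and $\omega\in\hat\Omega$ let $\mathcal S^+_\lambda(\omega)$ (resp. $\mathcal S^-_\lambda(\omega)$) be the set of Lipschitz solutions $u$ of $(\mathrm{HJ}_\lambda(\omega))$ with $u'\ge u_{\lambda_0}'(\cdot,\omega)$ (resp. $u'\le u_{\lambda_0}'(\cdot,\omega)$) a.e. in $\mathbb R$; for $\omega\notin\hat\Omega$ let both be the set of constant functions.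 Then, for every $\lambda>\lambda_0$: (a) for every $\omega\in\Omega$ there is a unique $u^+_\lambda(\cdot,\omega)\in\mathcal S^+_\lambda(\omega)$ with $u^+_\lambda(0,\omega)=0$, and it is of class $C^1$ on $\mathbb R$; (b) for every $\omega\in\Omega$ there is a unique $u^-_\lambda(\cdot,\omega)\in\mathcal S^-_\lambda(\omega)$ with $u^-_\lambda(0,\omega)=0$, and it is of class $C^1$ on $\mathbb R$. Moreover, $u^\pm_\lambda:\mathbb R\times\Omega\to\mathbb R$ are measurable with respect to the product of the Borel $\sigma$-algebra of $\mathbb R$ and $\mathcal F$, and their derivatives are stationary: for every $z\in\mathbb R$, almost surely, $(u^\pm_\lambda)'(x+z,\omega)=(u^\pm_\lambda)'(x,\tau_z\omega)$ for all $x\in\mathbb R$; if $\hat\Omega$ is invariant under all $\tau_z$ (for instance $\hat\Omega=\Omega_{0}$), this holds for all $x,z\in\mathbb R$ and every $\omega\in\Omega$. -/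

import Mathlib

open MeasureTheory

/-- `u` is a (continuous) viscosity supersolution of `a(x) u'' + H(x, u') = lam` in `ℝ`. -/
def IsViscositySupersolution (a : ℝ → ℝ) (H : ℝ → ℝ → ℝ) (lam : ℝ) (u : ℝ → ℝ) : Prop :=
  Continuous u ∧ ∀ φ : ℝ → ℝ, ContDiff ℝ 2 φ → ∀ x : ℝ,
    IsLocalMin (fun y => u y - φ y) x →
      a x * deriv (deriv φ) x + H x (deriv φ x) ≤ lam

/-- `u` is a (continuous) viscosity subsolution of `a(x) u'' + H(x, u') = lam` in `ℝ`. -/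
def IsViscositySubsolution (a : ℝ → ℝ) (H : ℝ → ℝ → ℝ) (lam : ℝ) (u : ℝ → ℝ) : Prop :=
  Continuous u ∧ ∀ φ : ℝ → ℝ, ContDiff ℝ 2 φ → ∀ x : ℝ,
    IsLocalMax (fun y => u y - φ y) x →
      lam ≤ a x * deriv (deriv φ) x + H x (deriv φ x)

/-- `u` is a (continuous) viscosity solution of `a(x) u'' + H(x, u') = lam` in `ℝ`. -/
def IsViscositySolution (a : ℝ → ℝ) (H : ℝ → ℝ → ℝ) (lam : ℝ) (u : ℝ → ℝ) : Prop :=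
  IsViscositySubsolution a H lam u ∧ IsViscositySupersolution a H lam u

/-- The critical value of the pair `(a, H)`: the infimum of the levels `lam` at which the
equation `a(x) u'' + H(x, u') = lam` has a continuous viscosity supersolution. -/
noncomputable def criticalValue (a : ℝ → ℝ) (H : ℝ → ℝ → ℝ) : ℝ :=
  sInf {lam : ℝ | ∃ u : ℝ → ℝ, IsViscositySupersolution a H lam u}

/-- `u` is globally Lipschitz on `ℝ`. -/
def IsLip (u : ℝ → ℝ) : Prop := ∃ K : NNReal, LipschitzWith K u

/-- The growth and regularity class of Hamiltonians with constants `α₀`, `α₁`, `γ`. -/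
structure HamiltonianClass (α₀ α₁ γ : ℝ) (H : ℝ → ℝ → ℝ) : Prop where
  growth_lower : ∀ x p, α₀ * |p| ^ γ - 1 / α₀ ≤ H x p
  growth_upper : ∀ x p, H x p ≤ α₁ * (|p| ^ γ + 1)
  lipschitz_momentum : ∀ x p q,
    |H x p - H x q| ≤ α₁ * (|p| + |q| + 1) ^ (γ - 1) * |p - q|
  lipschitz_space : ∀ x y p, |H x p - H y p| ≤ α₁ * (|p| ^ γ + 1) * |x - y|

/-- Strictly quasiconvex Hamiltonians of the previous class which are, in the momentum, at least
`η`-steep on each side of the minimizer `phat` of `H x`. -/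
structure SqcHamiltonianClass (α₀ α₁ γ η : ℝ) (H : ℝ → ℝ → ℝ) : Prop
    extends HamiltonianClass α₀ α₁ γ H where
  strict_quasiconvex : ∀ x p₀ p₁ s : ℝ, p₀ ≠ p₁ → 0 < s → s < 1 →
    H x ((1 - s) * p₀ + s * p₁) < max (H x p₀) (H x p₁)
  steep_left : ∀ x phat : ℝ, (∀ p, H x phat ≤ H x p) →
    ∀ p₁ p₂, p₁ < p₂ → p₂ ≤ phat → η * |p₁ - p₂| ≤ H x p₁ - H x p₂
  steep_right : ∀ x phat : ℝ, (∀ p, H x phat ≤ H x p) →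
    ∀ p₁ p₂, phat ≤ p₁ → p₁ < p₂ → η * |p₁ - p₂| ≤ H x p₂ - H x p₁

/-- `a` is not identically zero and every connected component of `{a > 0}` is bounded. -/
def HasBoundedComponents (a : ℝ → ℝ) : Prop :=
  (∃ x, a x ≠ 0) ∧
    ∀ x, 0 < a x → Bornology.IsBounded (connectedComponentIn {y | 0 < a y} x)

/-- A measure preserving ergodic action of `ℝ` on the probability space `(Ω, P)`. -/
structure IsErgodicFlow {Ω : Type*} [MeasurableSpace Ω] (P : Measure Ω) (τ : ℝ → Ω → Ω) :
    Prop where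
  zero : ∀ ω, τ 0 ω = ω
  add : ∀ x y ω, τ (x + y) ω = τ x (τ y ω)
  measurePreserving : ∀ x, MeasurePreserving (τ x) P P
  ergodic : ∀ φ : Ω → ℝ, Measurable φ → (∀ x, ∀ᵐ ω ∂P, φ (τ x ω) = φ ω) →
    ∃ c : ℝ, ∀ᵐ ω ∂P, φ ω = c

/-- The set of all `ω` for which `{a(·, ω) > 0}` is nonempty with bounded components and for which
the critical value is `lam0`. -/
def regularSet {Ω : Type*} (a : ℝ → Ω → ℝ) (H : ℝ → ℝ → Ω → ℝ) (lam0 : ℝ) : Set Ω :=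
  {ω | HasBoundedComponents (fun x => a x ω) ∧
    criticalValue (fun x => a x ω) (fun x p => H x p ω) = lam0}

/-- A choice, `ω` by `ω` (no measurability), of Lipschitz solutions at the critical level `lam0`
which vanish at the origin, extended by zero outside `Ωhat`. -/
def IsCriticalFamily {Ω : Type*} (a : ℝ → Ω → ℝ) (H : ℝ → ℝ → Ω → ℝ) (lam0 : ℝ)
    (Ωhat : Set Ω) (v : Ω → ℝ → ℝ) : Prop :=
  (∀ ω ∈ Ωhat, IsLip (v ω) ∧
    IsViscositySolution (fun x => a x ω) (fun x p => H x p ω) lam0 (v ω) ∧ v ω 0 = 0) ∧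
  ∀ ω ∉ Ωhat, ∀ x, v ω x = 0

/-- Lipschitz solutions at level `lam` with derivative a.e. above that of `v ω`;
the constants if `ω ∉ Ωhat`. -/
def correctorsPlus {Ω : Type*} (a : ℝ → Ω → ℝ) (H : ℝ → ℝ → Ω → ℝ) (Ωhat : Set Ω)
    (v : Ω → ℝ → ℝ) (lam : ℝ) (ω : Ω) : Set (ℝ → ℝ) :=
  {u | (ω ∈ Ωhat ∧ IsLip u ∧
      IsViscositySolution (fun x => a x ω) (fun x p => H x p ω) lam u ∧
      ∀ᵐ x : ℝ, deriv (v ω) x ≤ deriv u x) ∨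
    (ω ∉ Ωhat ∧ ∃ c : ℝ, u = fun _ => c)}

/-- Lipschitz solutions at level `lam` with derivative a.e. below that of `v ω`;
the constants if `ω ∉ Ωhat`. -/
def correctorsMinus {Ω : Type*} (a : ℝ → Ω → ℝ) (H : ℝ → ℝ → Ω → ℝ) (Ωhat : Set Ω)
    (v : Ω → ℝ → ℝ) (lam : ℝ) (ω : Ω) : Set (ℝ → ℝ) :=
  {u | (ω ∈ Ωhat ∧ IsLip u ∧
      IsViscositySolution (fun x => a x ω) (fun x p => H x p ω) lam u ∧
      ∀ᵐ x : ℝ, deriv u x ≤ deriv (v ω) x) ∨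
    (ω ∉ Ωhat ∧ ∃ c : ℝ, u = fun _ => c)}

/-- The derivative of `U` in `x` is stationary: for every shift `z` the identity
`U'(x + z, ω) = U'(x, τ_z ω)` holds almost surely for all `x`, and it holds for every `ω` without
exception if the set `Ωhat` is invariant under the flow. -/
def HasStationaryDeriv {Ω : Type*} [MeasurableSpace Ω] (P : Measure Ω) (τ : ℝ → Ω → Ω)
    (Ωhat : Set Ω) (U : ℝ → Ω → ℝ) : Prop :=
  (∀ z, ∀ᵐ ω ∂P, ∀ x, deriv (fun y => U y ω) (x + z) = deriv (fun y => U y (τ z ω)) x) ∧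
  ((∀ z ω, τ z ω ∈ Ωhat ↔ ω ∈ Ωhat) →
    ∀ z ω x, deriv (fun y => U y ω) (x + z) = deriv (fun y => U y (τ z ω)) x)

/-!
Between two consecutive zeros `l < r` of `a` a Lipschitz solution is `C²`, and its slope `p` solves
`a p' + H(x, p) = λ`. Since `a` vanishes at least quadratically at `l` and `r`, a bounded slope has
limits there, and these are roots of `H(l, ·) = λ` and `H(r, ·) = λ`. By strict quasiconvexity there
are at most two roots, and a slope lying above that of a solution of level `λ₀ < λ` must take the
larger one at every zero of `a`. This makes the slope continuous and, by comparison on each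
component of `{a > 0}`, unique. It exists because a supersolution of level in `(λ₀, λ)` provides
barriers, above which the largest bounded slope is obtained by shooting from high values and
compactness.

Uniqueness gives stationarity of the slope, and a description of the events `{p(x) < t}` by
countably many test slopes, hence measurability. The critical level is measurable and invariant
under the flow for similar reasons, so ergodicity makes it constant. The solutions with smaller
slope reduce to those with larger slope by the reflection `x ↦ -x`, `p ↦ -p`.
-/

open Filter Topology Set

/-- The parabola with slope `p` and curvature `s` touches `u` from below at `x`: the pair `(p, s)`
lies in the second-order subjet of `u` at `x`. -/
def TouchesBelow (u : ℝ → ℝ) (x p s : ℝ) : Prop :=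
  ∀ᶠ y in 𝓝 x, u x + p * (y - x) + s / 2 * (y - x) ^ 2 ≤ u y

lemma hasDerivAt_parabola (A p s x y : ℝ) :
    HasDerivAt (fun y => A + p * (y - x) + s / 2 * (y - x) ^ 2) (p + s * (y - x)) y := by
  have hsub : HasDerivAt (fun y : ℝ => y - x) 1 y := (hasDerivAt_id y).sub_const x
  refine ((hsub.const_mul p).const_add A).fun_add ((hsub.fun_pow 2).const_mul (s / 2))
    |>.congr_deriv ?_
  push_cast
  ring

lemma touchesBelow_of_hasDerivAt {φ P : ℝ → ℝ} {x s : ℝ}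
    (hφ : ∀ᶠ y in 𝓝 x, HasDerivAt φ (P y) y)
    (hr : ∀ᶠ y in 𝓝[>] x, P x + s * (y - x) ≤ P y)
    (hl : ∀ᶠ y in 𝓝[<] x, P y ≤ P x + s * (y - x)) :
    TouchesBelow φ x (P x) s := by
  set f : ℝ → ℝ := fun y => φ y - (φ x + P x * (y - x) + s / 2 * (y - x) ^ 2) with hf
  have hf' : ∀ᶠ y in 𝓝 x, HasDerivAt f (P y - (P x + s * (y - x))) y :=
    hφ.mono fun y hy => hy.fun_sub (hasDerivAt_parabola _ _ _ _ _)
  have hmin : IsLocalMin f x := by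
    refine isLocalMin_of_deriv' hf'.self_of_nhds.continuousAt
      (hf'.filter_mono nhdsWithin_le_nhds |>.mono fun y hy => hy.differentiableAt)
      (hf'.filter_mono nhdsWithin_le_nhds |>.mono fun y hy => hy.differentiableAt) ?_ ?_
    · filter_upwards [hl, hf'.filter_mono nhdsWithin_le_nhds] with y hle hy
      rw [hy.deriv]
      linarith
    · filter_upwards [hr, hf'.filter_mono nhdsWithin_le_nhds] with y hle hy
      rw [hy.deriv]
      linarith
  filter_upwards [hmin] with y hy
  simp only [hf, sub_self, mul_zero, ne_eq, OfNat.ofNat_ne_zero, not_false_eq_true, zero_pow,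
    add_zero] at hy
  linarith

lemma eventually_le_of_hasDerivWithinAt_Ioi {P : ℝ → ℝ} {x s s₁ : ℝ}
    (h : HasDerivWithinAt P s₁ (Ioi x) x) (hs : s < s₁) :
    ∀ᶠ y in 𝓝[>] x, P x + s * (y - x) ≤ P y := by
  have hslope := (hasDerivWithinAt_iff_tendsto_slope' self_notMem_Ioi).1 h
  filter_upwards [hslope.eventually (lt_mem_nhds hs), self_mem_nhdsWithin] with y hy hxy
  rw [slope_def_field, lt_div_iff₀ (sub_pos.2 hxy)] at hy
  linarith

lemma eventually_le_of_hasDerivWithinAt_Iio {P : ℝ → ℝ} {x s s₁ : ℝ}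
    (h : HasDerivWithinAt P s₁ (Iio x) x) (hs : s < s₁) :
    ∀ᶠ y in 𝓝[<] x, P y ≤ P x + s * (y - x) := by
  have hslope := (hasDerivWithinAt_iff_tendsto_slope' self_notMem_Iio).1 h
  filter_upwards [hslope.eventually (lt_mem_nhds hs), self_mem_nhdsWithin] with y hy hxy
  rw [slope_def_field, lt_div_iff_of_neg (sub_neg.2 hxy)] at hy
  linarith

lemma TouchesBelow.of_isLocalMin {u φ : ℝ → ℝ} {x p s : ℝ}
    (hmin : IsLocalMin (fun y => u y - φ y) x) (h : TouchesBelow φ x p s) :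
    TouchesBelow u x p s := by
  filter_upwards [hmin, h] with y hmin hφ
  linarith

lemma TouchesBelow.isLocalMin {u : ℝ → ℝ} {x p s : ℝ} (h : TouchesBelow u x p s) :
    IsLocalMin (fun y => u y - (u x + p * (y - x) + s / 2 * (y - x) ^ 2)) x := by
  filter_upwards [h] with y hy
  simp only [sub_self, mul_zero, ne_eq, OfNat.ofNat_ne_zero, not_false_eq_true, zero_pow, add_zero]
  linarith

lemma mul_add_le_of_forall_pos {A B c s : ℝ} (h : ∀ ε > 0, A * (s - ε) + B ≤ c) :
    A * s + B ≤ c := by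
  have hlim : Tendsto (fun ε => A * (s - ε) + B) (𝓝[>] 0) (𝓝 (A * (s - 0) + B)) :=
    (Continuous.tendsto (by fun_prop) 0).mono_left nhdsWithin_le_nhds
  rw [sub_zero] at hlim
  exact le_of_tendsto hlim (eventually_mem_nhdsWithin.mono h)

lemma isViscositySupersolution_iff {a : ℝ → ℝ} {H : ℝ → ℝ → ℝ} {lam : ℝ} {u : ℝ → ℝ} :
    IsViscositySupersolution a H lam u ↔
      Continuous u ∧ ∀ x p s, TouchesBelow u x p s → a x * s + H x p ≤ lam := by
  refine and_congr_right fun _ => ⟨fun h x p s ht => ?_, fun h φ hφ x hmin => ?_⟩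
  · set φ : ℝ → ℝ := fun y => u x + p * (y - x) + s / 2 * (y - x) ^ 2 with hφ
    have hd1 : deriv φ = fun y => p + s * (y - x) :=
      funext fun y => (hasDerivAt_parabola _ _ _ _ _).deriv
    have hd2 : deriv (deriv φ) x = s := by simp [hd1]
    have hle := h φ (by simp only [hφ]; fun_prop) x ht.isLocalMin
    rw [hd2, hd1] at hle
    simpa using hle
  · refine mul_add_le_of_forall_pos fun ε hε => ?_
    have hd1 (y : ℝ) : HasDerivAt φ (deriv φ y) y :=
      (hφ.differentiable (by norm_num)).differentiableAt.hasDerivAt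
    have hφ' : ContDiff ℝ 1 (deriv φ) :=
      ((contDiff_succ_iff_deriv (n := 1)).1 (by simpa [one_add_one_eq_two] using hφ)).2.2
    have hd2 : HasDerivAt (deriv φ) (deriv (deriv φ) x) x :=
      (hφ'.differentiable (by norm_num)).differentiableAt.hasDerivAt
    have ht : TouchesBelow φ x (deriv φ x) (deriv (deriv φ) x - ε) :=
      touchesBelow_of_hasDerivAt (Eventually.of_forall hd1)
        (eventually_le_of_hasDerivWithinAt_Ioi hd2.hasDerivWithinAt (by linarith))
        (eventually_le_of_hasDerivWithinAt_Iio hd2.hasDerivWithinAt (by linarith))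
    exact h x _ _ (ht.of_isLocalMin hmin)

lemma isViscositySubsolution_iff_neg {a : ℝ → ℝ} {H : ℝ → ℝ → ℝ} {lam : ℝ} {u : ℝ → ℝ} :
    IsViscositySubsolution a H lam u ↔
      IsViscositySupersolution a (fun x p => -H x (-p)) (-lam) (fun x => -u x) := by
  refine and_congr ⟨fun h => h.neg, fun h => by simpa only [neg_neg] using h.fun_neg⟩
    ⟨fun h φ hφ x hm => ?_, fun h φ hφ x hm => ?_⟩
  · have hle := h (fun y => -φ y) hφ.neg x (by filter_upwards [hm] with y hy; linarith)
    simp only [deriv.fun_neg'] at hle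
    linarith
  · have hle := h (fun y => -φ y) hφ.neg x (by filter_upwards [hm] with y hy; linarith)
    simp only [deriv.fun_neg', neg_neg] at hle
    linarith

/-- The curvature is lowered by `ε`, so that the contact point is a strict local minimum and
persists under uniform perturbations. -/
lemma TouchesBelow.exists_of_approx {u : ℝ → ℝ} {x p s ε ρ : ℝ} (h : TouchesBelow u x p s)
    (hε : 0 < ε) (hρ : 0 < ρ) :
    ∃ δ > 0, ∀ v, Continuous v → (∀ y, |y - x| ≤ ρ → |v y - u y| ≤ δ) →
      ∃ y, |y - x| < ρ ∧ TouchesBelow v y (p + (s - ε) * (y - x)) (s - ε) := by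
  obtain ⟨r₀, hr₀, hball⟩ := Metric.eventually_nhds_iff.1 h
  set r := min ρ (r₀ / 2)
  have hr0 : 0 < r := by positivity
  have hrr₀ : r < r₀ := (min_le_right _ _).trans_lt (half_lt_self hr₀)
  refine ⟨ε / 8 * r ^ 2, by positivity, fun v hv hvu => ?_⟩
  set g : ℝ → ℝ := fun y => v y - (p * (y - x) + (s - ε) / 2 * (y - x) ^ 2) with hg
  have hgc : Continuous g := by fun_prop
  have hxI : x ∈ Icc (x - r) (x + r) := by constructor <;> linarith
  obtain ⟨y, hy, hymin⟩ := (isCompact_Icc (a := x - r) (b := x + r)).exists_isMinOn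
    ⟨x, hxI⟩ hgc.continuousOn
  have habs : |y - x| ≤ r := abs_le.2 ⟨by linarith [hy.1], by linarith [hy.2]⟩
  have hyr : |y - x| < r := by
    have hyx := hymin hxI
    simp only [mem_ofPred_eq, hg, sub_self] at hyx
    have hy' := abs_le.1 (hvu y (habs.trans (min_le_left _ _)))
    have hx' := abs_le.1 (hvu x (by simpa using hρ.le))
    have hu : _ ≤ u y := hball (habs.trans_lt hrr₀)
    have hsq : (y - x) ^ 2 * 2 ≤ r ^ 2 := le_of_mul_le_mul_left (by linarith [hy'.1, hx'.2]) hε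
    exact abs_lt_of_sq_lt_sq (by linarith [pow_pos hr0 2]) hr0.le
  refine ⟨y, hyr.trans_le (min_le_left _ _), ?_⟩
  obtain ⟨hyl, hyu⟩ := abs_lt.1 hyr
  filter_upwards [Icc_mem_nhds (show x - r < y by linarith) (show y < x + r by linarith)]
    with z hz
  have hyz := hymin hz
  simp only [mem_ofPred_eq, hg] at hyz
  nlinarith

lemma IsViscositySupersolution.of_approx {a : ℝ → ℝ} {H : ℝ → ℝ → ℝ} {lam : ℝ} {u : ℝ → ℝ}
    (ha : Continuous a) (hH : Continuous fun q : ℝ × ℝ => H q.1 q.2) (hu : Continuous u)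
    (happ : ∀ R > 0, ∀ δ > 0, ∃ v mu, mu ≤ lam + δ ∧ IsViscositySupersolution a H mu v ∧
      ∀ y, |y| ≤ R → |v y - u y| ≤ δ) :
    IsViscositySupersolution a H lam u := by
  refine isViscositySupersolution_iff.2 ⟨hu, fun x p s ht => ?_⟩
  refine mul_add_le_of_forall_pos fun ε hε => le_of_forall_pos_le_add fun θ hθ => ?_
  set ψ : ℝ → ℝ := fun y => a y * (s - ε) + H y (p + (s - ε) * (y - x)) with hψ
  have hψc : Continuous ψ := (ha.mul continuous_const).add
    (hH.comp (f := fun y => (y, p + (s - ε) * (y - x))) (by fun_prop))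
  have hψx : ψ x = a x * (s - ε) + H x p := by simp [hψ]
  rw [← hψx]
  obtain ⟨ρ, hρ, hψρ⟩ := Metric.eventually_nhds_iff.1
    (hψc.continuousAt.eventually (lt_mem_nhds (sub_lt_self (ψ x) (half_pos hθ))))
  obtain ⟨δ, hδ, htouch⟩ := ht.exists_of_approx hε hρ
  obtain ⟨v, mu, hmu, hv, hvu⟩ := happ (|x| + ρ) (by positivity) (min (θ / 2) δ) (by positivity)
  have hvu' (y : ℝ) (hy : |y - x| ≤ ρ) : |v y - u y| ≤ δ :=
    (hvu y (by linarith [abs_sub_abs_le_abs_sub y x])).trans (min_le_right _ _)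
  obtain ⟨y, hyx, hy⟩ := htouch v hv.1 hvu'
  have hle : ψ y ≤ mu := (isViscositySupersolution_iff.1 hv).2 _ _ _ hy
  linarith [hψρ (show dist y x < ρ from hyx), min_le_left (θ / 2) δ]

lemma IsViscositySolution.of_approx {a : ℝ → ℝ} {H : ℝ → ℝ → ℝ} {lam : ℝ} {u : ℝ → ℝ}
    (ha : Continuous a) (hH : Continuous fun q : ℝ × ℝ => H q.1 q.2) (hu : Continuous u)
    (happ : ∀ R > 0, ∀ δ > 0, ∃ v mu, |mu - lam| ≤ δ ∧ IsViscositySolution a H mu v ∧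
      ∀ y, |y| ≤ R → |v y - u y| ≤ δ) :
    IsViscositySolution a H lam u := by
  refine ⟨isViscositySubsolution_iff_neg.2 (.of_approx ha ?_ hu.neg fun R hR δ hδ => ?_),
    .of_approx ha hH hu fun R hR δ hδ => ?_⟩
  · exact (hH.comp (f := fun q : ℝ × ℝ => (q.1, -q.2)) (by fun_prop)).neg
  · obtain ⟨v, mu, hmu, hv, hvu⟩ := happ R hR δ hδ
    refine ⟨fun y => -v y, -mu, by linarith [(abs_le.1 hmu).1],
      isViscositySubsolution_iff_neg.1 hv.1, fun y hy => ?_⟩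
    rw [neg_sub_neg, abs_sub_comm]
    exact hvu y hy
  · obtain ⟨v, mu, hmu, hv, hvu⟩ := happ R hR δ hδ
    exact ⟨v, mu, by linarith [(abs_le.1 hmu).2], hv.2, hvu⟩

lemma exists_touchesBelow_of_slope_lt {k : ℝ → ℝ} {x y z : ℝ} (hk : ContinuousOn k (Icc x z))
    (hxy : x < y) (hyz : y < z) (hlt : (k y - k x) / (y - x) < (k z - k y) / (z - y)) :
    ∃ w ∈ Ioo x z, ∃ p, ∃ ε > 0, TouchesBelow k w p ε := by
  have hyx : 0 < y - x := by linarith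
  have hzy : 0 < z - y := by linarith
  set m := (k z - k x) / (z - x) with hm
  have hmz : m * (z - x) = k z - k x := by rw [hm, div_mul_cancel₀]; linarith
  set D := m * (y - x) - (k y - k x) with hD
  have hD0 : 0 < D := by
    rw [div_lt_div_iff₀ hyx hzy] at hlt
    have : (k y - k x) * (z - x) < m * (y - x) * (z - x) := by nlinarith
    linarith [lt_of_mul_lt_mul_right this (by linarith)]
  set ε := D / ((y - x) * (z - y)) with hε
  have hεD : ε * ((y - x) * (z - y)) = D := div_mul_cancel₀ _ (by positivity)
  set g : ℝ → ℝ := fun w => k w - k x - m * (w - x) - ε / 2 * ((w - x) * (w - z)) with hg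
  have hgy : g y < 0 := by simp only [hg]; nlinarith
  have hgx : g x = 0 := by simp [hg]
  have hgz : g z = 0 := by simp only [hg]; rw [hmz]; ring
  obtain ⟨w, hw, hwmin⟩ := isCompact_Icc.exists_isMinOn ⟨x, le_rfl, by linarith⟩
    (show ContinuousOn g (Icc x z) by fun_prop)
  have hgw : g w < 0 := (hwmin ⟨hxy.le, hyz.le⟩).trans_lt hgy
  have hwI : w ∈ Ioo x z :=
    ⟨lt_of_le_of_ne hw.1 (by rintro rfl; linarith), lt_of_le_of_ne hw.2 (by rintro rfl; linarith)⟩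
  refine ⟨w, hwI, m + ε / 2 * (2 * w - x - z), ε, by positivity, ?_⟩
  filter_upwards [Icc_mem_nhds hwI.1 hwI.2] with v hv
  have hwv := hwmin hv
  simp only [mem_ofPred_eq, hg] at hwv
  nlinarith

lemma concaveOn_of_touchesBelow_le {h : ℝ → ℝ} {c d C : ℝ} (hc : ContinuousOn h (Ioo c d))
    (ht : ∀ x ∈ Ioo c d, ∀ p s, TouchesBelow h x p s → s ≤ C) :
    ConcaveOn ℝ (Ioo c d) fun x => h x - C / 2 * x ^ 2 := by
  refine concaveOn_of_slope_anti_adjacent (convex_Ioo c d) fun {x y z} hx hz hxy hyz => ?_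
  by_contra! hlt
  have hsub : Icc x z ⊆ Ioo c d := fun w hw => ⟨hx.1.trans_le hw.1, hw.2.trans_lt hz.2⟩
  have hcont : ContinuousOn (fun x => h x - C / 2 * x ^ 2) (Icc x z) := by
    have := hc.mono hsub
    fun_prop
  obtain ⟨w, hw, p, ε, hε, hT⟩ := exists_touchesBelow_of_slope_lt hcont hxy hyz hlt
  have hTh : TouchesBelow h w (p + C * w) (C + ε) := by
    filter_upwards [hT] with v hv
    linarith
  linarith [ht w (hsub (Ioo_subset_Icc_self hw)) _ _ hTh]

/-- Bounded Lipschitz diffusion coefficients with quadratic vanishing, and strictly quasiconvex,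
superquadratically coercive Hamiltonians; `M` quantifies the coercivity. -/
structure Admissible (M : ℝ → ℝ) (a : ℝ → ℝ) (H : ℝ → ℝ → ℝ) : Prop where
  a_nonneg : ∀ x, 0 ≤ a x
  a_le_one : ∀ x, a x ≤ 1
  a_lip : ∃ A, ∀ x y, |a x - a y| ≤ A * |x - y|
  a_quad : ∃ B > 0, ∀ z x, a z = 0 → a x ≤ B * (x - z) ^ 2
  H_lip : ∀ R, ∃ L > 0, ∀ x y p q, |p| ≤ R → |q| ≤ R → |H x p - H y q| ≤ L * (|x - y| + |p - q|)
  H_bdd : ∀ R, ∃ B > 0, ∀ x p, |p| ≤ R → |H x p| ≤ B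
  one_le_M : ∀ t, 1 ≤ M t
  mono_M : Monotone M
  coercive : ∀ t x p, M t ≤ |p| → t + p ^ 2 < H x p
  sqc : ∀ x p q r, p < q → q < r → H x q < max (H x p) (H x r)

/-- `P` is the larger of the two solutions of `H x = lam`: for a strictly quasiconvex `H x` it is
the one with values below `lam` to its left. -/
def IsUpperRoot (H : ℝ → ℝ → ℝ) (lam x P : ℝ) : Prop :=
  H x P = lam ∧ ∃ q < P, H x q < lam

section Roots

variable {M : ℝ → ℝ} {a : ℝ → ℝ} {H : ℝ → ℝ → ℝ} {lam x P : ℝ}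

lemma Admissible.continuous_a (h : Admissible M a H) : Continuous a := by
  obtain ⟨A, hA⟩ := h.a_lip
  refine continuous_iff_continuousAt.2 fun x => ?_
  refine tendsto_iff_dist_tendsto_zero.2 (squeeze_zero (fun _ => dist_nonneg) (fun y => hA y x) ?_)
  have : Continuous fun y => A * |y - x| := by fun_prop
  simpa using this.tendsto x

lemma Admissible.continuous_H (h : Admissible M a H) : Continuous fun q : ℝ × ℝ => H q.1 q.2 := by
  refine continuous_iff_continuousAt.2 fun ⟨x, p⟩ => ?_
  obtain ⟨L, -, hL⟩ := h.H_lip (|p| + 1)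
  refine tendsto_iff_dist_tendsto_zero.2 (squeeze_zero' (Eventually.of_forall fun _ => dist_nonneg)
    (g := fun q : ℝ × ℝ => L * (|q.1 - x| + |q.2 - p|)) ?_ ?_)
  · have : ∀ᶠ q : ℝ × ℝ in 𝓝 (x, p), |q.2| < |p| + 1 :=
      (continuous_snd.abs.tendsto (x, p)).eventually (gt_mem_nhds (by simp))
    filter_upwards [this] with q hq
    exact hL q.1 x q.2 p hq.le (by linarith)
  · have : Continuous fun q : ℝ × ℝ => L * (|q.1 - x| + |q.2 - p|) := by fun_prop
    simpa using this.tendsto (x, p)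

lemma Admissible.continuous_H_comp (h : Admissible M a H) {f g : ℝ → ℝ} (hf : Continuous f)
    (hg : Continuous g) : Continuous fun y => H (f y) (g y) :=
  h.continuous_H.comp (hf.prodMk hg)

lemma Admissible.eventually_lt_H (h : Admissible M a H) {x k : ℝ} (hk : lam < H x k) :
    ∀ᶠ y in 𝓝 x, lam < H y k :=
  (h.continuous_H_comp continuous_id continuous_const).continuousAt.eventually (lt_mem_nhds hk)

lemma Admissible.eventually_H_lt (h : Admissible M a H) {x k : ℝ} (hk : H x k < lam) :
    ∀ᶠ y in 𝓝 x, H y k < lam :=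
  (h.continuous_H_comp continuous_id continuous_const).continuousAt.eventually (gt_mem_nhds hk)

lemma Admissible.a_pos (h : Admissible M a H) (hx : a x ≠ 0) : 0 < a x :=
  lt_of_le_of_ne (h.a_nonneg x) hx.symm

lemma Admissible.abs_lt_of_H_le (h : Admissible M a H) {t p : ℝ} (hp : H x p ≤ t) : |p| < M t := by
  by_contra! hlarge
  linarith [h.coercive t x p hlarge, sq_nonneg p]

lemma IsUpperRoot.lt_H (hP : IsUpperRoot H lam x P) (h : Admissible M a H) {r : ℝ} (hr : P < r) :
    lam < H x r := by
  obtain ⟨hroot, q, hqP, hq⟩ := hP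
  have hmax := h.sqc x q P r hqP hr
  rw [hroot] at hmax
  exact (lt_max_iff.1 hmax).resolve_left hq.not_gt

lemma IsUpperRoot.unique (hP : IsUpperRoot H lam x P) (h : Admissible M a H) {Q : ℝ}
    (hQ : IsUpperRoot H lam x Q) : P = Q := by
  rcases lt_trichotomy P Q with hlt | heq | hgt
  · exact absurd hQ.1 (hP.lt_H h hlt).ne'
  · exact heq
  · exact absurd hP.1 (hQ.lt_H h hgt).ne'

lemma IsUpperRoot.le_of_H_le (hP : IsUpperRoot H lam x P) (h : Admissible M a H) {k : ℝ}
    (hk : H x k ≤ lam) : k ≤ P := by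
  by_contra! hlt
  exact (hP.lt_H h hlt).not_ge hk

lemma IsUpperRoot.lt_of_H_lt (hP : IsUpperRoot H lam x P) (h : Admissible M a H) {k : ℝ}
    (hk : H x k < lam) : k < P :=
  lt_of_le_of_ne (hP.le_of_H_le h hk.le) fun heq => hk.ne (heq ▸ hP.1)

lemma IsUpperRoot.lt_of_lt_H (hP : IsUpperRoot H lam x P) (h : Admissible M a H) {k₁ k₂ : ℝ}
    (hk : k₁ < k₂) (hk₁ : H x k₁ < lam) (hk₂ : lam < H x k₂) : P < k₂ := by
  by_contra! hle
  rcases hle.lt_or_eq with hlt | rfl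
  · exact (h.sqc x k₁ k₂ P hk hlt).not_ge (max_le hk₁.le hP.1.le |>.trans hk₂.le)
  · exact hk₂.ne' hP.1

lemma Admissible.exists_isUpperRoot (h : Admissible M a H) {q : ℝ} (hq : H x q < lam) :
    ∃ P, IsUpperRoot H lam x P := by
  set R := max (q + 1) (M lam)
  have hqR : q < R := (lt_add_one q).trans_le (le_max_left _ _)
  have hR : lam < H x R := by
    linarith [h.coercive lam x R ((le_max_right _ _).trans (le_abs_self _)), sq_nonneg R]
  have hcont : Continuous (H x) := h.continuous_H_comp continuous_const continuous_id
  obtain ⟨P, ⟨hqP, -⟩, hP⟩ := intermediate_value_Icc hqR.le hcont.continuousOn ⟨hq.le, hR.le⟩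
  exact ⟨P, hP, q, lt_of_le_of_ne hqP fun heq => hq.ne (heq ▸ hP), hq⟩

lemma IsUpperRoot.H_lt (hP : IsUpperRoot H lam x P) (h : Admissible M a H) :
    ∃ q₀ < P, ∀ q, q₀ ≤ q → q < P → H x q < lam := by
  obtain ⟨hroot, q, hqP, hq⟩ := hP
  refine ⟨q, hqP, fun r hqr hrP => ?_⟩
  rcases hqr.lt_or_eq with hqr | rfl
  · exact (h.sqc x q r P hqr hrP).trans_le (max_le hq.le hroot.le)
  · exact hq

lemma Admissible.dense_H_ne (h : Admissible M a H) (x lam : ℝ) : Dense {k | H x k ≠ lam} := by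
  refine dense_of_exists_between fun p r hpr => ?_
  by_contra! hno
  have hconst (b : ℝ) (hpb : p < b) (hbr : b < r) : H x b = lam := by
    by_contra hb
    exact hno b hb ⟨hpb, hbr⟩
  obtain ⟨b, hpb, hbr⟩ := exists_between hpr
  obtain ⟨b₁, hpb₁, hb₁⟩ := exists_between hpb
  obtain ⟨b₂, hb₂, hb₂r⟩ := exists_between hbr
  have hmax := h.sqc x b₁ b b₂ hb₁ hb₂
  rw [hconst b hpb hbr, hconst b₁ hpb₁ (hb₁.trans hbr), hconst b₂ (hpb.trans hb₂) hb₂r,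
    max_self] at hmax
  exact lt_irrefl _ hmax

end Roots

lemma Admissible.reflect {M : ℝ → ℝ} {a : ℝ → ℝ} {H : ℝ → ℝ → ℝ} (h : Admissible M a H) :
    Admissible M (fun x => a (-x)) (fun x p => H (-x) (-p)) where
  a_nonneg x := h.a_nonneg _
  a_le_one x := h.a_le_one _
  a_lip := by
    obtain ⟨A, hA⟩ := h.a_lip
    refine ⟨A, fun x y => (hA _ _).trans_eq ?_⟩
    rw [← abs_neg (x - y)]; ring_nf
  a_quad := by
    obtain ⟨B, hB, hB'⟩ := h.a_quad
    exact ⟨B, hB, fun z x hz => (hB' _ _ hz).trans_eq (by ring)⟩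
  H_lip R := by
    obtain ⟨L, hL, hL'⟩ := h.H_lip R
    refine ⟨L, hL, fun x y p q hp hq => (hL' _ _ _ _ (by simpa) (by simpa)).trans_eq ?_⟩
    rw [← abs_neg (x - y), ← abs_neg (p - q)]; ring_nf
  H_bdd R := by
    obtain ⟨B, hB, hB'⟩ := h.H_bdd R
    exact ⟨B, hB, fun x p hp => hB' _ _ (by simpa)⟩
  one_le_M := h.one_le_M
  mono_M := h.mono_M
  coercive t x p hp := by simpa using h.coercive t (-x) (-p) (by simpa)
  sqc x p q r hpq hqr := by
    rw [max_comm]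
    exact h.sqc _ _ _ _ (by linarith) (by linarith)

lemma TouchesBelow.eq_of_hasDerivAt {u : ℝ → ℝ} {x p s q : ℝ} (h : TouchesBelow u x p s)
    (hu : HasDerivAt u q x) : p = q := by
  have hdiff := h.isLocalMin.hasDerivAt_eq_zero (hu.fun_sub (hasDerivAt_parabola (u x) p s x x))
  linarith

lemma TouchesBelow.abs_le_of_lipschitzWith {u : ℝ → ℝ} {x p s : ℝ} {K : NNReal}
    (h : TouchesBelow u x p s) (hK : LipschitzWith K u) : |p| ≤ K := by
  have hdir (θ : ℝ) (hθ : |θ| = 1) : θ * p ≤ K := by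
    have hlim : Tendsto (fun t => θ * p + s / 2 * θ ^ 2 * t) (𝓝[>] 0)
        (𝓝 (θ * p + s / 2 * θ ^ 2 * 0)) :=
      (Continuous.tendsto (by fun_prop) 0).mono_left nhdsWithin_le_nhds
    have hray : Tendsto (fun t => x + θ * t) (𝓝[>] 0) (𝓝 (x + θ * 0)) :=
      (Continuous.tendsto (by fun_prop) 0).mono_left nhdsWithin_le_nhds
    rw [mul_zero, add_zero] at hlim hray
    refine le_of_tendsto hlim ?_
    filter_upwards [hray.eventually h, self_mem_nhdsWithin] with t ht (ht0 : 0 < t)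
    have hinc : u (x + θ * t) - u x ≤ K * t := by
      refine (le_abs_self _).trans ((hK.dist_le_mul _ _).trans_eq ?_)
      rw [Real.dist_eq, add_sub_cancel_left, abs_mul, hθ, one_mul, abs_of_pos ht0]
    rw [add_sub_cancel_left] at ht
    exact le_of_mul_le_mul_right (by linarith) ht0
  exact abs_le.2 ⟨by linarith [hdir (-1) (by simp)], by linarith [hdir 1 (by simp)]⟩

lemma IsViscositySupersolution.semiconcave {a : ℝ → ℝ} {H : ℝ → ℝ → ℝ} {lam m C c d : ℝ}
    {K : NNReal} {u : ℝ → ℝ} (hu : IsViscositySupersolution a H lam u) (hK : LipschitzWith K u)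
    (hm : 0 < m) (ha : ∀ x ∈ Ioo c d, m ≤ a x) (hC : 0 ≤ C)
    (hH : ∀ x (p : ℝ), |p| ≤ K → lam - H x p ≤ C) :
    ConcaveOn ℝ (Ioo c d) fun x => u x - (C / m) / 2 * x ^ 2 := by
  refine concaveOn_of_touchesBelow_le hu.1.continuousOn fun x hx p s hT => ?_
  have hsup := (isViscositySupersolution_iff.1 hu).2 x p s hT
  have hHx := hH x p (hT.abs_le_of_lipschitzWith hK)
  rw [le_div_iff₀ hm]
  rcases le_total s 0 with hs | hs
  · nlinarith
  · nlinarith [ha x hx]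

section Semiconcave

variable {u : ℝ → ℝ} {c d C x y : ℝ}

lemma hasDerivAt_half_mul_sq (C x : ℝ) : HasDerivAt (fun x : ℝ => C / 2 * x ^ 2) (C * x) x := by
  refine ((hasDerivAt_pow 2 x).const_mul (C / 2)).congr_deriv ?_
  push_cast
  ring

lemma exists_hasDerivWithinAt_of_semiconcave
    (h : ConcaveOn ℝ (Ioo c d) fun x => u x - C / 2 * x ^ 2) (hx : x ∈ Ioo c d) :
    ∃ l r, HasDerivWithinAt u l (Iio x) x ∧ HasDerivWithinAt u r (Ioi x) x ∧ r ≤ l := by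
  have hx' : x ∈ interior (Ioo c d) := by rwa [isOpen_Ioo.interior_eq]
  have hconv := h.neg
  have hq := hasDerivAt_half_mul_sq C x
  have hu : u = fun x => -((-fun x => u x - C / 2 * x ^ 2) x) + C / 2 * x ^ 2 := by
    ext y
    simp
  have hl := (hconv.hasDerivWithinAt_leftDeriv_of_mem_interior hx').fun_neg.fun_add
    hq.hasDerivWithinAt
  have hr := (hconv.hasDerivWithinAt_rightDeriv_of_mem_interior hx').fun_neg.fun_add
    hq.hasDerivWithinAt
  rw [← hu] at hl hr
  exact ⟨_, _, hl, hr, by linarith [hconv.leftDeriv_le_rightDeriv_of_mem_interior hx']⟩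

lemma differentiableAt_of_semiconcave_semiconvex
    (hcave : ConcaveOn ℝ (Ioo c d) fun x => u x - C / 2 * x ^ 2)
    (hvex : ConcaveOn ℝ (Ioo c d) fun x => -u x - C / 2 * x ^ 2) (hx : x ∈ Ioo c d) :
    DifferentiableAt ℝ u x := by
  obtain ⟨l, r, hl, hr, hrl⟩ := exists_hasDerivWithinAt_of_semiconcave hcave hx
  obtain ⟨l', r', hl', hr', hrl'⟩ := exists_hasDerivWithinAt_of_semiconcave hvex hx
  have hl_eq : l' = -l := (uniqueDiffWithinAt_Iio x).eq_deriv _ hl' hl.fun_neg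
  have hr_eq : r' = -r := (uniqueDiffWithinAt_Ioi x).eq_deriv _ hr' hr.fun_neg
  obtain rfl : l = r := by linarith
  have hunion := hl.union hr
  rw [Iio_union_Ioi, ← Set.sdiff_eq_compl_inter.trans (Set.inter_univ _)] at hunion
  exact (hasDerivWithinAt_univ.1 (hasDerivWithinAt_sdiff_singleton.1 hunion)).differentiableAt

lemma abs_deriv_sub_le_of_semiconcave_semiconvex
    (hcave : ConcaveOn ℝ (Ioo c d) fun x => u x - C / 2 * x ^ 2)
    (hvex : ConcaveOn ℝ (Ioo c d) fun x => -u x - C / 2 * x ^ 2) (hx : x ∈ Ioo c d)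
    (hy : y ∈ Ioo c d) : |deriv u y - deriv u x| ≤ C * |y - x| := by
  wlog hxy : x ≤ y generalizing x y
  · rw [abs_sub_comm, abs_sub_comm y]
    exact this hy hx (by linarith)
  have hdiff (z) (hz : z ∈ Ioo c d) : HasDerivAt u (deriv u z) z :=
    (differentiableAt_of_semiconcave_semiconvex hcave hvex hz).hasDerivAt
  have hcave' (z) (hz : z ∈ Ioo c d) :=
    (hdiff z hz).fun_sub (hasDerivAt_half_mul_sq C z)
  have hvex' (z) (hz : z ∈ Ioo c d) :=
    (hdiff z hz).fun_neg.fun_sub (hasDerivAt_half_mul_sq C z)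
  have hupper := hcave.antitoneOn_deriv (fun z hz => (hcave' z hz).differentiableAt) hx hy hxy
  have hlower := hvex.antitoneOn_deriv (fun z hz => (hvex' z hz).differentiableAt) hx hy hxy
  rw [(hcave' x hx).deriv, (hcave' y hy).deriv] at hupper
  rw [(hvex' x hx).deriv, (hvex' y hy).deriv] at hlower
  rw [abs_of_nonneg (by linarith : 0 ≤ y - x), abs_le]
  constructor <;> linarith

lemma continuousOn_deriv_of_semiconcave_semiconvex
    (hcave : ConcaveOn ℝ (Ioo c d) fun x => u x - C / 2 * x ^ 2)
    (hvex : ConcaveOn ℝ (Ioo c d) fun x => -u x - C / 2 * x ^ 2) :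
    ContinuousOn (deriv u) (Ioo c d) := by
  intro y hy
  have hlim : Tendsto (fun z => C * |z - y|) (𝓝[Ioo c d] y) (𝓝 (C * |y - y|)) :=
    (Continuous.tendsto (by fun_prop) y).mono_left nhdsWithin_le_nhds
  rw [sub_self, abs_zero, mul_zero] at hlim
  refine tendsto_iff_dist_tendsto_zero.2
    (squeeze_zero' (Eventually.of_forall fun _ => dist_nonneg) ?_ hlim)
  filter_upwards [self_mem_nhdsWithin] with z hz
  exact abs_deriv_sub_le_of_semiconcave_semiconvex hcave hvex hy hz

lemma deriv_eq_of_concaveOn_of_concaveOn_neg (hcave : ConcaveOn ℝ (Ioo c d) u)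
    (hvex : ConcaveOn ℝ (Ioo c d) fun x => -u x) (hx : x ∈ Ioo c d) (hy : y ∈ Ioo c d) :
    deriv u y = deriv u x := by
  have hle := abs_deriv_sub_le_of_semiconcave_semiconvex (C := 0) (by simpa using hcave)
    (by simpa using hvex) hx hy
  rw [zero_mul] at hle
  exact sub_eq_zero.1 (abs_nonpos_iff.1 hle)

end Semiconcave

/-- `W''` is the second derivative that the equation prescribes for `u`, so `u - W` is touched from
below by no parabola of positive curvature. -/
lemma IsViscositySupersolution.concaveOn_sub {a : ℝ → ℝ} {H : ℝ → ℝ → ℝ} {lam c d : ℝ}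
    {u F W₁ W : ℝ → ℝ} (hu : IsViscositySupersolution a H lam u)
    (ha : ∀ x ∈ Ioo c d, 0 < a x) (hd : ∀ x ∈ Ioo c d, DifferentiableAt ℝ u x)
    (hF : ∀ x ∈ Ioo c d, a x * F x + H x (deriv u x) = lam)
    (hW₁ : ∀ x, HasDerivAt W₁ (F x) x) (hW : ∀ x, HasDerivAt W (W₁ x) x) :
    ConcaveOn ℝ (Ioo c d) fun x => u x - W x := by
  have hWc : Continuous W := continuous_iff_continuousAt.2 fun x => (hW x).continuousAt
  suffices ConcaveOn ℝ (Ioo c d) fun x => (u x - W x) - 0 / 2 * x ^ 2 by simpa using this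
  refine concaveOn_of_touchesBelow_le (hu.1.sub hWc).continuousOn fun x hx p s hT => ?_
  refine le_of_forall_pos_le_add fun ε hε => ?_
  have hTW : TouchesBelow W x (W₁ x) (F x - ε) :=
    touchesBelow_of_hasDerivAt (Eventually.of_forall hW)
      (eventually_le_of_hasDerivWithinAt_Ioi (hW₁ x).hasDerivWithinAt (by linarith))
      (eventually_le_of_hasDerivWithinAt_Iio (hW₁ x).hasDerivWithinAt (by linarith))
  have hTu : TouchesBelow u x (p + W₁ x) (s + (F x - ε)) := by
    filter_upwards [hT, hTW] with y hy hyW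
    linarith
  have hsup := (isViscositySupersolution_iff.1 hu).2 x _ _ hTu
  rw [hTu.eq_of_hasDerivAt (hd x hx).hasDerivAt, ← hF x hx] at hsup
  have hmul : a x * (s - ε) ≤ a x * 0 := by linarith
  linarith [le_of_mul_le_mul_left hmul (ha x hx)]

lemma exists_primitive_of_continuousOn {f : ℝ → ℝ} {c d : ℝ} (hcd : c ≤ d)
    (hf : ContinuousOn f (Icc c d)) :
    ∃ F W : ℝ → ℝ, Continuous F ∧ EqOn F f (Icc c d) ∧ ∀ x, HasDerivAt W (F x) x := by
  have hF : Continuous (IccExtend hcd ((Icc c d).domRestrict f)) :=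
    (continuousOn_iff_continuous_domRestrict.1 hf).Icc_extend'
  exact ⟨_, _, hF, fun x hx => IccExtend_of_mem _ _ hx,
    fun x => (hF.integral_hasStrictDerivAt c x).hasDerivAt⟩

section Regularity

variable {M : ℝ → ℝ} {a : ℝ → ℝ} {H : ℝ → ℝ → ℝ} {lam : ℝ} {u : ℝ → ℝ}

lemma IsViscositySolution.exists_semiconcave_semiconvex (h : Admissible M a H)
    (hu : IsViscositySolution a H lam u) (hL : IsLip u) {x : ℝ} (hx : 0 < a x) :
    ∃ ρ > 0, ∃ C, (∀ y ∈ Ioo (x - ρ) (x + ρ), 0 < a y) ∧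
      ConcaveOn ℝ (Ioo (x - ρ) (x + ρ)) (fun x => u x - C / 2 * x ^ 2) ∧
      ConcaveOn ℝ (Ioo (x - ρ) (x + ρ)) (fun x => -u x - C / 2 * x ^ 2) := by
  obtain ⟨K, hK⟩ := hL
  obtain ⟨B, hB, hHB⟩ := h.H_bdd K
  obtain ⟨ρ, hρ, haρ⟩ := Metric.eventually_nhds_iff.1
    (h.continuous_a.continuousAt.eventually (lt_mem_nhds (half_lt_self hx)))
  have ha (y) (hy : y ∈ Ioo (x - ρ) (x + ρ)) : a x / 2 ≤ a y :=
    (haρ (abs_lt.2 ⟨by linarith [hy.1], by linarith [hy.2]⟩)).le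
  refine ⟨ρ, hρ, (|lam| + B) / (a x / 2), fun y hy => (half_pos hx).trans_le (ha y hy), ?_, ?_⟩
  · exact hu.2.semiconcave hK (half_pos hx) ha (by positivity) fun y p hp => by
      linarith [(abs_le.1 (hHB y p hp)).1, le_abs_self lam]
  · exact (isViscositySubsolution_iff_neg.1 hu.1).semiconcave hK.neg (half_pos hx) ha
      (by positivity) fun y p hp => by
        linarith [(abs_le.1 (hHB y (-p) (by simpa))).2, neg_abs_le lam]

lemma IsViscositySolution.deriv_sub_eq {c d : ℝ} {F W₁ W : ℝ → ℝ}
    (hu : IsViscositySolution a H lam u) (ha : ∀ x ∈ Ioo c d, 0 < a x)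
    (hd : ∀ x ∈ Ioo c d, DifferentiableAt ℝ u x)
    (hF : ∀ x ∈ Ioo c d, a x * F x + H x (deriv u x) = lam)
    (hW₁ : ∀ x, HasDerivAt W₁ (F x) x) (hW : ∀ x, HasDerivAt W (W₁ x) x) {x y : ℝ}
    (hx : x ∈ Ioo c d) (hy : y ∈ Ioo c d) : deriv u y - W₁ y = deriv u x - W₁ x := by
  have hcave := hu.2.concaveOn_sub ha hd hF hW₁ hW
  have hvex : ConcaveOn ℝ (Ioo c d) fun x => -(u x - W x) := by
    have hneg := (isViscositySubsolution_iff_neg.1 hu.1).concaveOn_sub (F := fun x => -F x) ha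
      (fun x hx => (hd x hx).fun_neg)
      (fun x hx => by rw [deriv.fun_neg, neg_neg]; linarith [hF x hx])
      (fun x => (hW₁ x).fun_neg) (fun x => (hW x).fun_neg)
    exact hneg.congr fun x _ => by ring
  have hderiv (z) (hz : z ∈ Ioo c d) := ((hd z hz).hasDerivAt.fun_sub (hW z)).deriv
  rw [← hderiv x hx, ← hderiv y hy]
  exact deriv_eq_of_concaveOn_of_concaveOn_neg hcave hvex hx hy

theorem IsViscositySolution.hasDerivAt_deriv (h : Admissible M a H)
    (hu : IsViscositySolution a H lam u) (hL : IsLip u) {x : ℝ} (hx : 0 < a x) :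
    DifferentiableAt ℝ u x ∧ HasDerivAt (deriv u) ((lam - H x (deriv u x)) / a x) x := by
  obtain ⟨ρ, hρ, C, hpos, hcave, hvex⟩ := hu.exists_semiconcave_semiconvex h hL hx
  have hdiff (y) (hy : y ∈ Ioo (x - ρ) (x + ρ)) : DifferentiableAt ℝ u y :=
    differentiableAt_of_semiconcave_semiconvex hcave hvex hy
  refine ⟨hdiff x ⟨by linarith, by linarith⟩, ?_⟩
  have hslope : ContinuousOn (fun y => (y, deriv u y)) (Ioo (x - ρ) (x + ρ)) :=
    continuousOn_id.prodMk (continuousOn_deriv_of_semiconcave_semiconvex hcave hvex)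
  have hsecond : ContinuousOn (fun y => (lam - H y (deriv u y)) / a y) (Ioo (x - ρ) (x + ρ)) :=
    (continuousOn_const.sub (h.continuous_H.comp_continuousOn hslope)).div
      h.continuous_a.continuousOn fun y hy => (hpos y hy).ne'
  have hsub : Icc (x - ρ / 2) (x + ρ / 2) ⊆ Ioo (x - ρ) (x + ρ) :=
    Icc_subset_Ioo (by linarith) (by linarith)
  obtain ⟨F, W₁, -, hF, hW₁⟩ := exists_primitive_of_continuousOn (by linarith) (hsecond.mono hsub)
  have hW₁c : Continuous W₁ := continuous_iff_continuousAt.2 fun y => (hW₁ y).continuousAt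
  have hsub' : Ioo (x - ρ / 2) (x + ρ / 2) ⊆ Ioo (x - ρ) (x + ρ) := Ioo_subset_Icc_self.trans hsub
  have hx' : x ∈ Ioo (x - ρ / 2) (x + ρ / 2) := ⟨by linarith, by linarith⟩
  have hequ (y) (hy : y ∈ Ioo (x - ρ / 2) (x + ρ / 2)) :
      a y * F y + H y (deriv u y) = lam := by
    rw [hF (Ioo_subset_Icc_self hy), mul_div_cancel₀ _ (hpos y (hsub' hy)).ne']
    ring
  have hloc : deriv u =ᶠ[𝓝 x] fun y => W₁ y + (deriv u x - W₁ x) := by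
    filter_upwards [Ioo_mem_nhds hx'.1 hx'.2] with y hy
    linarith [hu.deriv_sub_eq (fun y hy => hpos y (hsub' hy)) (fun y hy => hdiff y (hsub' hy))
      hequ hW₁ (fun y => (hW₁c.integral_hasStrictDerivAt x y).hasDerivAt) hx' hy]
  have hderiv := ((hW₁ x).add_const (deriv u x - W₁ x)).congr_of_eventuallyEq hloc
  rwa [hF (Ioo_subset_Icc_self hx')] at hderiv

end Regularity

section Supersolutions

variable {M : ℝ → ℝ} {a : ℝ → ℝ} {H : ℝ → ℝ → ℝ} {lam : ℝ} {w : ℝ → ℝ}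

lemma IsViscositySupersolution.le_of_isLocalMin {φ P : ℝ → ℝ} {x s : ℝ}
    (hw : IsViscositySupersolution a H lam w) (hφ : ∀ᶠ y in 𝓝 x, HasDerivAt φ (P y) y)
    (hP : HasDerivAt P s x) (hmin : IsLocalMin (fun y => w y - φ y) x) :
    a x * s + H x (P x) ≤ lam := by
  refine mul_add_le_of_forall_pos fun ε hε => ?_
  have hT : TouchesBelow φ x (P x) (s - ε) :=
    touchesBelow_of_hasDerivAt hφ
      (eventually_le_of_hasDerivWithinAt_Ioi hP.hasDerivWithinAt (by linarith))
      (eventually_le_of_hasDerivWithinAt_Iio hP.hasDerivWithinAt (by linarith))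
  exact (isViscositySupersolution_iff.1 hw).2 x _ _ (hT.of_isLocalMin hmin)

lemma IsViscositySupersolution.mono {mu : ℝ} (hw : IsViscositySupersolution a H lam w)
    (hle : lam ≤ mu) : IsViscositySupersolution a H mu w :=
  ⟨hw.1, fun φ hφ x hx => (hw.2 φ hφ x hx).trans hle⟩

lemma TouchesBelow.reflect {u : ℝ → ℝ} {x p s : ℝ} (h : TouchesBelow (fun y => u (-y)) x p s) :
    TouchesBelow u (-x) (-p) s := by
  have hneg : Tendsto (fun y : ℝ => -y) (𝓝 (-x)) (𝓝 x) := by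
    simpa using continuous_neg.tendsto (-x)
  filter_upwards [hneg.eventually h] with y hy
  simp only [neg_neg] at hy
  linarith

lemma IsViscositySupersolution.reflect (hw : IsViscositySupersolution a H lam w) :
    IsViscositySupersolution (fun x => a (-x)) (fun x p => H (-x) (-p)) lam
      (fun x => w (-x)) := by
  rw [isViscositySupersolution_iff] at hw ⊢
  exact ⟨hw.1.comp continuous_neg, fun x p s hT => hw.2 _ _ _ hT.reflect⟩

lemma IsViscositySolution.reflect (hw : IsViscositySolution a H lam w) :
    IsViscositySolution (fun x => a (-x)) (fun x p => H (-x) (-p)) lam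
      (fun x => w (-x)) := by
  refine ⟨?_, hw.2.reflect⟩
  rw [isViscositySubsolution_iff_neg]
  exact (isViscositySubsolution_iff_neg.1 hw.1).reflect

lemma IsViscositySupersolution.translate (hw : IsViscositySupersolution a H lam w) (z : ℝ) :
    IsViscositySupersolution (fun x => a (x + z)) (fun x p => H (x + z) p) lam
      (fun x => w (x + z)) := by
  rw [isViscositySupersolution_iff] at hw ⊢
  refine ⟨hw.1.comp (continuous_add_const z), fun x p s hT => hw.2 _ _ _ ?_⟩
  have hshift : Tendsto (fun y : ℝ => y - z) (𝓝 (x + z)) (𝓝 x) := by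
    simpa using (continuous_sub_right z).tendsto (x + z)
  filter_upwards [hshift.eventually hT] with y hy
  simp only [sub_add_cancel] at hy
  linarith

lemma IsViscositySupersolution.exists_H_le (hw : IsViscositySupersolution a H lam w)
    {z p r ω B : ℝ} (hr : 0 < r) (hω : 0 < ω) (hB0 : 0 ≤ B) (hB : ∀ x, a x ≤ B * (x - z) ^ 2)
    (hosc : ∀ y, |y - z| ≤ r → |w y - w z - p * (y - z)| ≤ ω) :
    ∃ y q, |y - z| < r ∧ |q - p| ≤ 4 * ω / r ∧ H y q ≤ lam + 4 * B * ω := by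
  set C := 4 * ω / r ^ 2
  have hC0 : 0 < C := by positivity
  have hCr : C * r ^ 2 = 4 * ω := div_mul_cancel₀ _ (by positivity)
  set g : ℝ → ℝ := fun y => w y - w z - p * (y - z) + C / 2 * (y - z) ^ 2 with hg
  have hgc : Continuous g := by
    have := hw.1
    fun_prop
  have hzI : z ∈ Icc (z - r) (z + r) := by constructor <;> linarith
  obtain ⟨y, hy, hymin⟩ := isCompact_Icc.exists_isMinOn ⟨z, hzI⟩ hgc.continuousOn
  have hyr : |y - z| < r := by
    have hgy : g y ≤ 0 := (hymin hzI).trans_eq (by simp [hg])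
    have hlow := (abs_le.1 (hosc y (abs_le.2 ⟨by linarith [hy.1], by linarith [hy.2]⟩))).1
    have hsq : C * (2 * (y - z) ^ 2) ≤ C * r ^ 2 := by simp only [hg] at hgy; linarith
    exact abs_lt_of_sq_lt_sq (by nlinarith [le_of_mul_le_mul_left hsq hC0]) hr.le
  obtain ⟨hyl, hyu⟩ := abs_lt.1 hyr
  have hT : TouchesBelow w y (p - C * (y - z)) (-C) := by
    filter_upwards [Icc_mem_nhds (show z - r < y by linarith) (show y < z + r by linarith)]
      with x hx
    have hyx := hymin hx
    simp only [mem_ofPred_eq, hg] at hyx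
    linarith
  refine ⟨y, p - C * (y - z), hyr, ?_, ?_⟩
  · rw [sub_sub_cancel_left, abs_neg, abs_mul, abs_of_pos hC0, le_div_iff₀ hr, ← hCr, sq,
      ← mul_assoc]
    gcongr
  · have hsup := (isViscositySupersolution_iff.1 hw).2 _ _ _ hT
    have haC : a y * C ≤ 4 * B * ω := by
      calc a y * C ≤ (B * |y - z| ^ 2) * C := by rw [sq_abs]; gcongr; exact hB y
        _ ≤ (B * r ^ 2) * C := by gcongr
        _ = B * (C * r ^ 2) := by ring
        _ = 4 * B * ω := by rw [hCr]; ring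
    linarith

lemma IsViscositySupersolution.exists_H_lt_of_a_eq_zero (h : Admissible M a H)
    (hw : IsViscositySupersolution a H lam w) {z mu : ℝ} (hz : a z = 0) (hmu : lam < mu) :
    ∃ p, H z p < mu := by
  obtain ⟨B, hB, haB⟩ := h.a_quad
  obtain ⟨L, hL, hHL⟩ := h.H_lip (M mu)
  have hgap : 0 < mu - lam := sub_pos.2 hmu
  set ω := (mu - lam) / (8 * B) with hω
  have hω0 : 0 < ω := div_pos hgap (by positivity)
  have hωB : 4 * B * ω = (mu - lam) / 2 := by rw [hω]; field_simp; norm_num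
  obtain ⟨ρ, hρ, hosc⟩ := Metric.continuous_iff.1 hw.1 z ω hω0
  set r := min (ρ / 2) ((mu - lam) / (4 * L))
  have hr : 0 < r := lt_min (half_pos hρ) (div_pos hgap (by positivity))
  obtain ⟨y, q, hyr, -, hq⟩ := hw.exists_H_le (p := 0) hr hω0 hB.le
    (fun x => haB z x hz) fun y hy => by
      rw [zero_mul, sub_zero]
      exact (hosc y (hy.trans_lt ((min_le_left _ _).trans_lt (half_lt_self hρ)))).le
  have hqM : |q| ≤ M mu := (h.abs_lt_of_H_le (x := y) (by linarith)).le
  have hHzy : H z q - H y q ≤ L * |z - y| := by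
    simpa using (le_abs_self _).trans (hHL z y q q hqM hqM)
  have hLzy : L * |z - y| ≤ (mu - lam) / 4 := by
    rw [abs_sub_comm]
    have hy : |y - z| ≤ (mu - lam) / (4 * L) := hyr.le.trans (min_le_right _ _)
    calc L * |y - z| ≤ L * ((mu - lam) / (4 * L)) := by gcongr
      _ = (mu - lam) / 4 := by field_simp
  exact ⟨q, by linarith⟩

lemma IsViscositySupersolution.exists_H_le_of_hasDerivAt (hw : IsViscositySupersolution a H lam w)
    {z p B ε : ℝ} (hB0 : 0 ≤ B) (hB : ∀ x, a x ≤ B * (x - z) ^ 2) (hp : HasDerivAt w p z)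
    (hε : 0 < ε) :
    ∃ y q, |y - z| < ε ∧ |q - p| ≤ 4 * ε ∧ H y q ≤ lam + 4 * B * ε ^ 2 := by
  obtain ⟨ρ, hρ, hlin⟩ := Metric.eventually_nhds_iff.1 ((hasDerivAt_iff_isLittleO.1 hp).def hε)
  set r := min (ρ / 2) ε
  have hr : 0 < r := by positivity
  have hrε : r ≤ ε := min_le_right _ _
  obtain ⟨y, q, hyr, hq, hH⟩ := hw.exists_H_le (p := p) hr (mul_pos hε hr) hB0 hB fun y hy => by
    have hyρ : dist y z < ρ := hy.trans_lt ((min_le_left _ _).trans_lt (half_lt_self hρ))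
    have hyε := hlin hyρ
    simp only [smul_eq_mul, Real.norm_eq_abs] at hyε
    rw [mul_comm p]
    exact hyε.trans (by gcongr)
  refine ⟨y, q, hyr.trans_le hrε, hq.trans_eq ?_, hH.trans ?_⟩
  · rw [← mul_assoc, mul_div_cancel_right₀ _ hr.ne']
  · rw [sq]
    gcongr

lemma IsViscositySupersolution.H_le_of_hasDerivAt (hw : IsViscositySupersolution a H lam w)
    (hH : Continuous fun q : ℝ × ℝ => H q.1 q.2) {z p B : ℝ} (hB0 : 0 ≤ B)
    (hB : ∀ x, a x ≤ B * (x - z) ^ 2) (hp : HasDerivAt w p z) : H z p ≤ lam := by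
  by_contra! hlt
  obtain ⟨mu, hmu, hmuH⟩ := exists_between hlt
  obtain ⟨ρ, hρ, hnear⟩ := Metric.eventually_nhds_iff.1
    ((hH.tendsto (z, p)).eventually (lt_mem_nhds hmuH))
  have hsmall : Tendsto (fun ε : ℝ => lam + 4 * B * ε ^ 2) (𝓝[>] 0) (𝓝 (lam + 4 * B * 0 ^ 2)) :=
    (Continuous.tendsto (by fun_prop) 0).mono_left nhdsWithin_le_nhds
  obtain ⟨ε, hεmu, hε, hερ⟩ := ((hsmall.eventually (gt_mem_nhds (by simpa using hmu))).and
    (Ioo_mem_nhdsGT (show 0 < ρ / 4 by positivity))).exists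
  obtain ⟨y, q, hy, hq, hHyq⟩ := hw.exists_H_le_of_hasDerivAt hB0 hB hp hε
  have hclose : dist (y, q) (z, p) < ρ := by
    rw [Prod.dist_eq, max_lt_iff, Real.dist_eq, Real.dist_eq]
    constructor <;> linarith
  exact (hnear hclose).not_ge (hHyq.trans hεmu.le)

lemma IsViscositySolution.H_eq_of_hasDerivAt (h : Admissible M a H)
    (hw : IsViscositySolution a H lam w) {z p : ℝ} (hz : a z = 0) (hp : HasDerivAt w p z) :
    H z p = lam := by
  obtain ⟨B, hB, haB⟩ := h.a_quad
  have hneg : Continuous fun q : ℝ × ℝ => -H q.1 (-q.2) :=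
    (h.continuous_H.comp (f := fun q : ℝ × ℝ => (q.1, -q.2)) (by fun_prop)).neg
  have hge := (isViscositySubsolution_iff_neg.1 hw.1).H_le_of_hasDerivAt hneg hB.le
    (fun x => haB z x hz) hp.fun_neg
  rw [neg_neg, neg_le_neg_iff] at hge
  exact (hw.2.H_le_of_hasDerivAt h.continuous_H hB.le (fun x => haB z x hz) hp).antisymm hge

/-- A function `φ` with `φ'' = -(φ') ^ 2` and `φ'` large is a strict barrier, because `H` grows
faster than `p ^ 2` while `a ≤ 1`. -/
lemma IsViscositySupersolution.not_isLocalMin_of_hasDerivAt_neg_sq (h : Admissible M a H)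
    (hw : IsViscositySupersolution a H lam w) {φ P : ℝ → ℝ} {x : ℝ}
    (hφ : ∀ᶠ y in 𝓝 x, HasDerivAt φ (P y) y) (hP : HasDerivAt P (-(P x) ^ 2) x)
    (hlarge : M lam ≤ |P x|) : ¬IsLocalMin (fun y => w y - φ y) x := fun hmin => by
  have hsup := hw.le_of_isLocalMin hφ hP hmin
  nlinarith [h.coercive lam x (P x) hlarge, h.a_le_one x, sq_nonneg (P x)]

lemma hasDerivAt_one_sub_mul_sub (R x t : ℝ) :
    HasDerivAt (fun t => 1 - R * (t - x)) (-R) t := by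
  simpa using (((hasDerivAt_id t).sub_const x).const_mul R).const_sub 1

lemma hasDerivAt_neg_div_one_sub_mul_sub {R x t : ℝ} (ht : R * (t - x) < 1) :
    HasDerivAt (fun t => -R / (1 - R * (t - x))) (-(-R / (1 - R * (t - x))) ^ 2) t := by
  refine ((hasDerivAt_const t (-R)).fun_div (hasDerivAt_one_sub_mul_sub R x t)
    (sub_pos.2 ht).ne').congr_deriv ?_
  rw [div_pow]
  ring

lemma tendsto_log_one_sub_mul_sub {R : ℝ} (hR : 0 < R) (x : ℝ) :
    Tendsto (fun t => Real.log (1 - R * (t - x))) (𝓝[<] (x + 1 / R)) atBot := by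
  refine Real.tendsto_log_nhdsGT_zero.comp (tendsto_nhdsWithin_iff.2 ⟨?_, ?_⟩)
  · have hlim := (hasDerivAt_one_sub_mul_sub R x (x + 1 / R)).continuousAt.tendsto
    rw [add_sub_cancel_left, mul_one_div_cancel hR.ne', sub_self] at hlim
    exact hlim.mono_left nhdsWithin_le_nhds
  · filter_upwards [self_mem_nhdsWithin] with t (ht : t < x + 1 / R)
    have hlt : R * (t - x) < R * (1 / R) := by gcongr; linarith
    rw [mul_one_div_cancel hR.ne'] at hlt
    exact sub_pos.2 hlt

/-- The barrier `log (1 - M lam * (t - x))` solves `φ'' = -(φ') ^ 2` and tends to `-∞` at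
`x + 1 / M lam`. -/
lemma IsViscositySupersolution.add_log_le (h : Admissible M a H)
    (hw : IsViscositySupersolution a H lam w) {x y : ℝ} (hxy : x < y)
    (hy : M lam * (y - x) < 1) : w x + Real.log (1 - M lam * (y - x)) ≤ w y := by
  set R := M lam
  have hR : 0 < R := one_pos.trans_le (h.one_le_M lam)
  by_contra! hdrop
  set e := x + 1 / R
  have hlt_one {t : ℝ} (ht : t < e) : R * (t - x) < 1 := by
    rw [mul_comm, ← lt_div_iff₀ hR]
    exact sub_left_lt_of_lt_add ht
  have hye : y < e := by
    rw [mul_comm, ← lt_div_iff₀ hR] at hy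
    exact lt_add_of_sub_left_lt hy
  obtain ⟨b, hlog, hwb, hyb, hbe⟩ :
      ∃ b, Real.log (1 - R * (b - x)) < w e - 1 - w x ∧ w e - 1 < w b ∧ y < b ∧ b < e :=
    (((tendsto_log_one_sub_mul_sub hR x).eventually_lt_atBot _).and
      ((((hw.1.tendsto e).eventually (lt_mem_nhds (sub_one_lt _))).filter_mono
        nhdsWithin_le_nhds).and (Ioo_mem_nhdsLT hye))).exists
  set φ : ℝ → ℝ := fun t => Real.log (1 - R * (t - x)) with hφ
  have hφ' {t : ℝ} (ht : t < e) : HasDerivAt φ (-R / (1 - R * (t - x))) t :=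
    (hasDerivAt_one_sub_mul_sub R x t).log (sub_pos.2 (hlt_one ht)).ne'
  set g : ℝ → ℝ := fun t => w t - φ t with hg
  have hgc : ContinuousOn g (Icc x b) := hw.1.continuousOn.sub fun t ht =>
    (hφ' (ht.2.trans_lt hbe)).continuousAt.continuousWithinAt
  have hgy : g y < w x := sub_lt_iff_lt_add.2 hdrop
  have hends : ∀ t ∈ Icc x b \ Ioo x b, g y < g t := by
    rw [Icc_sdiff_Ioo_same (hxy.trans hyb).le]
    rintro t (rfl | rfl)
    · simpa [hg, hφ] using hgy
    · exact hgy.trans (by simp only [hg, hφ]; linarith)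
  obtain ⟨t, htI, htmin⟩ := isCompact_Icc.exists_isLocalMin_mem_open Ioo_subset_Icc_self hgc
    ⟨hxy.le, hyb.le⟩ hends isOpen_Ioo
  have hte := htI.2.trans hbe
  refine hw.not_isLocalMin_of_hasDerivAt_neg_sq h
    ((eventually_lt_nhds hte).mono fun s hs => hφ' hs)
    (hasDerivAt_neg_div_one_sub_mul_sub (hlt_one hte)) ?_ htmin
  have hpos : 0 < 1 - R * (t - x) := sub_pos.2 (hlt_one hte)
  rw [abs_div, abs_neg, abs_of_pos hR, abs_of_pos hpos]
  exact le_div_self hR.le hpos (sub_le_self _ (mul_nonneg hR.le (sub_nonneg.2 htI.1.le)))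

lemma IsViscositySupersolution.add_log_le' (h : Admissible M a H)
    (hw : IsViscositySupersolution a H lam w) {x y : ℝ} (hxy : y < x)
    (hy : M lam * (x - y) < 1) : w x + Real.log (1 - M lam * (x - y)) ≤ w y := by
  have hrefl := hw.reflect.add_log_le h.reflect (x := -x) (y := -y) (by linarith)
    (by rwa [neg_sub_neg])
  rwa [neg_neg, neg_neg, neg_sub_neg] at hrefl

end Supersolutions

/-- `p` solves `a p' + H(y, p) = lam` on `[c, d]`, the equation for the slope of a solution. -/
def SolvesOn (a : ℝ → ℝ) (H : ℝ → ℝ → ℝ) (lam c d : ℝ) (p : ℝ → ℝ) : Prop :=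
  ∀ y ∈ Icc c d, HasDerivWithinAt p ((lam - H y (p y)) / a y) (Icc c d) y

lemma le_of_deriv_lt_of_eq {f f' g g' : ℝ → ℝ} {c d : ℝ}
    (hf : ∀ y ∈ Icc c d, HasDerivWithinAt f (f' y) (Icc c d) y)
    (hg : ∀ y ∈ Icc c d, HasDerivWithinAt g (g' y) (Icc c d) y) (hfg : f c ≤ g c)
    (hlt : ∀ y ∈ Icc c d, f y = g y → f' y < g' y) : ∀ y ∈ Icc c d, f y ≤ g y := by
  have hmem (y) (hy : y ∈ Ico c d) : Icc c d ∈ 𝓝[≥] y := Icc_mem_nhdsGE_of_mem hy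
  exact image_le_of_deriv_right_lt_deriv_boundary'
    (fun y hy => (hf y hy).continuousWithinAt)
    (fun y hy => (hf y (Ico_subset_Icc_self hy)).mono_of_mem_nhdsWithin (hmem y hy)) hfg
    (fun y hy => (hg y hy).continuousWithinAt)
    (fun y hy => (hg y (Ico_subset_Icc_self hy)).mono_of_mem_nhdsWithin (hmem y hy))
    fun y hy => hlt y (Ico_subset_Icc_self hy)

lemma exists_eq_and_forall_le_of_lt {f : ℝ → ℝ} {c d v : ℝ} (hcd : c ≤ d)
    (hf : ContinuousOn f (Icc c d)) (hc : v < f c) (hd : f d ≤ v) :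
    ∃ e ∈ Ioc c d, f e = v ∧ ∀ y ∈ Icc c e, v ≤ f y := by
  have hcompact : IsCompact (Icc c d ∩ f ⁻¹' Iic v) :=
    isCompact_Icc.of_isClosed_subset (hf.preimage_isClosed_of_isClosed isClosed_Icc isClosed_Iic)
      inter_subset_left
  obtain ⟨e, ⟨heI, hev⟩, hleast⟩ := hcompact.exists_isLeast ⟨d, ⟨hcd, le_rfl⟩, hd⟩
  have hce : c < e := lt_of_le_of_ne heI.1 fun heq => (heq ▸ hc).not_ge hev
  obtain ⟨e', he'I, he'⟩ := intermediate_value_Icc' heI.1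
    (hf.mono (Icc_subset_Icc_right heI.2)) ⟨hev, hc.le⟩
  have hee' : e = e' := (hleast ⟨⟨he'I.1, he'I.2.trans heI.2⟩, he'.le⟩).antisymm he'I.2
  have hfe : f e = v := hee' ▸ he'
  refine ⟨e, ⟨hce, heI.2⟩, hfe, fun y hy => ?_⟩
  by_contra! hlt
  have hye : y = e := hy.2.antisymm (hleast ⟨⟨hy.1, hy.2.trans heI.2⟩, hlt.le⟩)
  exact hlt.ne (hye ▸ hfe)

lemma abs_projIcc_neg_le {R : ℝ} (hR : -R ≤ R) (t : ℝ) : |(projIcc (-R) R hR t : ℝ)| ≤ R :=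
  abs_le.2 (projIcc (-R) R hR t).2

lemma abs_projIcc_sub_projIcc_le {c d : ℝ} (hcd : c ≤ d) (s t : ℝ) :
    |(projIcc c d hcd s : ℝ) - projIcc c d hcd t| ≤ |s - t| := by
  simpa [Real.dist_eq, Subtype.dist_eq] using (LipschitzWith.projIcc hcd).dist_le_mul s t

lemma coe_projIcc_neg_of_abs_le {R : ℝ} (hR : -R ≤ R) {t : ℝ} (ht : |t| ≤ R) :
    (projIcc (-R) R hR t : ℝ) = t :=
  congrArg Subtype.val (projIcc_of_mem hR (abs_le.1 ht))

section Existence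

variable {M : ℝ → ℝ} {a : ℝ → ℝ} {H : ℝ → ℝ → ℝ} {lam mu c d R : ℝ} {p w : ℝ → ℝ}

lemma SolvesOn.mono (hp : SolvesOn a H lam c d p) {c' d' : ℝ} (hc : c ≤ c') (hd : d' ≤ d) :
    SolvesOn a H lam c' d' p :=
  fun y hy => (hp y (Icc_subset_Icc hc hd hy)).mono (Icc_subset_Icc hc hd)

lemma SolvesOn.hasDerivAt (hp : SolvesOn a H lam c d p) {y : ℝ} (hy : y ∈ Ioo c d) :
    HasDerivAt p ((lam - H y (p y)) / a y) y :=
  (hp y (Ioo_subset_Icc_self hy)).hasDerivAt (Icc_mem_nhds hy.1 hy.2)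

lemma SolvesOn.continuousOn (hp : SolvesOn a H lam c d p) : ContinuousOn p (Icc c d) :=
  fun y hy => (hp y hy).continuousWithinAt

lemma Admissible.exists_pos_le (h : Admissible M a H) (hcd : c ≤ d)
    (ha : ∀ y ∈ Icc c d, 0 < a y) : ∃ m > 0, ∀ y ∈ Icc c d, m ≤ a y := by
  obtain ⟨m, hm, hmin⟩ := isCompact_Icc.exists_isMinOn ⟨c, le_rfl, hcd⟩
    h.continuous_a.continuousOn
  exact ⟨a m, ha m hm, fun y hy => hmin hy⟩

lemma Admissible.exists_clamped_solution (h : Admissible M a H) (hcd : c ≤ d)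
    (ha : ∀ y ∈ Icc c d, 0 < a y) (hR : -R ≤ R) (lam p₀ : ℝ) :
    ∃ p : ℝ → ℝ, p c = p₀ ∧ ∀ y ∈ Icc c d,
      HasDerivWithinAt p ((lam - H y (projIcc (-R) R hR (p y))) / a y) (Icc c d) y := by
  obtain ⟨m, hm, hma⟩ := h.exists_pos_le hcd ha
  obtain ⟨L, hL, hHL⟩ := h.H_lip R
  obtain ⟨B, hB, hHB⟩ := h.H_bdd R
  let K : NNReal := ⟨L / m, by positivity⟩
  let N : NNReal := ⟨(|lam| + B) / m, by positivity⟩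
  let A : NNReal := ⟨(|lam| + B) / m * (d - c), mul_nonneg (by positivity) (by linarith)⟩
  have hPL : IsPicardLindelof (fun y q => (lam - H y (projIcc (-R) R hR q)) / a y)
      (tmin := c) (tmax := d) ⟨c, le_rfl, hcd⟩ p₀ A 0 N K := by
    refine ⟨fun y hy => LipschitzOnWith.of_dist_le_mul fun q _ r _ => ?_, fun q _ => ?_,
      fun y hy q _ => ?_, ?_⟩
    · rw [Real.dist_eq, Real.dist_eq, ← sub_div, sub_sub_sub_cancel_left, abs_div,
        abs_of_pos (ha y hy), div_le_iff₀ (ha y hy)]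
      have hlip := hHL y y _ _ (abs_projIcc_neg_le hR r) (abs_projIcc_neg_le hR q)
      rw [sub_self, abs_zero, zero_add] at hlip
      calc _ ≤ L * |(projIcc (-R) R hR r : ℝ) - projIcc (-R) R hR q| := hlip
        _ ≤ L * |q - r| := by
          rw [abs_sub_comm q]
          exact mul_le_mul_of_nonneg_left (abs_projIcc_sub_projIcc_le hR r q) hL.le
        _ = L / m * |q - r| * m := by field_simp
        _ ≤ L / m * |q - r| * a y := by gcongr; exact hma y hy
    · have hnum : Continuous fun y => lam - H y (projIcc (-R) R hR q) :=
        continuous_const.sub (h.continuous_H_comp continuous_id continuous_const)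
      exact hnum.continuousOn.div h.continuous_a.continuousOn fun y hy => (ha y hy).ne'
    · rw [Real.norm_eq_abs, abs_div, abs_of_pos (ha y hy), div_le_iff₀ (ha y hy)]
      calc |lam - H y (projIcc (-R) R hR q)| ≤ |lam| + B :=
            (abs_sub _ _).trans (by gcongr; exact hHB _ _ (abs_projIcc_neg_le hR q))
        _ = (|lam| + B) / m * m := by field_simp
        _ ≤ (|lam| + B) / m * a y := by gcongr; exact hma y hy
    · rw [NNReal.coe_zero, sub_zero, sub_self, max_eq_left (by linarith)]
      exact le_rfl
  exact hPL.exists_eq_forall_mem_Icc_hasDerivWithinAt₀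

lemma Admissible.neg_le_self_of_M_le (h : Admissible M a H) (hR : M lam ≤ R) : -R ≤ R :=
  neg_le_self (by linarith [h.one_le_M lam])

lemma Admissible.exists_clamped_solution_le (h : Admissible M a H) (hcd : c ≤ d)
    (ha : ∀ y ∈ Icc c d, 0 < a y) (hR : M lam ≤ R) :
    ∃ p : ℝ → ℝ, p c = R ∧ (∀ y ∈ Icc c d, p y ≤ R) ∧ ∀ y ∈ Icc c d,
      HasDerivWithinAt p
        ((lam - H y (projIcc (-R) R (h.neg_le_self_of_M_le hR) (p y))) / a y) (Icc c d) y := by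
  have habs : |R| = R := abs_of_nonneg (by linarith [h.one_le_M lam])
  obtain ⟨p, hpc, hp⟩ := h.exists_clamped_solution hcd ha (h.neg_le_self_of_M_le hR) lam R
  refine ⟨p, hpc, le_of_deriv_lt_of_eq hp (g' := fun _ => 0)
    (fun y _ => hasDerivWithinAt_const _ _ _) hpc.le fun y hy he => ?_, hp⟩
  rw [he, coe_projIcc_neg_of_abs_le _ habs.le]
  exact div_neg_of_neg_of_pos
    (by linarith [h.coercive lam y R (by rwa [habs]), sq_nonneg R]) (ha y hy)

lemma Admissible.exists_solvesOn_of_barrier (h : Admissible M a H) (hcd : c ≤ d)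
    (ha : ∀ y ∈ Icc c d, 0 < a y) (hR : M lam ≤ R) (hmu : mu < lam) {g g' : ℝ → ℝ}
    (hg : ∀ y ∈ Icc c d, HasDerivWithinAt g (g' y) (Icc c d) y)
    (hgR : ∀ y ∈ Icc c d, |g y| ≤ R) (hgH : ∀ y ∈ Icc c d, a y * g' y + H y (g y) ≤ mu) :
    ∃ p : ℝ → ℝ, p c = R ∧ SolvesOn a H lam c d p ∧ ∀ y ∈ Icc c d, |p y| ≤ R ∧ g y ≤ p y := by
  obtain ⟨p, hpc, hpR, hp⟩ := h.exists_clamped_solution_le hcd ha hR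
  have hgp : ∀ y ∈ Icc c d, g y ≤ p y := by
    refine le_of_deriv_lt_of_eq hg hp ?_ fun y hy he => ?_
    · exact hpc ▸ (abs_le.1 (hgR c ⟨le_rfl, hcd⟩)).2
    · rw [← he, coe_projIcc_neg_of_abs_le _ (hgR y hy), lt_div_iff₀ (ha y hy)]
      linarith [hgH y hy]
  have hpa (y) (hy : y ∈ Icc c d) : |p y| ≤ R :=
    abs_le.2 ⟨(abs_le.1 (hgR y hy)).1.trans (hgp y hy), hpR y hy⟩
  refine ⟨p, hpc, fun y hy => ?_, fun y hy => ⟨hpa y hy, hgp y hy⟩⟩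
  have hderiv := hp y hy
  rwa [coe_projIcc_neg_of_abs_le _ (hpa y hy)] at hderiv

lemma IsViscositySupersolution.exists_sub_lt_of_hasDerivAt (h : Admissible M a H)
    (hw : IsViscositySupersolution a H lam w) {φ : ℝ → ℝ} (hcd : c < d) (hφ : HasDerivAt φ R c)
    (hR : M lam < R) : ∃ y ∈ Ioo c d, w y - φ y < w c - φ c := by
  have hM : 0 < M lam := one_pos.trans_le (h.one_le_M lam)
  have hlog : HasDerivAt (fun y => φ y + Real.log (1 - M lam * (y - c))) (R + -M lam) c := by
    simpa using hφ.fun_add ((hasDerivAt_one_sub_mul_sub (M lam) c c).log (by simp))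
  have hinc := eventually_le_of_hasDerivWithinAt_Ioi (s := (R - M lam) / 2)
    hlog.hasDerivWithinAt (by linarith)
  obtain ⟨y, hy, hyI⟩ := (hinc.and
    (Ioo_mem_nhdsGT (show c < min d (c + 1 / M lam) from lt_min hcd (by simpa)))).exists
  obtain ⟨hyd, hyM⟩ := lt_min_iff.1 hyI.2
  refine ⟨y, ⟨hyI.1, hyd⟩, ?_⟩
  have hsmall : M lam * (y - c) < 1 := by
    rw [mul_comm, ← lt_div_iff₀ hM]
    linarith
  have hdrop := hw.add_log_le' h hyI.1 hsmall
  have hpos : 0 < (R - M lam) / 2 * (y - c) := mul_pos (by linarith) (sub_pos.2 hyI.1)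
  simp only [sub_self, mul_zero, sub_zero, Real.log_one, add_zero] at hy
  linarith

lemma IsViscositySupersolution.exists_sub_lt_of_hasDerivAt_neg (h : Admissible M a H)
    (hw : IsViscositySupersolution a H lam w) {φ : ℝ → ℝ} (hcd : c < d) (hφ : HasDerivAt φ (-R) d)
    (hR : M lam < R) : ∃ y ∈ Ioo c d, w y - φ y < w d - φ d := by
  have hφ' : HasDerivAt (fun y => φ (-y)) R (-d) := by
    rw [← neg_neg d] at hφ
    simpa [Function.comp_def] using hφ.comp (-d) (hasDerivAt_neg (-d))
  obtain ⟨y, hy, hlt⟩ :=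
    hw.reflect.exists_sub_lt_of_hasDerivAt h.reflect (neg_lt_neg hcd) hφ' hR
  exact ⟨-y, ⟨by linarith [hy.2], by linarith [hy.1]⟩, by simpa using hlt⟩

/-- Minimizing `w - ∫ p` gives a contradiction both at an endpoint, where a supersolution cannot
follow slopes larger than `M`, and in the interior, where `p` solves the equation at a level above
that of `w`. -/
lemma IsViscositySupersolution.not_descends (h : Admissible M a H)
    (hw : IsViscositySupersolution a H mu w) (hmu : mu < lam) (hR : M lam < R) (hcd : c < d)
    (ha : ∀ y ∈ Icc c d, 0 < a y) (hp : SolvesOn a H lam c d p) (hpc : p c = R) :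
    p d ≠ -R := fun hpd => by
  have hR' : M mu < R := (h.mono_M hmu.le).trans_lt hR
  obtain ⟨P, φ, -, hP, hφ⟩ := exists_primitive_of_continuousOn hcd.le hp.continuousOn
  have hgc : Continuous fun y => w y - φ y :=
    hw.1.sub (continuous_iff_continuousAt.2 fun y => (hφ y).continuousAt)
  obtain ⟨x, hx, hmin⟩ := isCompact_Icc.exists_isMinOn ⟨c, le_rfl, hcd.le⟩ hgc.continuousOn
  have hPx := hP hx
  rcases hx.1.eq_or_lt with rfl | hcx
  · obtain ⟨y, hy, hlt⟩ :=
      hw.exists_sub_lt_of_hasDerivAt h hcd (hpc ▸ hPx ▸ hφ c) hR'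
    exact hlt.not_ge (hmin (Ioo_subset_Icc_self hy))
  rcases hx.2.eq_or_lt with rfl | hxd
  · obtain ⟨y, hy, hlt⟩ :=
      hw.exists_sub_lt_of_hasDerivAt_neg h hcd (hpd ▸ hPx ▸ hφ x) hR'
    exact hlt.not_ge (hmin (Ioo_subset_Icc_self hy))
  · have hnhds : Icc c d ∈ 𝓝 x := Icc_mem_nhds hcx hxd
    have hle := hw.le_of_isLocalMin (Eventually.of_forall hφ)
      ((hp.hasDerivAt ⟨hcx, hxd⟩).congr_of_eventuallyEq (eventually_of_mem hnhds hP))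
      (hmin.isLocalMin hnhds)
    rw [hPx, mul_div_cancel₀ _ (ha x hx).ne'] at hle
    linarith

lemma IsViscositySupersolution.exists_solvesOn (h : Admissible M a H)
    (hw : IsViscositySupersolution a H mu w) (hmu : mu < lam) (hR : M lam < R) (hcd : c ≤ d)
    (ha : ∀ y ∈ Icc c d, 0 < a y) :
    ∃ p : ℝ → ℝ, SolvesOn a H lam c d p ∧ ∀ y ∈ Icc c d, |p y| ≤ R := by
  obtain ⟨p, hpc, hpR, hp⟩ := h.exists_clamped_solution_le hcd ha hR.le
  have hsolves {e : ℝ} (he : e ≤ d) (hlow : ∀ y ∈ Icc c e, -R ≤ p y) : SolvesOn a H lam c e p := by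
    intro y hy
    have hsub : Icc c e ⊆ Icc c d := Icc_subset_Icc_right he
    have hderiv := (hp y (hsub hy)).mono hsub
    rwa [coe_projIcc_neg_of_abs_le _ (abs_le.2 ⟨hlow y hy, hpR y (hsub hy)⟩)] at hderiv
  suffices hlow : ∀ y ∈ Icc c d, -R ≤ p y from
    ⟨p, hsolves le_rfl hlow, fun y hy => abs_le.2 ⟨hlow y hy, hpR y hy⟩⟩
  intro e₀ he₀
  by_contra! hlt
  have hcont : ContinuousOn p (Icc c e₀) := fun y hy =>
    (hp y ⟨hy.1, hy.2.trans he₀.2⟩).continuousWithinAt.mono (Icc_subset_Icc_right he₀.2)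
  have hneg : -R < p c := by linarith [h.one_le_M lam]
  obtain ⟨e, he, hpe, hlow⟩ := exists_eq_and_forall_le_of_lt he₀.1 hcont hneg hlt.le
  have hed : e ≤ d := he.2.trans he₀.2
  exact hw.not_descends h hmu hR he.1 (fun y hy => ha y ⟨hy.1, hy.2.trans hed⟩)
    (hsolves hed hlow) hpc hpe

end Existence

lemma abs_div_sub_div_le {s t u v m N : ℝ} (hm : 0 < m) (hu : m ≤ u) (hv : m ≤ v)
    (hs : |s| ≤ N) : |t / v - s / u| ≤ |t - s| / m + N * (|u - v| / m ^ 2) := by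
  have hu0 : 0 < u := hm.trans_le hu
  have hv0 : 0 < v := hm.trans_le hv
  have hN : 0 ≤ N := (abs_nonneg s).trans hs
  have hsplit : t / v - s / u = (t - s) / v + s * ((u - v) / (v * u)) := by
    field_simp
    ring
  have hden : m ^ 2 ≤ v * u := by rw [sq]; gcongr
  calc |t / v - s / u| ≤ |t - s| / v + |s| * (|u - v| / (v * u)) := by
        rw [hsplit]
        refine (abs_add_le _ _).trans_eq ?_
        rw [abs_mul, abs_div, abs_div, abs_of_pos hv0, abs_of_pos (mul_pos hv0 hu0)]
    _ ≤ |t - s| / m + N * (|u - v| / m ^ 2) := by gcongr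

lemma hasDerivAt_of_quadratic_bound {p : ℝ → ℝ} {x D C ρ : ℝ} (hρ : 0 < ρ)
    (hb : ∀ y ∈ Icc (x - ρ) (x + ρ), |p y - p x - D * (y - x)| ≤ C * (y - x) ^ 2) :
    HasDerivAt p D x := by
  have hquad : (fun y => p y - p x - (y - x) • D) =O[𝓝 x] fun y => (y - x) ^ 2 := by
    refine Asymptotics.IsBigO.of_bound C ?_
    filter_upwards [Icc_mem_nhds (sub_lt_self x hρ) (lt_add_of_pos_right x hρ)] with y hy
    rw [Real.norm_eq_abs, Real.norm_eq_abs, abs_of_nonneg (sq_nonneg (y - x)), smul_eq_mul,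
      mul_comm (y - x)]
    exact hb y hy
  have hshift : Tendsto (fun y => y - x) (𝓝 x) (𝓝 0) := by
    simpa using (continuous_sub_right x).tendsto x
  have hsq : (fun t : ℝ => t ^ 2) =o[𝓝 0] fun t => t := by
    simpa using Asymptotics.isLittleO_pow_id (𝕜 := ℝ) one_lt_two
  exact hasDerivAt_iff_isLittleO.2 (hquad.trans_isLittleO (hsq.comp_tendsto hshift))

lemma exists_pointwise_limit {p : ℕ → ℝ → ℝ} {S : Set ℝ} {R : ℝ → ℝ}
    (hp : ∀ x ∈ S, ∀ᶠ n in atTop, |p n x| ≤ R x) :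
    ∃ (U : Ultrafilter ℕ) (q : ℝ → ℝ), (U : Filter ℕ) ≤ atTop ∧
      ∀ x ∈ S, |q x| ≤ R x ∧ Tendsto (fun n => p n x) U (𝓝 (q x)) := by
  have hU : (hyperfilter ℕ : Filter ℕ) ≤ atTop := by
    rw [← Nat.cofinite_eq_atTop]
    exact hyperfilter_le_cofinite
  have hlim (x : ℝ) (hx : x ∈ S) :
      ∃ t, |t| ≤ R x ∧ Tendsto (fun n => p n x) (hyperfilter ℕ : Filter ℕ) (𝓝 t) := by
    have hmem : ((hyperfilter ℕ).map fun n => p n x : Filter ℝ) ≤ 𝓟 (Icc (-R x) (R x)) :=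
      le_principal_iff.2 (((hp x hx).filter_mono hU).mono fun n hn => abs_le.1 hn)
    obtain ⟨t, ht, hlim⟩ := isCompact_Icc.ultrafilter_le_nhds _ hmem
    exact ⟨t, abs_le.2 ht, hlim⟩
  choose! q hq using hlim
  exact ⟨hyperfilter ℕ, q, hU, hq⟩

section Compactness

variable {M : ℝ → ℝ} {a : ℝ → ℝ} {H : ℝ → ℝ → ℝ} {lam c d m N R : ℝ}

lemma SolvesOn.abs_sub_le {p : ℝ → ℝ} (hp : SolvesOn a H lam c d p) (hm : 0 < m) (hN : 0 ≤ N)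
    (ha : ∀ y ∈ Icc c d, m ≤ a y) (hbd : ∀ y ∈ Icc c d, |lam - H y (p y)| ≤ N) {x y : ℝ}
    (hx : x ∈ Icc c d) (hy : y ∈ Icc c d) : |p y - p x| ≤ N / m * |y - x| := by
  refine (convex_Icc c d).norm_image_sub_le_of_norm_hasDerivWithin_le hp (fun z hz => ?_) hx hy
  rw [Real.norm_eq_abs, abs_div, abs_of_pos (hm.trans_le (ha z hz))]
  exact div_le_div₀ hN (hbd z hz) hm (ha z hz)

lemma Admissible.exists_slope_lipschitz (h : Admissible M a H) (hm : 0 < m) (hN : 0 ≤ N)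
    (ha : ∀ y ∈ Icc c d, m ≤ a y) :
    ∃ C, 0 ≤ C ∧ ∀ mu p, |mu| ≤ N → SolvesOn a H mu c d p → (∀ y ∈ Icc c d, |p y| ≤ R) →
      ∀ x ∈ Icc c d, ∀ y ∈ Icc c d,
        |(mu - H y (p y)) / a y - (mu - H x (p x)) / a x| ≤ C * |y - x| := by
  obtain ⟨L, hL, hHL⟩ := h.H_lip R
  obtain ⟨B, hB, hHB⟩ := h.H_bdd R
  obtain ⟨A, hA⟩ := h.a_lip
  set D := (N + B) / m
  refine ⟨L * (1 + D) / m + (N + B) * (|A| / m ^ 2), by positivity,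
    fun mu p hmu hp hpR x hx y hy => ?_⟩
  have hbd (z) (hz : z ∈ Icc c d) : |mu - H z (p z)| ≤ N + B :=
    (abs_sub _ _).trans (add_le_add hmu (hHB z _ (hpR z hz)))
  have hpD : |p y - p x| ≤ D * |y - x| := hp.abs_sub_le hm (by positivity) ha hbd hx hy
  have hnum : |(mu - H y (p y)) - (mu - H x (p x))| ≤ L * (1 + D) * |y - x| := by
    rw [sub_sub_sub_cancel_left, abs_sub_comm, mul_assoc]
    exact (hHL y x (p y) (p x) (hpR y hy) (hpR x hx)).trans (by gcongr; linarith)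
  have hden : |a x - a y| ≤ |A| * |y - x| := by
    rw [abs_sub_comm]
    exact (hA y x).trans (by gcongr; exact le_abs_self A)
  calc _ ≤ |(mu - H y (p y)) - (mu - H x (p x))| / m + (N + B) * (|a x - a y| / m ^ 2) :=
        abs_div_sub_div_le hm (ha x hx) (ha y hy) (hbd x hx)
    _ ≤ L * (1 + D) * |y - x| / m + (N + B) * (|A| * |y - x| / m ^ 2) := by gcongr
    _ = _ := by ring

lemma Admissible.exists_taylor_bound (h : Admissible M a H) (hm : 0 < m) (hN : 0 ≤ N)
    (ha : ∀ y ∈ Icc c d, m ≤ a y) :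
    ∃ C, ∀ mu p, |mu| ≤ N → SolvesOn a H mu c d p → (∀ y ∈ Icc c d, |p y| ≤ R) →
      ∀ x ∈ Icc c d, ∀ y ∈ Icc c d,
        |p y - p x - (mu - H x (p x)) / a x * (y - x)| ≤ C * (y - x) ^ 2 := by
  obtain ⟨C, hC0, hC⟩ := h.exists_slope_lipschitz (R := R) hm hN ha
  refine ⟨C, fun mu p hmu hp hpR x hx y hy => ?_⟩
  have hsub : uIcc x y ⊆ Icc c d := uIcc_subset_Icc hx hy
  have hderiv (z) (hz : z ∈ uIcc x y) :
      HasDerivWithinAt (fun z => p z - (mu - H x (p x)) / a x * z)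
        ((mu - H z (p z)) / a z - (mu - H x (p x)) / a x) (uIcc x y) z := by
    simpa using ((hp z (hsub hz)).mono hsub).fun_sub
      ((hasDerivWithinAt_id z _).const_mul ((mu - H x (p x)) / a x))
  have hmvt := (convex_uIcc x y).norm_image_sub_le_of_norm_hasDerivWithin_le hderiv
    (fun z hz => (hC mu p hmu hp hpR x hx z (hsub hz)).trans
      (mul_le_mul_of_nonneg_left (abs_sub_left_of_mem_uIcc hz) hC0)) left_mem_uIcc right_mem_uIcc
  simp only [Real.norm_eq_abs] at hmvt
  calc _ = |p y - (mu - H x (p x)) / a x * y - (p x - (mu - H x (p x)) / a x * x)| := by ring_nf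
    _ ≤ C * |y - x| * |y - x| := hmvt
    _ = C * (y - x) ^ 2 := by rw [mul_assoc, ← sq, sq_abs]

lemma Admissible.hasDerivAt_of_tendsto (h : Admissible M a H) {U : Filter ℕ} [U.NeBot] {x ρ : ℝ}
    {mu : ℕ → ℝ} {p : ℕ → ℝ → ℝ} {q : ℝ → ℝ} (hρ : 0 < ρ)
    (ha : ∀ y ∈ Icc (x - ρ) (x + ρ), 0 < a y) (hmu : Tendsto mu U (𝓝 lam))
    (hp : ∀ᶠ n in U, SolvesOn a H (mu n) (x - ρ) (x + ρ) (p n) ∧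
      ∀ y ∈ Icc (x - ρ) (x + ρ), |p n y| ≤ R)
    (hq : ∀ y ∈ Icc (x - ρ) (x + ρ), Tendsto (fun n => p n y) U (𝓝 (q y))) :
    HasDerivAt q ((lam - H x (q x)) / a x) x := by
  have hx : x ∈ Icc (x - ρ) (x + ρ) := ⟨by linarith, by linarith⟩
  obtain ⟨m, hm, hma⟩ := h.exists_pos_le (by linarith) ha
  obtain ⟨C, hC⟩ := h.exists_taylor_bound (R := R) (N := |lam| + 1) hm (by positivity) hma
  refine hasDerivAt_of_quadratic_bound hρ (C := C) fun y hy => ?_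
  have hbound : ∀ᶠ n in U,
      |p n y - p n x - (mu n - H x (p n x)) / a x * (y - x)| ≤ C * (y - x) ^ 2 := by
    filter_upwards [hp, hmu.abs.eventually (Iic_mem_nhds (lt_add_one |lam|))] with n hpn hmun
    exact hC (mu n) (p n) hmun hpn.1 hpn.2 x hx y hy
  have hHx : Continuous (H x) := h.continuous_H_comp continuous_const continuous_id
  have hslope : Tendsto (fun n => (mu n - H x (p n x)) / a x) U (𝓝 ((lam - H x (q x)) / a x)) :=
    (hmu.sub ((hHx.tendsto _).comp (hq x hx))).div_const _
  exact le_of_tendsto (((hq y hy).sub (hq x hx)).sub (hslope.mul_const _)).abs hbound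

lemma Admissible.exists_limit_solution (h : Admissible M a H) {l r : ℝ} {c d mu : ℕ → ℝ}
    {p : ℕ → ℝ → ℝ} (ha : ∀ y ∈ Ioo l r, 0 < a y) (hc : Tendsto c atTop (𝓝 l))
    (hd : Tendsto d atTop (𝓝 r)) (hmu : Tendsto mu atTop (𝓝 lam))
    (hp : ∀ n, SolvesOn a H (mu n) (c n) (d n) (p n))
    (hpR : ∀ n, ∀ y ∈ Icc (c n) (d n), |p n y| ≤ R) :
    ∃ q : ℝ → ℝ, (∀ x ∈ Ioo l r, HasDerivAt q ((lam - H x (q x)) / a x) x ∧ |q x| ≤ R) ∧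
      ∀ x ∈ Ioo l r, ∀ k, (∀ᶠ n in atTop, k ≤ p n x) → k ≤ q x := by
  have hmem {x} (hx : x ∈ Ioo l r) : ∀ᶠ n in atTop, x ∈ Icc (c n) (d n) :=
    (hc.eventually (Iic_mem_nhds hx.1)).and (hd.eventually (Ici_mem_nhds hx.2))
  obtain ⟨U, q, hU, hq⟩ := exists_pointwise_limit (R := fun _ => R)
    fun x hx => (hmem hx).mono (hpR · x)
  refine ⟨q, fun x hx => ⟨?_, (hq x hx).1⟩, fun x hx k hk => ge_of_tendsto (hq x hx).2 (hU hk)⟩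
  obtain ⟨ρ, hρ, hball⟩ := Metric.nhds_basis_closedBall.mem_iff.1 (Ioo_mem_nhds hx.1 hx.2)
  rw [Real.closedBall_eq_Icc] at hball
  have hle : x - ρ ≤ x + ρ := by linarith
  refine h.hasDerivAt_of_tendsto (R := R) hρ (fun y hy => ha y (hball hy)) (hmu.mono_left hU) ?_
    fun y hy => (hq y (hball hy)).2
  filter_upwards [hU (hmem (hball ⟨le_rfl, hle⟩)), hU (hmem (hball ⟨hle, le_rfl⟩))] with n hl hr
  exact ⟨(hp n).mono hl.1 hr.2, fun y hy => hpR n y ⟨hl.1.trans hy.1, hy.2.trans hr.2⟩⟩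

end Compactness

/-- `p` solves the equation `a p' + H(y, p) = lam` for the slope of a solution on `(l, r)`. -/
def SolvesOnIoo (a : ℝ → ℝ) (H : ℝ → ℝ → ℝ) (lam l r : ℝ) (p : ℝ → ℝ) : Prop :=
  ∀ y ∈ Ioo l r, HasDerivAt p ((lam - H y (p y)) / a y) y

/-- `(l, r)` is a bounded connected component of `{a > 0}`. -/
structure IsComponent (a : ℝ → ℝ) (l r : ℝ) : Prop where
  lt : l < r
  left : a l = 0
  right : a r = 0
  pos : ∀ y ∈ Ioo l r, 0 < a y

section Endpoints

variable {M : ℝ → ℝ} {a : ℝ → ℝ} {H : ℝ → ℝ → ℝ} {lam l r R : ℝ}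

lemma SolvesOnIoo.solvesOn {p : ℝ → ℝ} (hp : SolvesOnIoo a H lam l r p) {c d : ℝ} (hc : l < c)
    (hd : d < r) : SolvesOn a H lam c d p := fun y hy =>
  (hp y (Icc_subset_Ioo hc hd hy)).hasDerivWithinAt

lemma SolvesOnIoo.reflect {p : ℝ → ℝ} (hp : SolvesOnIoo a H lam l r p) :
    SolvesOnIoo (fun x => a (-x)) (fun x p => H (-x) (-p)) lam (-r) (-l) (fun x => -p (-x)) := by
  intro y hy
  have hderiv := hp (-y) ⟨by linarith [hy.2], by linarith [hy.1]⟩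
  simpa [Function.comp_def] using (hderiv.scomp y (hasDerivAt_neg y)).fun_neg

lemma antitoneOn_sub_div_sub {f f' : ℝ → ℝ} {k : ℝ} (hf : ∀ x ∈ Ioo l r, HasDerivAt f (f' x) x)
    (hf' : ∀ x ∈ Ioo l r, f' x ≤ -(k / (x - l) ^ 2)) :
    AntitoneOn (fun x => f x - k / (x - l)) (Ioo l r) := by
  have hderiv (x) (hx : x ∈ Ioo l r) :
      HasDerivAt (fun x => f x - k / (x - l)) (f' x + k / (x - l) ^ 2) x := by
    have hne : x - l ≠ 0 := sub_ne_zero.2 hx.1.ne'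
    refine ((hf x hx).fun_sub ((hasDerivAt_const x k).fun_div
      ((hasDerivAt_id x).sub_const l) hne)).congr_deriv ?_
    simp only [id]
    ring
  refine antitoneOn_of_deriv_nonpos (convex_Ioo l r)
    (fun x hx => (hderiv x hx).continuousAt.continuousWithinAt) ?_ ?_ <;> rw [interior_Ioo]
  · exact fun x hx => (hderiv x hx).differentiableAt.differentiableWithinAt
  · intro x hx
    rw [(hderiv x hx).deriv]
    linarith [hf' x hx]

lemma tendsto_div_sub_nhdsGT {k : ℝ} (hk : 0 < k) (l : ℝ) :
    Tendsto (fun x => k / (x - l)) (𝓝[>] l) atTop := by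
  have hshift : Tendsto (fun x => x - l) (𝓝[>] l) (𝓝[>] 0) := by
    refine tendsto_nhdsWithin_iff.2 ⟨?_, ?_⟩
    · simpa using ((continuous_sub_right l).tendsto l).mono_left nhdsWithin_le_nhds
    · filter_upwards [self_mem_nhdsWithin] with x hx using sub_pos.2 (mem_Ioi.1 hx)
  exact (tendsto_inv_nhdsGT_zero.comp hshift).const_mul_atTop hk

lemma not_forall_le_of_deriv_le_neg_div_sq {f f' : ℝ → ℝ} {k : ℝ} (hlr : l < r) (hk : 0 < k)
    (hf : ∀ x ∈ Ioo l r, HasDerivAt f (f' x) x)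
    (hf' : ∀ x ∈ Ioo l r, f' x ≤ -(k / (x - l) ^ 2)) : ¬ ∀ x ∈ Ioo l r, f x ≤ R := by
  intro hR
  obtain ⟨b, hb⟩ := nonempty_Ioo.2 hlr
  obtain ⟨x, hlarge, hx⟩ := (((tendsto_div_sub_nhdsGT hk l).eventually_gt_atTop
    (R - f b + k / (b - l))).and (Ioo_mem_nhdsGT hb.1)).exists
  have hxI : x ∈ Ioo l r := ⟨hx.1, hx.2.trans hb.2⟩
  have hdecr : f b - k / (b - l) ≤ f x - k / (x - l) :=
    antitoneOn_sub_div_sub hf hf' hxI hb hx.2.le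
  linarith [hR x hxI]

/-- The coefficient `a` vanishes quadratically at `l`, so a numerator bounded away from `0` gives
`f` a nonintegrable derivative. -/
lemma Admissible.nonpos_of_tendsto_numerator (h : Admissible M a H) (hlr : l < r) (hl : a l = 0)
    (ha : ∀ y ∈ Ioo l r, 0 < a y) {f g : ℝ → ℝ} {G : ℝ}
    (hf : ∀ x ∈ Ioo l r, HasDerivAt f (-(g x / a x)) x) (hfR : ∀ x ∈ Ioo l r, f x ≤ R)
    (hg : Tendsto g (𝓝[>] l) (𝓝 G)) : G ≤ 0 := by
  by_contra! hG
  obtain ⟨B, hB, hquad⟩ := h.a_quad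
  obtain ⟨δ, hδ : l < δ, hsub⟩ := mem_nhdsGT_iff_exists_Ioo_subset.1
    ((hg.eventually (lt_mem_nhds (half_lt_self hG))).and (Ioo_mem_nhdsGT hlr))
  refine not_forall_le_of_deriv_le_neg_div_sq hδ (div_pos (half_pos hG) hB)
    (fun x hx => hf x (hsub hx).2) (fun x hx => ?_) fun x hx => hfR x (hsub hx).2
  obtain ⟨hgx : G / 2 < g x, hxI⟩ := hsub hx
  rw [div_div]
  exact neg_le_neg (div_le_div₀ ((half_pos hG).trans hgx).le hgx.le (ha x hxI) (hquad l x hl))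

lemma SolvesOn.const_le {p : ℝ → ℝ} {c d k : ℝ} (hp : SolvesOn a H lam c d p) (hcd : c ≤ d)
    (ha : ∀ y ∈ Icc c d, 0 < a y) (hk : ∀ y ∈ Icc c d, H y k < lam) (hkc : k ≤ p c) :
    k ≤ p d :=
  le_of_deriv_lt_of_eq (fun y _ => hasDerivWithinAt_const y _ k) hp hkc
    (fun y hy heq => div_pos (sub_pos.2 (heq ▸ hk y hy)) (ha y hy)) d ⟨hcd, le_rfl⟩

lemma SolvesOn.le_const {p : ℝ → ℝ} {c d k : ℝ} (hp : SolvesOn a H lam c d p) (hcd : c ≤ d)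
    (ha : ∀ y ∈ Icc c d, 0 < a y) (hk : ∀ y ∈ Icc c d, lam < H y k) (hkc : p c ≤ k) :
    p d ≤ k :=
  le_of_deriv_lt_of_eq hp (fun y _ => hasDerivWithinAt_const y _ k) hkc
    (fun y hy heq => div_neg_of_neg_of_pos (sub_neg.2 (heq ▸ hk y hy)) (ha y hy)) d ⟨hcd, le_rfl⟩

/-- Near `l` the graph of `p` crosses a level `k` with `H l k ≠ lam` in one direction only, and
such levels are dense. -/
lemma Admissible.exists_limit_left (h : Admissible M a H) (hlr : l < r)
    (ha : ∀ y ∈ Ioo l r, 0 < a y) {p : ℝ → ℝ} (hp : SolvesOnIoo a H lam l r p)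
    (hR : ∀ y ∈ Ioo l r, |p y| ≤ R) : ∃ P, Tendsto p (𝓝[>] l) (𝓝 P) := by
  have hIoo : ∀ᶠ y in 𝓝[>] l, y ∈ Ioo l r := Ioo_mem_nhdsGT hlr
  refine tendsto_of_no_upcrossings (h.dense_H_ne l lam) ?_
    ⟨R, by simpa using hIoo.mono fun y hy => (abs_le.1 (hR y hy)).2⟩
    ⟨-R, by simpa using hIoo.mono fun y hy => (abs_le.1 (hR y hy)).1⟩
  rintro k hk k' - hkk' ⟨hlow, hhigh⟩
  replace hhigh : ∃ᶠ y in 𝓝[>] l, k < p y := hhigh.mono fun y hy => hkk'.trans hy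
  rcases lt_or_gt_of_ne hk with hk | hk
  · obtain ⟨δ, hδ : l < δ, hsub⟩ := mem_nhdsGT_iff_exists_Ioo_subset.1
      (hIoo.and (mem_nhdsWithin_of_mem_nhds (h.eventually_H_lt hk)))
    obtain ⟨d, hd, hdδ⟩ := (hlow.and_eventually (Ioo_mem_nhdsGT hδ)).exists
    obtain ⟨c, hc, hcd⟩ := (hhigh.and_eventually (Ioo_mem_nhdsGT hdδ.1)).exists
    have hIcc (y) (hy : y ∈ Icc c d) := hsub (Icc_subset_Ioo hcd.1 hdδ.2 hy)
    exact hd.not_ge ((hp.solvesOn hcd.1 (hsub hdδ).1.2).const_le hcd.2.le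
      (fun y hy => ha y (hIcc y hy).1) (fun y hy => (hIcc y hy).2) hc.le)
  · obtain ⟨δ, hδ : l < δ, hsub⟩ := mem_nhdsGT_iff_exists_Ioo_subset.1
      (hIoo.and (mem_nhdsWithin_of_mem_nhds (h.eventually_lt_H hk)))
    obtain ⟨d, hd, hdδ⟩ := (hhigh.and_eventually (Ioo_mem_nhdsGT hδ)).exists
    obtain ⟨c, hc, hcd⟩ := (hlow.and_eventually (Ioo_mem_nhdsGT hdδ.1)).exists
    have hIcc (y) (hy : y ∈ Icc c d) := hsub (Icc_subset_Ioo hcd.1 hdδ.2 hy)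
    exact hd.not_ge ((hp.solvesOn hcd.1 (hsub hdδ).1.2).le_const hcd.2.le
      (fun y hy => ha y (hIcc y hy).1) (fun y hy => (hIcc y hy).2) hc.le)

lemma Admissible.tendsto_H_left (h : Admissible M a H) {p : ℝ → ℝ} {P : ℝ}
    (hp : Tendsto p (𝓝[>] l) (𝓝 P)) : Tendsto (fun y => H y (p y)) (𝓝[>] l) (𝓝 (H l P)) :=
  (h.continuous_H.tendsto (l, P)).comp
    ((tendsto_id.mono_left nhdsWithin_le_nhds).prodMk_nhds hp)

lemma Admissible.exists_tendsto_left (h : Admissible M a H) (hlr : l < r) (hl : a l = 0)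
    (ha : ∀ y ∈ Ioo l r, 0 < a y) {p : ℝ → ℝ} (hp : SolvesOnIoo a H lam l r p)
    (hR : ∀ y ∈ Ioo l r, |p y| ≤ R) : ∃ P, H l P = lam ∧ Tendsto p (𝓝[>] l) (𝓝 P) := by
  obtain ⟨P, hP⟩ := h.exists_limit_left hlr ha hp hR
  have hH := h.tendsto_H_left hP
  refine ⟨P, le_antisymm (sub_nonpos.1 ?_) (sub_nonpos.1 ?_), hP⟩
  · refine h.nonpos_of_tendsto_numerator hlr hl ha (f := p) (R := R)
      (fun y hy => (hp y hy).congr_deriv (by ring)) (fun y hy => (abs_le.1 (hR y hy)).2)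
      (hH.sub_const lam)
  · refine h.nonpos_of_tendsto_numerator hlr hl ha (f := fun y => -p y) (R := R)
      (fun y hy => (hp y hy).fun_neg) (fun y hy => ?_) (hH.const_sub lam)
    linarith [(abs_le.1 (hR y hy)).1]

lemma Admissible.exists_tendsto_right (h : Admissible M a H) (hlr : l < r) (hr : a r = 0)
    (ha : ∀ y ∈ Ioo l r, 0 < a y) {p : ℝ → ℝ} (hp : SolvesOnIoo a H lam l r p)
    (hR : ∀ y ∈ Ioo l r, |p y| ≤ R) : ∃ P, H r P = lam ∧ Tendsto p (𝓝[<] r) (𝓝 P) := by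
  obtain ⟨P, hroot, hP⟩ := h.reflect.exists_tendsto_left (l := -r) (r := -l) (by linarith)
    (by simpa using hr) (fun y hy => ha _ ⟨by linarith [hy.2], by linarith [hy.1]⟩) hp.reflect
    (R := R) fun y hy => by
      rw [abs_neg]
      exact hR _ ⟨by linarith [hy.2], by linarith [hy.1]⟩
  exact ⟨-P, by simpa using hroot, by simpa [Function.comp_def] using
    (hP.comp tendsto_neg_nhdsLT).neg⟩

lemma isUpperRoot_of_le {mu x P Q : ℝ} (hmu : mu < lam) (hP : H x P = lam) (hQ : H x Q = mu)
    (hle : Q ≤ P) : IsUpperRoot H lam x P :=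
  ⟨hP, Q, lt_of_le_of_ne hle fun heq => hmu.ne (hQ ▸ heq ▸ hP), hQ.trans_lt hmu⟩

lemma IsUpperRoot.eventually_H_lt_of_lt (hP : IsUpperRoot H lam l P) (h : Admissible M a H)
    {p : ℝ → ℝ} (hp : Tendsto p (𝓝[>] l) (𝓝 P)) :
    ∀ᶠ y in 𝓝[>] l, ∀ s, p y < s → H y (p y) < H y s := by
  obtain ⟨hroot, k, hkP, hk⟩ := hP
  obtain ⟨t, hkt, ht⟩ := exists_between hk
  filter_upwards [mem_nhdsWithin_of_mem_nhds (h.eventually_H_lt hkt),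
    hp.eventually (lt_mem_nhds hkP),
    (h.tendsto_H_left hp).eventually (lt_mem_nhds (hroot ▸ ht))] with y hyk hyp hyH s hs
  exact (lt_max_iff.1 (h.sqc y k (p y) s hyp hs)).resolve_left (hyk.trans hyH).not_gt

lemma SolvesOnIoo.eventually_le (h : Admissible M a H) (hlr : l < r)
    (ha : ∀ y ∈ Ioo l r, 0 < a y) {p q : ℝ → ℝ} {P : ℝ} (hP : IsUpperRoot H lam l P)
    (hp : SolvesOnIoo a H lam l r p) (hq : SolvesOnIoo a H lam l r q)
    (hpP : Tendsto p (𝓝[>] l) (𝓝 P)) (hqP : Tendsto q (𝓝[>] l) (𝓝 P)) :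
    ∀ᶠ y in 𝓝[>] l, q y ≤ p y := by
  obtain ⟨δ, hδ : l < δ, hsub⟩ := mem_nhdsGT_iff_exists_Ioo_subset.1
    (Filter.Eventually.and (Ioo_mem_nhdsGT hlr) (hP.eventually_H_lt_of_lt h hpP))
  filter_upwards [Ioo_mem_nhdsGT hδ] with x hx
  by_contra! hlt
  have hgap : 0 < (q x - p x) / 2 := by linarith
  have hlim : Tendsto (fun y => q y - p y) (𝓝[>] l) (𝓝 0) := by simpa using hqP.sub hpP
  obtain ⟨c, hc, hcx⟩ := ((hlim.eventually (gt_mem_nhds hgap)).and (Ioo_mem_nhdsGT hx.1)).exists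
  have hmem {z} (hz : z ∈ Icc c x) := hsub (Icc_subset_Ioo hcx.1 hx.2 hz)
  have hstay : q x - p x ≤ (q x - p x) / 2 := by
    refine le_of_deriv_lt_of_eq (g' := fun _ => 0)
      (fun z hz => ((hq z (hmem hz).1).fun_sub (hp z (hmem hz).1)).hasDerivWithinAt)
      (fun z _ => hasDerivWithinAt_const z _ ((q x - p x) / 2)) hc.le (fun z hz heq => ?_) x
      ⟨hcx.2.le, le_rfl⟩
    obtain ⟨hzI, hz⟩ := hmem hz
    rw [← sub_div]
    exact div_neg_of_neg_of_pos (by linarith [hz (q z) (by linarith)]) (ha z hzI)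
  linarith

lemma Admissible.lipschitzOnWith_slope (h : Admissible M a H) (R lam : ℝ) {m : ℝ} (hm : 0 < m) :
    ∃ K, ∀ y, m ≤ a y → LipschitzOnWith K (fun t => (lam - H y t) / a y) (Icc (-R) R) := by
  obtain ⟨L, hL, hHL⟩ := h.H_lip R
  refine ⟨⟨L / m, by positivity⟩, fun y hy => LipschitzOnWith.of_dist_le_mul fun s hs t ht => ?_⟩
  have hay : 0 < a y := hm.trans_le hy
  have hnum := hHL y y t s (abs_le.2 ht) (abs_le.2 hs)
  rw [sub_self, abs_zero, zero_add, abs_sub_comm t] at hnum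
  rw [Real.dist_eq, Real.dist_eq, ← sub_div, abs_div, abs_of_pos hay, sub_sub_sub_cancel_left,
    div_le_iff₀ hay]
  calc |H y t - H y s| ≤ L / m * |s - t| * m := hnum.trans_eq (by field_simp)
    _ ≤ L / m * |s - t| * a y := by gcongr

lemma SolvesOnIoo.eq_of_tendsto (h : Admissible M a H) (hlr : l < r)
    (ha : ∀ y ∈ Ioo l r, 0 < a y) {p q : ℝ → ℝ} {P : ℝ} (hP : IsUpperRoot H lam l P)
    (hp : SolvesOnIoo a H lam l r p) (hq : SolvesOnIoo a H lam l r q)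
    (hpP : Tendsto p (𝓝[>] l) (𝓝 P)) (hqP : Tendsto q (𝓝[>] l) (𝓝 P))
    (hpR : ∀ y ∈ Ioo l r, |p y| ≤ R) (hqR : ∀ y ∈ Ioo l r, |q y| ≤ R) :
    ∀ y ∈ Ioo l r, p y = q y := by
  intro x hx
  obtain ⟨c, ⟨hqp, hpq⟩, hcx⟩ := (((hp.eventually_le h hlr ha hP hq hpP hqP).and
    (hq.eventually_le h hlr ha hP hp hqP hpP)).and (Ioo_mem_nhdsGT hx.1)).exists
  have hsub : Icc c x ⊆ Ioo l r := Icc_subset_Ioo hcx.1 hx.2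
  have hsub' : Ico c x ⊆ Ioo l r := Ico_subset_Icc_self.trans hsub
  obtain ⟨m, hm, hma⟩ := h.exists_pos_le hcx.2.le fun y hy => ha y (hsub hy)
  obtain ⟨K, hK⟩ := h.lipschitzOnWith_slope R lam hm
  exact ODE_solution_unique_of_mem_Icc_right (s := fun _ => Icc (-R) R)
    (fun y hy => hK y (hma y (Ico_subset_Icc_self hy)))
    (hp.solvesOn hcx.1 hx.2).continuousOn (fun y hy => (hp y (hsub' hy)).hasDerivWithinAt)
    (fun y hy => abs_le.1 (hpR y (hsub' hy)))
    (hq.solvesOn hcx.1 hx.2).continuousOn (fun y hy => (hq y (hsub' hy)).hasDerivWithinAt)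
    (fun y hy => abs_le.1 (hqR y (hsub' hy))) (hpq.antisymm hqp) ⟨hcx.2.le, le_rfl⟩

lemma SolvesOnIoo.le_of_level_lt (h : Admissible M a H) (hI : IsComponent a l r) {mu : ℝ}
    (hmu : mu < lam) {p q : ℝ → ℝ} {P : ℝ} (hP : IsUpperRoot H lam l P)
    (hp : SolvesOnIoo a H lam l r p) (hpP : Tendsto p (𝓝[>] l) (𝓝 P))
    (hq : SolvesOnIoo a H mu l r q) (hqR : ∀ y ∈ Ioo l r, |q y| ≤ R) :
    ∀ y ∈ Ioo l r, q y ≤ p y := by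
  intro x hx
  obtain ⟨Q, hQ, hqQ⟩ := h.exists_tendsto_left hI.lt hI.left hI.pos hq hqR
  have hQP : Q < P := hP.lt_of_H_lt h (by linarith)
  obtain ⟨c, hc, hcx⟩ := ((hqQ.eventually_lt hpP hQP).and (Ioo_mem_nhdsGT hx.1)).exists
  refine le_of_deriv_lt_of_eq (hq.solvesOn hcx.1 hx.2) (hp.solvesOn hcx.1 hx.2) hc.le
    (fun y hy heq => ?_) x ⟨hcx.2.le, le_rfl⟩
  have hpos := hI.pos y (Icc_subset_Ioo hcx.1 hx.2 hy)
  rw [heq]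
  gcongr

lemma SolvesOnIoo.exists_tendsto_upperRoot (h : Admissible M a H) (hI : IsComponent a l r) {mu : ℝ}
    (hmu : mu < lam) {p q : ℝ → ℝ} (hp : SolvesOnIoo a H lam l r p)
    (hpR : ∀ y ∈ Ioo l r, |p y| ≤ R)
    (hq : SolvesOnIoo a H mu l r q) (hqR : ∀ y ∈ Ioo l r, |q y| ≤ R)
    (hqp : ∀ y ∈ Ioo l r, q y ≤ p y) :
    (∃ P, IsUpperRoot H lam l P ∧ Tendsto p (𝓝[>] l) (𝓝 P)) ∧
      ∃ P, IsUpperRoot H lam r P ∧ Tendsto p (𝓝[<] r) (𝓝 P) := by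
  obtain ⟨P, hP, hpP⟩ := h.exists_tendsto_left hI.lt hI.left hI.pos hp hpR
  obtain ⟨Q, hQ, hqQ⟩ := h.exists_tendsto_left hI.lt hI.left hI.pos hq hqR
  obtain ⟨P', hP', hpP'⟩ := h.exists_tendsto_right hI.lt hI.right hI.pos hp hpR
  obtain ⟨Q', hQ', hqQ'⟩ := h.exists_tendsto_right hI.lt hI.right hI.pos hq hqR
  refine ⟨⟨P, isUpperRoot_of_le hmu hP hQ ?_, hpP⟩, ⟨P', isUpperRoot_of_le hmu hP' hQ' ?_, hpP'⟩⟩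
  · exact le_of_tendsto_of_tendsto hqQ hpP
      (by filter_upwards [Ioo_mem_nhdsGT hI.lt] with y hy using hqp y hy)
  · exact le_of_tendsto_of_tendsto hqQ' hpP'
      (by filter_upwards [Ioo_mem_nhdsLT hI.lt] with y hy using hqp y hy)

lemma exists_seq_tendsto_endpoints (hlr : l < r) :
    ∃ c d : ℕ → ℝ, (∀ n, l < c n ∧ c n ≤ d n ∧ d n < r) ∧ Tendsto c atTop (𝓝 l) ∧
      Tendsto d atTop (𝓝 r) := by
  obtain ⟨b, hb⟩ := nonempty_Ioo.2 hlr
  obtain ⟨c, -, hc, hcl⟩ := exists_seq_strictAnti_tendsto' hb.1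
  obtain ⟨d, -, hd, hdr⟩ := exists_seq_strictMono_tendsto' hb.2
  exact ⟨c, d, fun n => ⟨(hc n).1, ((hc n).2.trans (hd n).1).le, (hd n).2⟩, hcl, hdr⟩

lemma Admissible.exists_solvesOnIoo_of_barriers (h : Admissible M a H) (hI : IsComponent a l r)
    {mu : ℝ} (hmu : mu < lam) (hR : M lam ≤ R) {b : ℝ → ℝ}
    (hbar : ∀ c d, l < c → c ≤ d → d < r → ∃ g g' : ℝ → ℝ,
      (∀ y ∈ Icc c d, HasDerivWithinAt g (g' y) (Icc c d) y) ∧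
      (∀ y ∈ Icc c d, |g y| ≤ R ∧ b y ≤ g y) ∧ ∀ y ∈ Icc c d, a y * g' y + H y (g y) ≤ mu) :
    ∃ p, SolvesOnIoo a H lam l r p ∧ ∀ y ∈ Ioo l r, |p y| ≤ R ∧ b y ≤ p y := by
  obtain ⟨c, d, hcd, hc, hd⟩ := exists_seq_tendsto_endpoints hI.lt
  have hsolve (n) : ∃ p, SolvesOn a H lam (c n) (d n) p ∧
      ∀ y ∈ Icc (c n) (d n), |p y| ≤ R ∧ b y ≤ p y := by
    obtain ⟨hln, hle, hrn⟩ := hcd n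
    obtain ⟨g, g', hg, hgR, hgH⟩ := hbar (c n) (d n) hln hle hrn
    obtain ⟨p, -, hp, hgp⟩ := h.exists_solvesOn_of_barrier hle
      (fun y hy => hI.pos y (Icc_subset_Ioo hln hrn hy)) hR hmu hg (fun y hy => (hgR y hy).1) hgH
    exact ⟨p, hp, fun y hy => ⟨(hgp y hy).1, (hgR y hy).2.trans (hgp y hy).2⟩⟩
  choose f hf hfb using hsolve
  obtain ⟨p, hp, hlower⟩ := h.exists_limit_solution hI.pos hc hd tendsto_const_nhds hf
    fun n y hy => (hfb n y hy).1
  refine ⟨p, fun y hy => (hp y hy).1, fun y hy => ⟨(hp y hy).2, hlower y hy _ ?_⟩⟩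
  filter_upwards [hc.eventually (Iic_mem_nhds hy.1), hd.eventually (Ici_mem_nhds hy.2)]
    with n hcy hdy using (hfb n y ⟨hcy, hdy⟩).2

/-- Going through an intermediate level makes the solution lie above one of lower level, which
forces the larger root at both ends. -/
lemma Admissible.exists_component_solution (h : Admissible M a H) (hI : IsComponent a l r) {mu : ℝ}
    (hmu : mu < lam) (hR : M lam ≤ R)
    (hbar : ∀ c d, l < c → c ≤ d → d < r → ∃ g g' : ℝ → ℝ,
      (∀ y ∈ Icc c d, HasDerivWithinAt g (g' y) (Icc c d) y) ∧ (∀ y ∈ Icc c d, |g y| ≤ R) ∧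
      ∀ y ∈ Icc c d, a y * g' y + H y (g y) ≤ mu) :
    ∃ p, SolvesOnIoo a H lam l r p ∧ (∀ y ∈ Ioo l r, |p y| ≤ R) ∧
      (∃ P, IsUpperRoot H lam l P ∧ Tendsto p (𝓝[>] l) (𝓝 P)) ∧
      ∃ P, IsUpperRoot H lam r P ∧ Tendsto p (𝓝[<] r) (𝓝 P) := by
  obtain ⟨nu, hmunu, hnu⟩ := exists_between hmu
  obtain ⟨q, hq, hqR⟩ := h.exists_solvesOnIoo_of_barriers hI hmunu ((h.mono_M hnu.le).trans hR)
    (b := fun _ => -R) fun c d hc hcd hd => by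
      obtain ⟨g, g', hg, hgR, hgH⟩ := hbar c d hc hcd hd
      exact ⟨g, g', hg, fun y hy => ⟨hgR y hy, (abs_le.1 (hgR y hy)).1⟩, hgH⟩
  obtain ⟨p, hp, hpR⟩ := h.exists_solvesOnIoo_of_barriers hI hnu hR (b := q)
    fun c d hc _ hd => ⟨q, _, hq.solvesOn hc hd,
      fun y hy => ⟨(hqR y (Icc_subset_Ioo hc hd hy)).1, le_rfl⟩, fun y hy => by
        rw [mul_div_cancel₀ _ (hI.pos y (Icc_subset_Ioo hc hd hy)).ne']
        linarith⟩
  exact ⟨p, hp, fun y hy => (hpR y hy).1, hp.exists_tendsto_upperRoot h hI hnu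
    (fun y hy => (hpR y hy).1) hq (fun y hy => (hqR y hy).1) fun y hy => (hpR y hy).2⟩

end Endpoints

/-- The slope of the solution which takes the larger root wherever the diffusion vanishes. -/
structure IsUpperProfile (a : ℝ → ℝ) (H : ℝ → ℝ → ℝ) (lam : ℝ) (p : ℝ → ℝ) : Prop where
  cont : Continuous p
  bdd : ∃ R, ∀ x, |p x| ≤ R
  ode : ∀ x, 0 < a x → HasDerivAt p ((lam - H x (p x)) / a x) x
  root : ∀ x, a x = 0 → IsUpperRoot H lam x (p x)

/-- Every point of `{a > 0}` lies between two zeros of `a`. -/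
def HasZerosOnBothSides (a : ℝ → ℝ) : Prop :=
  ∀ x, 0 < a x → (∃ l < x, a l = 0) ∧ ∃ r > x, a r = 0

/-- Subsolutions of the slope equation at level `mu`, bounded by `R`, on all compact intervals on
which the diffusion does not vanish. -/
structure HasBarriers (a : ℝ → ℝ) (H : ℝ → ℝ → ℝ) (mu R : ℝ) : Prop where
  zero : ∀ z, a z = 0 → ∃ q, H z q ≤ mu
  barrier : ∀ c d, c ≤ d → (∀ y ∈ Icc c d, 0 < a y) → ∃ g g' : ℝ → ℝ,
    (∀ y ∈ Icc c d, HasDerivWithinAt g (g' y) (Icc c d) y) ∧ (∀ y ∈ Icc c d, |g y| ≤ R) ∧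
    ∀ y ∈ Icc c d, a y * g' y + H y (g y) ≤ mu

section Components

variable {M : ℝ → ℝ} {a : ℝ → ℝ} {H : ℝ → ℝ → ℝ} {lam l r R : ℝ}

lemma exists_zeros_of_isBounded_component (ha : ∀ x, 0 ≤ a x) {x : ℝ} (hx : 0 < a x)
    (hb : Bornology.IsBounded (connectedComponentIn {y | 0 < a y} x)) :
    (∃ l < x, a l = 0) ∧ ∃ r > x, a r = 0 := by
  have hpos (y) (hy : a y ≠ 0) : 0 < a y := lt_of_le_of_ne (ha y) hy.symm
  constructor
  · by_contra! hne
    have hsub : Iic x ⊆ connectedComponentIn {y | 0 < a y} x :=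
      isPreconnected_Iic.subset_connectedComponentIn self_mem_Iic fun y hy =>
        (mem_Iic.1 hy).eq_or_lt.elim (fun heq => heq ▸ hx) fun hlt => hpos y (hne y hlt)
    exact not_bddBelow_Iic x (hb.subset hsub).bddBelow
  · by_contra! hne
    have hsub : Ici x ⊆ connectedComponentIn {y | 0 < a y} x :=
      isPreconnected_Ici.subset_connectedComponentIn self_mem_Ici fun y hy =>
        (mem_Ici.1 hy).eq_or_lt.elim (fun heq => heq ▸ hx) fun hlt => hpos y (hne y hlt)
    exact not_bddAbove_Ici x (hb.subset hsub).bddAbove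

lemma isBounded_component_of_zeros {l x r : ℝ} (hlx : l < x) (hl : a l = 0) (hxr : x < r)
    (hr : a r = 0) (hx : 0 < a x) :
    Bornology.IsBounded (connectedComponentIn {y | 0 < a y} x) := by
  have hord := (isPreconnected_connectedComponentIn (F := {y | 0 < a y}) (x := x)).ordConnected
  have hsub := connectedComponentIn_subset {y | 0 < a y} x
  have hxmem : x ∈ connectedComponentIn {y | 0 < a y} x := mem_connectedComponentIn hx
  refine (Metric.isBounded_Icc l r).subset fun y hy => ⟨?_, ?_⟩ <;> by_contra! hlt
  · exact (hsub (hord.out hy hxmem ⟨hlt.le, hlx.le⟩)).ne' hl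
  · exact (hsub (hord.out hxmem hy ⟨hxr.le, hlt.le⟩)).ne' hr

lemma hasBoundedComponents_iff (ha : ∀ x, 0 ≤ a x) :
    HasBoundedComponents a ↔ (∃ x, a x ≠ 0) ∧ HasZerosOnBothSides a :=
  and_congr_right fun _ => forall₂_congr fun _ hx =>
    ⟨exists_zeros_of_isBounded_component ha hx, fun ⟨⟨_, hlx, hl⟩, _, hxr, hr⟩ =>
      isBounded_component_of_zeros hlx hl hxr hr hx⟩

lemma HasZerosOnBothSides.exists_isComponent (hz : HasZerosOnBothSides a)
    (h : Admissible M a H) {x : ℝ} (hx : 0 < a x) : ∃ l r, IsComponent a l r ∧ x ∈ Ioo l r := by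
  obtain ⟨⟨l₀, hl₀, hl₀'⟩, r₀, hr₀, hr₀'⟩ := hz x hx
  have hclosed : IsClosed {y | a y = 0} := isClosed_singleton.preimage h.continuous_a
  obtain ⟨l, ⟨hlI, hl : a l = 0⟩, hl_max⟩ :=
    ((isCompact_Icc (a := l₀) (b := x)).inter_right hclosed).exists_isGreatest
      ⟨l₀, ⟨le_rfl, hl₀.le⟩, hl₀'⟩
  obtain ⟨r, ⟨hrI, hr : a r = 0⟩, hr_min⟩ :=
    ((isCompact_Icc (a := x) (b := r₀)).inter_right hclosed).exists_isLeast
      ⟨r₀, ⟨le_of_lt hr₀, le_rfl⟩, hr₀'⟩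
  have hlx : l < x := lt_of_le_of_ne hlI.2 fun heq => hx.ne' (heq ▸ hl)
  have hxr : x < r := lt_of_le_of_ne hrI.1 fun heq => hx.ne' (heq ▸ hr)
  refine ⟨l, r, ⟨hlx.trans hxr, hl, hr, fun y hy => h.a_pos fun hy0 => ?_⟩, hlx, hxr⟩
  rcases le_total y x with hyx | hyx
  · exact (hl_max ⟨⟨hlI.1.trans hy.1.le, hyx⟩, hy0⟩).not_gt hy.1
  · exact (hr_min ⟨⟨hyx, hy.2.le.trans hrI.2⟩, hy0⟩).not_gt hy.2

lemma IsComponent.left_le_of_zero {x z : ℝ} (hI : IsComponent a l r) (hz : a z = 0)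
    (hx : x ∈ Ioo l r) (hzx : z ≤ x) : z ≤ l := by
  by_contra! hlz
  exact (hI.pos z ⟨hlz, hzx.trans_lt hx.2⟩).ne' hz

lemma IsComponent.le_right_of_zero {x z : ℝ} (hI : IsComponent a l r) (hz : a z = 0)
    (hx : x ∈ Ioo l r) (hxz : x ≤ z) : r ≤ z := by
  by_contra! hzr
  exact (hI.pos z ⟨hx.1.trans_le hxz, hzr⟩).ne' hz

lemma IsComponent.unique {l' r' x : ℝ} (hI : IsComponent a l r) (hI' : IsComponent a l' r')
    (hx : x ∈ Ioo l r) (hx' : x ∈ Ioo l' r') : l = l' ∧ r = r' :=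
  ⟨le_antisymm (hI'.left_le_of_zero hI.left hx' hx.1.le)
      (hI.left_le_of_zero hI'.left hx hx'.1.le),
    le_antisymm (hI.le_right_of_zero hI'.right hx hx'.2.le)
      (hI'.le_right_of_zero hI.right hx' hx.2.le)⟩

lemma IsUpperRoot.exists_levels {x P ε : ℝ} (hP : IsUpperRoot H lam x P) (h : Admissible M a H)
    (hε : 0 < ε) : ∃ k₁ k₂, P - ε < k₁ ∧ k₁ < P ∧ P < k₂ ∧ k₂ < P + ε ∧
      ∀ᶠ y in 𝓝 x, H y k₁ < lam ∧ lam < H y k₂ := by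
  obtain ⟨q₀, hq₀, hbelow⟩ := hP.H_lt h
  obtain ⟨k₁, hk₁, hk₁P⟩ := exists_between (max_lt hq₀ (sub_lt_self P hε))
  obtain ⟨k₂, hk₂P, hk₂⟩ := exists_between (lt_add_of_pos_right P hε)
  obtain ⟨hqk, hεk⟩ := max_lt_iff.1 hk₁
  exact ⟨k₁, k₂, hεk, hk₁P, hk₂P, hk₂, (h.eventually_H_lt (hbelow k₁ hqk.le hk₁P)).and
    (h.eventually_lt_H (hP.lt_H h hk₂P))⟩

/-- An upper profile whose continuity is only known from inside the components of `{a > 0}`: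
the form in which profiles are glued together. -/
structure IsPiecewiseUpperProfile (a : ℝ → ℝ) (H : ℝ → ℝ → ℝ) (lam : ℝ) (p : ℝ → ℝ) : Prop where
  root : ∀ x, a x = 0 → IsUpperRoot H lam x (p x)
  ode : ∀ l r, IsComponent a l r → SolvesOnIoo a H lam l r p
  left : ∀ l r, IsComponent a l r → Tendsto p (𝓝[>] l) (𝓝 (p l))
  right : ∀ l r, IsComponent a l r → Tendsto p (𝓝[<] r) (𝓝 (p r))

lemma IsPiecewiseUpperProfile.mem_Icc {p : ℝ → ℝ} (hp : IsPiecewiseUpperProfile a H lam p)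
    (h : Admissible M a H) (hz : HasZerosOnBothSides a) {k₁ k₂ z x : ℝ} (hk : k₁ < k₂)
    (hz0 : a z = 0) (hzx : z ≤ x) (hH : ∀ y ∈ Icc z x, H y k₁ < lam ∧ lam < H y k₂) :
    p x ∈ Icc k₁ k₂ := by
  have hzero (y) (hy : y ∈ Icc z x) (hy0 : a y = 0) : p y ∈ Ioo k₁ k₂ :=
    ⟨(hp.root y hy0).lt_of_H_lt h (hH y hy).1,
      (hp.root y hy0).lt_of_lt_H h hk (hH y hy).1 (hH y hy).2⟩
  by_cases hx0 : a x = 0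
  · exact Ioo_subset_Icc_self (hzero x ⟨hzx, le_rfl⟩ hx0)
  obtain ⟨l, r, hI, hx⟩ := hz.exists_isComponent h (h.a_pos hx0)
  have hzl : z ≤ l := hI.left_le_of_zero hz0 hx hzx
  obtain ⟨hl₁, hl₂⟩ := hzero l ⟨hzl, hx.1.le⟩ hI.left
  obtain ⟨c, hc, hcx⟩ := (((hp.left l r hI).eventually (Ioo_mem_nhds hl₁ hl₂)).and
    (Ioo_mem_nhdsGT hx.1)).exists
  have hsol := (hp.ode l r hI).solvesOn hcx.1 hx.2
  have hpos (y) (hy : y ∈ Icc c x) : 0 < a y := hI.pos y (Icc_subset_Ioo hcx.1 hx.2 hy)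
  have hHc (y) (hy : y ∈ Icc c x) := hH y ⟨hzl.trans (hcx.1.le.trans hy.1), hy.2⟩
  exact ⟨hsol.const_le hcx.2.le hpos (fun y hy => (hHc y hy).1) hc.1.le,
    hsol.le_const hcx.2.le hpos (fun y hy => (hHc y hy).2) hc.2.le⟩

/-- Either zeros of `a` accumulate at `x₀` from the left, and `p` is squeezed between two levels as
in `mem_Icc`, or `x₀` is the right endpoint of a component. -/
lemma IsPiecewiseUpperProfile.tendsto_nhdsLT {p : ℝ → ℝ} (hp : IsPiecewiseUpperProfile a H lam p)
    (h : Admissible M a H) (hz : HasZerosOnBothSides a) {x₀ : ℝ} (hx₀ : a x₀ = 0) :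
    Tendsto p (𝓝[<] x₀) (𝓝 (p x₀)) := by
  by_cases hacc : ∃ b < x₀, ∀ z ∈ Ioo b x₀, a z ≠ 0
  · obtain ⟨b, hb, hne⟩ := hacc
    obtain ⟨y, hy⟩ := nonempty_Ioo.2 hb
    obtain ⟨l, r, hI, hyI⟩ := hz.exists_isComponent h (h.a_pos (hne y hy))
    have hr : r = x₀ := (hI.le_right_of_zero hx₀ hyI hy.2.le).antisymm <| by
      by_contra! hlt
      exact hne r ⟨hy.1.trans hyI.2, hlt⟩ hI.right
    exact hr ▸ hp.right l r hI
  push Not at hacc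
  refine Metric.tendsto_nhds.2 fun ε hε => ?_
  obtain ⟨k₁, k₂, hεk, hk₁, hk₂, hkε, hH⟩ := (hp.root x₀ hx₀).exists_levels h hε
  obtain ⟨δ, hδ, hball⟩ := Metric.eventually_nhds_iff_ball.1 hH
  rw [Real.ball_eq_Ioo] at hball
  obtain ⟨z, hzI, hz0⟩ := hacc (x₀ - δ) (by linarith)
  filter_upwards [Ioo_mem_nhdsLT hzI.2] with x hx
  obtain ⟨hlow, hhigh⟩ := hp.mem_Icc h hz (hk₁.trans hk₂) hz0 hx.1.le fun y hy =>
    hball y ⟨hzI.1.trans_le hy.1, hy.2.trans_lt (by linarith [hx.2])⟩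
  exact abs_lt.2 ⟨by linarith, by linarith⟩

lemma IsPiecewiseUpperProfile.tendsto_nhdsGE {p : ℝ → ℝ} (hp : IsPiecewiseUpperProfile a H lam p)
    (h : Admissible M a H) (hz : HasZerosOnBothSides a) {x₀ : ℝ} (hx₀ : a x₀ = 0) :
    Tendsto p (𝓝[≥] x₀) (𝓝 (p x₀)) := by
  refine Metric.tendsto_nhds.2 fun ε hε => ?_
  obtain ⟨k₁, k₂, hεk, hk₁, hk₂, hkε, hH⟩ := (hp.root x₀ hx₀).exists_levels h hε
  obtain ⟨δ, hδ, hball⟩ := Metric.eventually_nhds_iff_ball.1 hH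
  rw [Real.ball_eq_Ioo] at hball
  filter_upwards [Ico_mem_nhdsGE (lt_add_of_pos_right x₀ hδ)] with x hx
  obtain ⟨hlow, hhigh⟩ := hp.mem_Icc h hz (hk₁.trans hk₂) hx₀ hx.1 fun y hy =>
    hball y ⟨by linarith [hy.1], hy.2.trans_lt hx.2⟩
  exact abs_lt.2 ⟨by linarith, by linarith⟩

lemma IsPiecewiseUpperProfile.continuous {p : ℝ → ℝ} (hp : IsPiecewiseUpperProfile a H lam p)
    (h : Admissible M a H) (hz : HasZerosOnBothSides a) : Continuous p := by
  refine continuous_iff_continuousAt.2 fun x => ?_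
  by_cases hx : a x = 0
  · rw [ContinuousAt, ← nhdsLT_sup_nhdsGE]
    exact (hp.tendsto_nhdsLT h hz hx).sup (hp.tendsto_nhdsGE h hz hx)
  · obtain ⟨l, r, hI, hxI⟩ := hz.exists_isComponent h (h.a_pos hx)
    exact (hp.ode l r hI x hxI).continuousAt

lemma HasZerosOnBothSides.exists_glue (hz : HasZerosOnBothSides a) (h : Admissible M a H)
    (g : ℝ → ℝ) (f : ℝ → ℝ → ℝ → ℝ) :
    ∃ p : ℝ → ℝ, (∀ x, a x = 0 → p x = g x) ∧
      ∀ l r, IsComponent a l r → EqOn p (f l r) (Ioo l r) := by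
  classical
  have hends (x) (hx : 0 < a x) : ∃ l r, IsComponent a l r ∧ x ∈ Ioo l r :=
    hz.exists_isComponent h hx
  choose! l r hI hx using hends
  refine ⟨fun x => if a x = 0 then g x else f (l x) (r x) x, fun x hx => if_pos hx,
    fun l' r' hI' x hx' => ?_⟩
  have hpos := hI'.pos x hx'
  obtain ⟨hl, hr⟩ := (hI x hpos).unique hI' (hx x hpos) hx'
  simp only [if_neg hpos.ne', hl, hr]

lemma Admissible.exists_component_solution_tendsto (h : Admissible M a H) {mu : ℝ}
    (hmu : mu < lam) (hR : M lam ≤ R) (hbar : HasBarriers a H mu R) {P : ℝ → ℝ}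
    (hP : ∀ z, a z = 0 → IsUpperRoot H lam z (P z)) (hI : IsComponent a l r) :
    ∃ p, SolvesOnIoo a H lam l r p ∧ (∀ y ∈ Ioo l r, |p y| ≤ R) ∧
      Tendsto p (𝓝[>] l) (𝓝 (P l)) ∧ Tendsto p (𝓝[<] r) (𝓝 (P r)) := by
  obtain ⟨p, hp, hpR, ⟨Q, hQ, hpQ⟩, Q', hQ', hpQ'⟩ :=
    h.exists_component_solution hI hmu hR fun c d hc hcd hd =>
      hbar.barrier c d hcd fun y hy => hI.pos y (Icc_subset_Ioo hc hd hy)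
  rw [hQ.unique h (hP l hI.left)] at hpQ
  rw [hQ'.unique h (hP r hI.right)] at hpQ'
  exact ⟨p, hp, hpR, hpQ, hpQ'⟩

theorem Admissible.exists_isUpperProfile (h : Admissible M a H) (hz : HasZerosOnBothSides a)
    {mu : ℝ} (hmu : mu < lam) (hR : M lam ≤ R) (hbar : HasBarriers a H mu R) :
    ∃ p, IsUpperProfile a H lam p ∧ ∀ x, |p x| ≤ R := by
  have hroot (z) (hz0 : a z = 0) : ∃ P, IsUpperRoot H lam z P := by
    obtain ⟨q, hq⟩ := hbar.zero z hz0
    exact h.exists_isUpperRoot (hq.trans_lt hmu)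
  choose! P hP using hroot
  choose! f hf hfR hfl hfr using fun l r (hI : IsComponent a l r) =>
    h.exists_component_solution_tendsto hmu hR hbar hP hI
  obtain ⟨p, hpP, hpf⟩ := hz.exists_glue h P f
  have hp : IsPiecewiseUpperProfile a H lam p := by
    refine ⟨fun x hx => (hpP x hx).symm ▸ hP x hx, fun l r hI x hx => ?_, fun l r hI => ?_,
      fun l r hI => ?_⟩
    · rw [hpf l r hI hx]
      exact (hf l r hI x hx).congr_of_eventuallyEq
        ((hpf l r hI).eventuallyEq_of_mem (Ioo_mem_nhds hx.1 hx.2))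
    · rw [hpP l hI.left]
      exact (hfl l r hI).congr' ((hpf l r hI).eventuallyEq_of_mem (Ioo_mem_nhdsGT hI.lt)).symm
    · rw [hpP r hI.right]
      exact (hfr l r hI).congr' ((hpf l r hI).eventuallyEq_of_mem (Ioo_mem_nhdsLT hI.lt)).symm
  have hpR (x) : |p x| ≤ R := by
    by_cases hx : a x = 0
    · exact (h.abs_lt_of_H_le (hp.root x hx).1.le).le.trans hR
    · obtain ⟨l, r, hI, hxI⟩ := hz.exists_isComponent h (h.a_pos hx)
      rw [hpf l r hI hxI]
      exact hfR l r hI x hxI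
  refine ⟨p, ⟨hp.continuous h hz, ⟨R, hpR⟩, fun x hx => ?_, hp.root⟩, hpR⟩
  obtain ⟨l, r, hI, hxI⟩ := hz.exists_isComponent h hx
  exact hp.ode l r hI x hxI

lemma IsUpperProfile.solvesOnIoo {p : ℝ → ℝ} (hp : IsUpperProfile a H lam p)
    (hI : IsComponent a l r) : SolvesOnIoo a H lam l r p := fun y hy => hp.ode y (hI.pos y hy)

lemma IsUpperProfile.unique (h : Admissible M a H) (hz : HasZerosOnBothSides a) {p q : ℝ → ℝ}
    (hp : IsUpperProfile a H lam p) (hq : IsUpperProfile a H lam q) : p = q := by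
  ext x
  by_cases hx : a x = 0
  · exact (hp.root x hx).unique h (hq.root x hx)
  obtain ⟨l, r, hI, hxI⟩ := hz.exists_isComponent h (h.a_pos hx)
  obtain ⟨R₁, hR₁⟩ := hp.bdd
  obtain ⟨R₂, hR₂⟩ := hq.bdd
  have hpl : Tendsto p (𝓝[>] l) (𝓝 (p l)) := (hp.cont.tendsto l).mono_left nhdsWithin_le_nhds
  have hql : Tendsto q (𝓝[>] l) (𝓝 (p l)) := by
    rw [(hp.root l hI.left).unique h (hq.root l hI.left)]
    exact (hq.cont.tendsto l).mono_left nhdsWithin_le_nhds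
  exact (hp.solvesOnIoo hI).eq_of_tendsto h hI.lt hI.pos (hp.root l hI.left) (hq.solvesOnIoo hI)
    hpl hql (R := max R₁ R₂) (fun y _ => (hR₁ y).trans (le_max_left _ _))
    (fun y _ => (hR₂ y).trans (le_max_right _ _)) x hxI

lemma TouchesBelow.curvature_le {u P : ℝ → ℝ} {x q s s' : ℝ} (hT : TouchesBelow u x q s)
    (hu : ∀ᶠ y in 𝓝 x, HasDerivAt u (P y) y) (hP : HasDerivAt P s' x) : s ≤ s' := by
  refine le_of_forall_pos_le_add fun ε hε => ?_
  have habove : TouchesBelow (fun y => -u y) x (-P x) (-s' - ε) :=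
    touchesBelow_of_hasDerivAt (P := fun y => -P y) (hu.mono fun y hy => hy.fun_neg)
      (eventually_le_of_hasDerivWithinAt_Ioi hP.fun_neg.hasDerivWithinAt (by linarith))
      (eventually_le_of_hasDerivWithinAt_Iio hP.fun_neg.hasDerivWithinAt (by linarith))
  obtain rfl : q = P x := hT.eq_of_hasDerivAt hu.self_of_nhds
  obtain ⟨y, ⟨hbelow, habove⟩, hxy : x < y⟩ :=
    (((hT.and habove).filter_mono nhdsWithin_le_nhds).and
      (eventually_mem_nhdsWithin (s := Ioi x))).exists
  have hsq : 0 < (y - x) ^ 2 := pow_pos (sub_pos.2 hxy) 2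
  exact le_of_mul_le_mul_right (by linarith) hsq

lemma TouchesBelow.mul_curvature_le {u P : ℝ → ℝ} {x q s t : ℝ} (hT : TouchesBelow u x q s)
    (hu : ∀ y, HasDerivAt u (P y) y) (hx : 0 ≤ a x) (hP : 0 < a x → HasDerivAt P (t / a x) x)
    (ht : a x = 0 → t = 0) : a x * s ≤ t := by
  rcases hx.eq_or_lt' with hx | hx
  · rw [hx, ht hx, zero_mul]
  · rw [mul_comm, ← le_div_iff₀ hx]
    exact hT.curvature_le (Eventually.of_forall hu) (hP hx)

lemma IsUpperProfile.isViscositySolution {p u : ℝ → ℝ} (h : Admissible M a H)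
    (hp : IsUpperProfile a H lam p) (hu : ∀ x, HasDerivAt u (p x) x) :
    IsViscositySolution a H lam u := by
  have hcont : Continuous u := continuous_iff_continuousAt.2 fun x => (hu x).continuousAt
  refine ⟨isViscositySubsolution_iff_neg.2 (isViscositySupersolution_iff.2
      ⟨hcont.neg, fun x q s hT => ?_⟩),
    isViscositySupersolution_iff.2 ⟨hcont, fun x q s hT => ?_⟩⟩
  · obtain rfl : q = -p x := hT.eq_of_hasDerivAt (hu x).fun_neg
    rw [neg_neg]
    linarith [hT.mul_curvature_le (t := H x (p x) - lam) (fun y => (hu y).fun_neg) (h.a_nonneg x)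
      (fun hx => (hp.ode x hx).fun_neg.congr_deriv (by ring))
      fun hx => sub_eq_zero.2 (hp.root x hx).1]
  · obtain rfl : q = p x := hT.eq_of_hasDerivAt (hu x)
    linarith [hT.mul_curvature_le hu (h.a_nonneg x) (hp.ode x)
      fun hx => sub_eq_zero.2 (hp.root x hx).1.symm]

end Components

section RealAnalysis

lemma lipschitzWith_of_hasDerivAt {u p : ℝ → ℝ} {R : ℝ} (hu : ∀ x, HasDerivAt u (p x) x)
    (hR : ∀ x, |p x| ≤ R) : LipschitzWith R.toNNReal u := by
  refine lipschitzWith_of_nnnorm_deriv_le (fun x => (hu x).differentiableAt) fun x => ?_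
  rw [(hu x).deriv, ← NNReal.coe_le_coe, coe_nnnorm]
  exact (hR x).trans (Real.le_coe_toNNReal R)

lemma hasDerivAt_of_ae_deriv_eq {u p : ℝ → ℝ} (hu : IsLip u) (hp : Continuous p)
    (hae : ∀ᵐ x, deriv u x = p x) (x : ℝ) : HasDerivAt u (p x) x := by
  obtain ⟨K, hK⟩ := hu
  have hint (y : ℝ) : u y = u 0 + ∫ t in (0 : ℝ)..y, p t := by
    rw [← intervalIntegral.integral_congr_ae (hae.mono fun t ht _ => ht),
      hK.lipschitzOnWith.absolutelyContinuousOnInterval.integral_deriv_eq_sub]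
    ring
  rw [funext hint]
  exact (hp.integral_hasStrictDerivAt 0 x).hasDerivAt.const_add _

lemma exists_limit_of_lipschitzWith {K : NNReal} {u : ℕ → ℝ → ℝ} (hu : ∀ n, LipschitzWith K (u n))
    (hu0 : ∀ n, u n 0 = 0) :
    ∃ (U : Ultrafilter ℕ) (v : ℝ → ℝ), (U : Filter ℕ) ≤ atTop ∧ LipschitzWith K v ∧ v 0 = 0 ∧
      ∀ T, TendstoUniformlyOn u v U (Icc (-T) T) := by
  have hbound (n : ℕ) (x : ℝ) : |u n x| ≤ K * |x| := by
    simpa [hu0, Real.dist_eq] using (hu n).dist_le_mul x 0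
  obtain ⟨U, v, hU, hv⟩ := exists_pointwise_limit (S := univ) (R := fun x => K * |x|)
    fun x _ => Eventually.of_forall fun n => hbound n x
  have hlim (x : ℝ) : Tendsto (fun n => u n x) U (𝓝 (v x)) := (hv x trivial).2
  refine ⟨U, v, hU, .of_dist_le_mul fun x y => ?_, by simpa using (hv 0 trivial).1, fun T => ?_⟩
  · exact le_of_tendsto ((hlim x).dist (hlim y)) (.of_forall fun n => (hu n).dist_le_mul x y)
  · have hunif := (EquicontinuousOn.tendsto_uniformOnFun_iff_pi (𝔖 := {K | IsCompact K})
      (fun _ hK => hK) sUnion_isCompact_eq_univ (fun K _ => (LipschitzWith.uniformEquicontinuous u _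
        hu).equicontinuous.equicontinuousOn K) U v).2 (tendsto_pi_nhds.2 hlim)
    exact UniformOnFun.tendsto_iff_tendstoUniformlyOn.1 hunif _ isCompact_Icc

end RealAnalysis

section Deterministic

variable {M : ℝ → ℝ} {a : ℝ → ℝ} {H : ℝ → ℝ → ℝ} {lam mu l r R : ℝ}

lemma IsLip.exists_abs_deriv_le {u : ℝ → ℝ} (hu : IsLip u) : ∃ K, ∀ x, |deriv u x| ≤ K := by
  obtain ⟨K, hK⟩ := hu
  exact ⟨K, fun x => norm_deriv_le_of_lipschitz hK⟩

lemma IsLip.ae_differentiableAt {u : ℝ → ℝ} (hu : IsLip u) : ∀ᵐ x, DifferentiableAt ℝ u x := by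
  obtain ⟨K, hK⟩ := hu
  exact hK.ae_differentiableAt

lemma IsViscositySolution.solvesOnIoo_deriv (h : Admissible M a H) {u : ℝ → ℝ}
    (hu : IsViscositySolution a H lam u) (hL : IsLip u) (hI : IsComponent a l r) :
    SolvesOnIoo a H lam l r (deriv u) := fun y hy => (hu.hasDerivAt_deriv h hL (hI.pos y hy)).2

lemma SolvesOnIoo.continuousOn {p : ℝ → ℝ} (hp : SolvesOnIoo a H lam l r p) :
    ContinuousOn p (Ioo l r) := fun y hy => (hp y hy).continuousAt.continuousWithinAt

lemma SolvesOnIoo.le_of_ae_le {p q : ℝ → ℝ} (hp : SolvesOnIoo a H lam l r p)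
    (hq : SolvesOnIoo a H mu l r q) (hle : ∀ᵐ x, q x ≤ p x) : ∀ x ∈ Ioo l r, q x ≤ p x := by
  have hmin : (fun x => min (q x) (p x)) =ᵐ[volume.restrict (Ioo l r)] q :=
    (ae_restrict_of_ae hle).mono fun x hx => min_eq_left hx
  exact fun x hx => min_eq_left_iff.1 (Measure.eqOn_open_of_ae_eq hmin isOpen_Ioo
    (hq.continuousOn.inf hp.continuousOn) hq.continuousOn hx)

lemma IsUpperProfile.tendsto_nhdsGT {p : ℝ → ℝ} (hp : IsUpperProfile a H lam p) (x : ℝ) :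
    Tendsto p (𝓝[>] x) (𝓝 (p x)) := (hp.cont.tendsto x).mono_left nhdsWithin_le_nhds

lemma IsUpperProfile.ae_deriv_le (h : Admissible M a H) (hz : HasZerosOnBothSides a) {p v : ℝ → ℝ}
    (hp : IsUpperProfile a H lam p) (hmu : mu < lam) (hv : IsViscositySolution a H mu v)
    (hvL : IsLip v) : ∀ᵐ x, deriv v x ≤ p x := by
  filter_upwards [hvL.ae_differentiableAt] with x hx
  by_cases hx0 : a x = 0
  · exact (hp.root x hx0).le_of_H_le h
      ((hv.H_eq_of_hasDerivAt h hx0 hx.hasDerivAt).le.trans hmu.le)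
  · obtain ⟨l, r, hI, hxI⟩ := hz.exists_isComponent h (h.a_pos hx0)
    obtain ⟨K, hK⟩ := hvL.exists_abs_deriv_le
    exact (hp.solvesOnIoo hI).le_of_level_lt h hI hmu (hp.root l hI.left) (hp.tendsto_nhdsGT l)
      (hv.solvesOnIoo_deriv h hvL hI) (fun y _ => hK y) x hxI

lemma IsUpperProfile.eq_on_component (h : Admissible M a H) {p P Q : ℝ → ℝ}
    (hp : IsUpperProfile a H lam p) (hI : IsComponent a l r) (hmu : mu < lam)
    (hP : SolvesOnIoo a H lam l r P) (hPR : ∃ R, ∀ x, |P x| ≤ R)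
    (hQ : SolvesOnIoo a H mu l r Q) (hQR : ∃ R, ∀ x, |Q x| ≤ R)
    (hQP : ∀ x ∈ Ioo l r, Q x ≤ P x) : ∀ x ∈ Ioo l r, P x = p x := by
  obtain ⟨R₀, hR₀⟩ := hp.bdd
  obtain ⟨R₁, hR₁⟩ := hPR
  obtain ⟨R₂, hR₂⟩ := hQR
  have hP₁ (x : ℝ) : |P x| ≤ max R₀ (max R₁ R₂) := le_max_of_le_right (le_max_of_le_left (hR₁ x))
  obtain ⟨P₀, hP₀, hlim⟩ := (hP.exists_tendsto_upperRoot h hI hmu (fun x _ => hP₁ x) hQ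
    (fun x _ => le_max_of_le_right (le_max_of_le_right (hR₂ x))) hQP).1
  obtain rfl : P₀ = p l := hP₀.unique h (hp.root l hI.left)
  exact hP.eq_of_tendsto h hI.lt hI.pos hP₀ (hp.solvesOnIoo hI) hlim (hp.tendsto_nhdsGT l)
    (fun x _ => hP₁ x) (fun x _ => le_max_of_le_left (hR₀ x))

theorem IsUpperProfile.hasDerivAt_of_ae_le (h : Admissible M a H) (hz : HasZerosOnBothSides a)
    {p u v : ℝ → ℝ} (hp : IsUpperProfile a H lam p) (hmu : mu < lam)
    (hv : IsViscositySolution a H mu v) (hvL : IsLip v) (hu : IsViscositySolution a H lam u)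
    (huL : IsLip u) (hle : ∀ᵐ x, deriv v x ≤ deriv u x) : ∀ x, HasDerivAt u (p x) x := by
  refine hasDerivAt_of_ae_deriv_eq huL hp.cont ?_
  filter_upwards [huL.ae_differentiableAt, hvL.ae_differentiableAt, hle] with x hux hvx hlex
  by_cases hx0 : a x = 0
  · exact (isUpperRoot_of_le hmu (hu.H_eq_of_hasDerivAt h hx0 hux.hasDerivAt)
      (hv.H_eq_of_hasDerivAt h hx0 hvx.hasDerivAt) hlex).unique h (hp.root x hx0)
  · obtain ⟨l, r, hI, hxI⟩ := hz.exists_isComponent h (h.a_pos hx0)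
    have hu' := hu.solvesOnIoo_deriv h huL hI
    have hv' := hv.solvesOnIoo_deriv h hvL hI
    exact hp.eq_on_component h hI hmu hu' huL.exists_abs_deriv_le hv' hvL.exists_abs_deriv_le
      (hu'.le_of_ae_le hv' hle) x hxI

lemma IsViscositySupersolution.hasBarriers (h : Admissible M a H) {w : ℝ → ℝ}
    (hw : IsViscositySupersolution a H mu w) (hmu : mu < lam) (hR : M lam < R) :
    HasBarriers a H lam R where
  zero z hz := by
    obtain ⟨q, hq⟩ := hw.exists_H_lt_of_a_eq_zero h hz hmu
    exact ⟨q, hq.le⟩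
  barrier c d hcd ha := by
    obtain ⟨p, hp, hpR⟩ := hw.exists_solvesOn h hmu hR hcd ha
    refine ⟨p, _, hp, hpR, fun y hy => ?_⟩
    rw [mul_div_cancel₀ _ (ha y hy).ne']
    linarith

lemma Admissible.exists_supersolution (h : Admissible M a H) :
    ∃ lam, ∃ w, IsViscositySupersolution a H lam w := by
  obtain ⟨B, -, hB⟩ := h.H_bdd 0
  refine ⟨B, fun _ => 0, isViscositySupersolution_iff.2 ⟨continuous_const, fun x p s hT => ?_⟩⟩
  obtain rfl : p = 0 := hT.eq_of_hasDerivAt (hasDerivAt_const x 0)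
  have hs : s ≤ 0 := hT.curvature_le (P := fun _ => 0)
    (Eventually.of_forall fun y => hasDerivAt_const y 0) (hasDerivAt_const x 0)
  have hH : H x 0 ≤ B := (le_abs_self _).trans (hB x 0 abs_zero.le)
  linarith [mul_nonpos_of_nonneg_of_nonpos (h.a_nonneg x) hs]

lemma Admissible.bddBelow_supersolution (h : Admissible M a H) {z : ℝ} (hz : a z = 0) :
    BddBelow {lam : ℝ | ∃ u : ℝ → ℝ, IsViscositySupersolution a H lam u} := by
  obtain ⟨B, hB, hHB⟩ := h.H_bdd (M 0)
  refine ⟨-B, ?_⟩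
  rintro lam ⟨w, hw⟩
  by_contra! hlt
  obtain ⟨p, hp⟩ := hw.exists_H_lt_of_a_eq_zero h hz hlt
  have hpM : |p| < M 0 := h.abs_lt_of_H_le (x := z) (by linarith)
  linarith [(abs_le.1 (hHB z p hpM.le)).1]

lemma Admissible.exists_supersolution_of_criticalValue_lt (h : Admissible M a H)
    (hlam : criticalValue a H < lam) : ∃ mu < lam, ∃ w, IsViscositySupersolution a H mu w := by
  obtain ⟨mu, hmu, hmulam⟩ := exists_lt_of_csInf_lt h.exists_supersolution hlam
  exact ⟨mu, hmulam, hmu⟩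

lemma Admissible.exists_isUpperProfile_of_criticalValue_lt (h : Admissible M a H)
    (hz : HasZerosOnBothSides a) (hlam : criticalValue a H < lam) :
    ∃ p, IsUpperProfile a H lam p ∧ ∀ x, |p x| ≤ M lam + 1 := by
  obtain ⟨mu, hmu, w, hw⟩ := h.exists_supersolution_of_criticalValue_lt hlam
  obtain ⟨nu, hmunu, hnulam⟩ := exists_between hmu
  exact h.exists_isUpperProfile hz hnulam (by linarith)
    (hw.hasBarriers h hmunu ((h.mono_M hnulam.le).trans_lt (lt_add_one _)))

lemma IsUpperProfile.exists_solution (h : Admissible M a H) {p : ℝ → ℝ}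
    (hp : IsUpperProfile a H lam p) (hR : ∀ x, |p x| ≤ R) : ∃ u : ℝ → ℝ,
      LipschitzWith R.toNNReal u ∧ IsViscositySolution a H lam u ∧ u 0 = 0 ∧
        ∀ x, HasDerivAt u (p x) x := by
  have hderiv (x : ℝ) : HasDerivAt (fun x => ∫ t in (0 : ℝ)..x, p t) (p x) x :=
    (hp.cont.integral_hasStrictDerivAt 0 x).hasDerivAt
  exact ⟨_, lipschitzWith_of_hasDerivAt hderiv hR, hp.isViscositySolution h hderiv, by simp, hderiv⟩

lemma Admissible.exists_limit_viscositySolution (h : Admissible M a H) {K : NNReal}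
    {nu : ℕ → ℝ} {u : ℕ → ℝ → ℝ} (hnu : Tendsto nu atTop (𝓝 lam))
    (hK : ∀ n, LipschitzWith K (u n)) (hu : ∀ n, IsViscositySolution a H (nu n) (u n))
    (hu0 : ∀ n, u n 0 = 0) :
    ∃ v, IsLip v ∧ IsViscositySolution a H lam v ∧ v 0 = 0 := by
  obtain ⟨U, v, hU, hvK, hv0, huv⟩ := exists_limit_of_lipschitzWith hK hu0
  refine ⟨v, ⟨K, hvK⟩, ?_, hv0⟩
  refine .of_approx h.continuous_a h.continuous_H hvK.continuous fun T _ δ hδ => ?_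
  obtain ⟨n, hn, hnlam⟩ := ((Metric.tendstoUniformlyOn_iff.1 (huv T) δ hδ).and
    (hU (Metric.tendsto_nhds.1 hnu δ hδ))).exists
  refine ⟨u n, nu n, hnlam.le, hu n, fun y hy => ?_⟩
  rw [abs_sub_comm]
  exact (hn y (abs_le.1 hy)).le

theorem Admissible.exists_critical_solution (h : Admissible M a H) (hz : HasZerosOnBothSides a) :
    ∃ v, IsLip v ∧ IsViscositySolution a H (criticalValue a H) v ∧ v 0 = 0 := by
  set lam₀ := criticalValue a H
  have happ (n : ℕ) : ∃ u : ℝ → ℝ, LipschitzWith (M (lam₀ + 1) + 1).toNNReal u ∧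
      IsViscositySolution a H (lam₀ + 1 / ((n : ℝ) + 1)) u ∧ u 0 = 0 := by
    obtain ⟨p, hp, hpR⟩ := h.exists_isUpperProfile_of_criticalValue_lt hz
      (lt_add_of_pos_right lam₀ (Nat.one_div_pos_of_nat (n := n)))
    have hle : lam₀ + 1 / ((n : ℝ) + 1) ≤ lam₀ + 1 := by
      simpa using Nat.one_div_le_one_div (α := ℝ) n.zero_le
    obtain ⟨u, huR, hu, hu0, -⟩ := hp.exists_solution h (R := M (lam₀ + 1) + 1) fun x =>
      (hpR x).trans (by gcongr; exact h.mono_M hle)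
    exact ⟨u, huR, hu, hu0⟩
  choose u huR hu hu0 using happ
  refine h.exists_limit_viscositySolution ?_ huR hu hu0
  simpa using tendsto_one_div_add_atTop_nhds_zero_nat.const_add lam₀

end Deterministic

section CoercivityBound

variable {a : ℝ → ℝ} {H : ℝ → ℝ → ℝ} {κ α₀ α₁ γ η : ℝ}

/-- A momentum size from which on a Hamiltonian with lower growth `α₀ |p| ^ γ - 1 / α₀` exceeds
`t + p ^ 2`; it serves as the function `M` of `Admissible`. -/
noncomputable def coercivityBound (α₀ γ t : ℝ) : ℝ :=
  1 + (2 / α₀) ^ (1 / (γ - 2)) + max t 0 + 1 / α₀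

lemma one_le_coercivityBound (hα₀ : 0 < α₀) (t : ℝ) : 1 ≤ coercivityBound α₀ γ t := by
  have hpow : 0 ≤ (2 / α₀) ^ (1 / (γ - 2)) := by positivity
  have hinv : 0 ≤ 1 / α₀ := by positivity
  unfold coercivityBound
  linarith [le_max_right t 0]

lemma monotone_coercivityBound : Monotone (coercivityBound α₀ γ) := fun s t hst => by
  unfold coercivityBound
  gcongr

lemma lt_of_coercivityBound_le_abs (hα₀ : 0 < α₀) (hγ : 2 < γ) {t p : ℝ}
    (hp : coercivityBound α₀ γ t ≤ |p|) : t + p ^ 2 < α₀ * |p| ^ γ - 1 / α₀ := by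
  have hpow : 0 < (2 / α₀) ^ (1 / (γ - 2)) := by positivity
  have hinv : 0 < 1 / α₀ := by positivity
  have hmax : 0 ≤ max t 0 := le_max_right _ _
  unfold coercivityBound at hp
  have hp_one : 1 ≤ |p| := by linarith
  have hratio : 2 / α₀ ≤ |p| ^ (γ - 2) := by
    calc 2 / α₀ = ((2 / α₀) ^ (1 / (γ - 2))) ^ (γ - 2) := by
          rw [← Real.rpow_mul (by positivity), one_div_mul_cancel (by linarith), Real.rpow_one]
      _ ≤ |p| ^ (γ - 2) := Real.rpow_le_rpow hpow.le (by linarith) (by linarith)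
  have hquad : 2 * p ^ 2 ≤ α₀ * |p| ^ γ := by
    calc 2 * p ^ 2 ≤ α₀ * |p| ^ (γ - 2) * p ^ 2 := by
          gcongr
          rwa [div_le_iff₀' hα₀] at hratio
      _ = α₀ * |p| ^ γ := by
          rw [mul_assoc, ← sq_abs p, ← Real.rpow_natCast,
            ← Real.rpow_add (one_pos.trans_le hp_one)]
          norm_num
  have hp_sq : |p| ≤ p ^ 2 := by
    rw [← sq_abs]
    exact le_self_pow₀ hp_one two_ne_zero
  linarith [le_max_left t 0]

lemma abs_sub_le_of_sqrt_lipschitz (ha : ∀ x, 0 ≤ a x ∧ a x ≤ 1)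
    (hA : ∀ x y, |√(a x) - √(a y)| ≤ κ * |x - y|) (x y : ℝ) :
    |a x - a y| ≤ 2 * κ * |x - y| := by
  have hsum : √(a x) + √(a y) ≤ 2 := by
    linarith [Real.sqrt_le_one.2 (ha x).2, Real.sqrt_le_one.2 (ha y).2]
  calc |a x - a y| = |√(a x) - √(a y)| * (√(a x) + √(a y)) := by
        rw [← abs_of_nonneg (show 0 ≤ √(a x) + √(a y) by positivity), ← abs_mul, mul_comm,
          ← sq_sub_sq, Real.sq_sqrt (ha x).1, Real.sq_sqrt (ha y).1]
    _ ≤ κ * |x - y| * 2 :=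
        mul_le_mul (hA x y) hsum (by positivity) ((abs_nonneg _).trans (hA x y))
    _ = 2 * κ * |x - y| := by ring

lemma le_sq_of_sqrt_lipschitz {z : ℝ} (ha : ∀ x, 0 ≤ a x)
    (hA : ∀ x y, |√(a x) - √(a y)| ≤ κ * |x - y|) (hz : a z = 0) (x : ℝ) :
    a x ≤ κ ^ 2 * (x - z) ^ 2 := by
  have hroot : √(a x) ≤ κ * |x - z| := by
    simpa [hz, abs_of_nonneg (Real.sqrt_nonneg _)] using hA x z
  calc a x = √(a x) ^ 2 := (Real.sq_sqrt (ha x)).symm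
    _ ≤ (κ * |x - z|) ^ 2 := by gcongr
    _ = κ ^ 2 * (x - z) ^ 2 := by rw [mul_pow, sq_abs]

lemma HamiltonianClass.abs_H_sub_le (hH : HamiltonianClass α₀ α₁ γ H) (hα₁ : 0 < α₁) (hγ : 1 ≤ γ)
    {R x y p q : ℝ} (hp : |p| ≤ R) (hq : |q| ≤ R) :
    |H x p - H y q| ≤
      (α₁ * (R ^ γ + 1) + α₁ * (R + R + 1) ^ (γ - 1)) * (|x - y| + |p - q|) := by
  have hR : 0 ≤ R := (abs_nonneg p).trans hp
  have hspace : |H x p - H y p| ≤ α₁ * (R ^ γ + 1) * |x - y| :=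
    (hH.lipschitz_space x y p).trans (by gcongr)
  have hmomentum : |H y p - H y q| ≤ α₁ * (R + R + 1) ^ (γ - 1) * |p - q| :=
    (hH.lipschitz_momentum y p q).trans (by gcongr)
  have hcross₁ : 0 ≤ α₁ * (R ^ γ + 1) * |p - q| := by positivity
  have hcross₂ : 0 ≤ α₁ * (R + R + 1) ^ (γ - 1) * |x - y| := by positivity
  linarith [abs_sub_le (H x p) (H y p) (H y q)]

lemma HamiltonianClass.abs_H_le (hH : HamiltonianClass α₀ α₁ γ H) (hα₀ : 0 < α₀) (hα₁ : 0 < α₁)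
    (hγ : 0 ≤ γ) {R x p : ℝ} (hp : |p| ≤ R) : |H x p| ≤ α₁ * (R ^ γ + 1) + 1 / α₀ := by
  have hR : 0 ≤ R := (abs_nonneg p).trans hp
  have hupper : H x p ≤ α₁ * (R ^ γ + 1) := (hH.growth_upper x p).trans (by gcongr)
  have hlower : -(1 / α₀) ≤ H x p := by
    have hpow : 0 ≤ α₀ * |p| ^ γ := by positivity
    linarith [hH.growth_lower x p]
  have hinv : 0 ≤ 1 / α₀ := by positivity
  have hconst : 0 ≤ α₁ * (R ^ γ + 1) := by positivity
  exact abs_le'.2 ⟨by linarith, by linarith⟩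

lemma SqcHamiltonianClass.lt_max (hH : SqcHamiltonianClass α₀ α₁ γ η H) (x : ℝ) {p q r : ℝ}
    (hpq : p < q) (hqr : q < r) : H x q < max (H x p) (H x r) := by
  have hrp : 0 < r - p := by linarith
  convert hH.strict_quasiconvex x p r ((q - p) / (r - p)) (by linarith)
    (div_pos (by linarith) hrp) ((div_lt_one hrp).2 (by linarith)) using 2
  field_simp
  ring

lemma SqcHamiltonianClass.admissible (hκ : 0 < κ) (hα₀ : 0 < α₀) (hα₁ : 0 < α₁) (hγ : 2 < γ)
    (ha : ∀ x, 0 ≤ a x ∧ a x ≤ 1) (hA : ∀ x y, |√(a x) - √(a y)| ≤ κ * |x - y|)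
    (hH : SqcHamiltonianClass α₀ α₁ γ η H) : Admissible (coercivityBound α₀ γ) a H where
  a_nonneg x := (ha x).1
  a_le_one x := (ha x).2
  a_lip := ⟨2 * κ, abs_sub_le_of_sqrt_lipschitz ha hA⟩
  a_quad := ⟨κ ^ 2, by positivity,
    fun _ x hz => le_sq_of_sqrt_lipschitz (fun x => (ha x).1) hA hz x⟩
  H_lip R := ⟨α₁ * (|R| ^ γ + 1) + α₁ * (|R| + |R| + 1) ^ (γ - 1), by positivity,
    fun _ _ _ _ hp hq => hH.abs_H_sub_le hα₁ (by linarith) (hp.trans (le_abs_self R))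
      (hq.trans (le_abs_self R))⟩
  H_bdd R := ⟨α₁ * (|R| ^ γ + 1) + 1 / α₀, by positivity,
    fun _ _ hp => hH.abs_H_le hα₀ hα₁ (by linarith) (hp.trans (le_abs_self R))⟩
  one_le_M := one_le_coercivityBound hα₀
  mono_M := monotone_coercivityBound
  coercive _ x p hp := (lt_of_coercivityBound_le_abs hα₀ hγ hp).trans_le (hH.growth_lower x p)
  sqc x _ _ _ hpq hqr := hH.lt_max x hpq hqr

end CoercivityBound

section TestSlopes

/-- The family `G`, with derivatives `G'`, consists of `C¹` functions and is dense in `C¹([c, d])`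
for every interval `[c, d]`. -/
structure IsDenseC1 {ι : Type*} (G G' : ι → ℝ → ℝ) : Prop where
  hasDerivAt : ∀ i y, HasDerivAt (G i) (G' i y) y
  continuous_deriv : ∀ i, Continuous (G' i)
  exists_approx : ∀ (c d : ℝ) (p p' : ℝ → ℝ),
    (∀ y ∈ Icc c d, HasDerivWithinAt p (p' y) (Icc c d) y) → ContinuousOn p' (Icc c d) →
      ∀ ε > 0, ∃ i, ∀ y ∈ Icc c d, |G i y - p y| < ε ∧ |G' i y - p' y| < ε

lemma IsDenseC1.continuous {ι : Type*} {G G' : ι → ℝ → ℝ} (hG : IsDenseC1 G G') (i : ι) :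
    Continuous (G i) :=
  continuous_iff_continuousAt.2 fun y => (hG.hasDerivAt i y).continuousAt

lemma exists_nat_approx_of_denseRange {g : ℕ → C(ℝ, ℝ)} (hg : DenseRange g) {f : ℝ → ℝ} {c d θ : ℝ}
    (hcd : c ≤ d) (hf : ContinuousOn f (Icc c d)) (hθ : 0 < θ) :
    ∃ n, ∀ y ∈ Icc c d, |g n y - f y| < θ := by
  let F : C(ℝ, ℝ) := ⟨IccExtend hcd ((Icc c d).domRestrict f), hf.domRestrict.Icc_extend'⟩
  have hunif := ContinuousMap.tendsto_iff_forall_isCompact_tendstoUniformlyOn.1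
    (tendsto_id (x := 𝓝 F)) (Icc c d) isCompact_Icc
  obtain ⟨n, hn⟩ := hg.mem_nhds (Metric.tendstoUniformlyOn_iff.1 hunif θ hθ)
  refine ⟨n, fun y hy => ?_⟩
  have hF : F y = f y := IccExtend_of_mem hcd ((Icc c d).domRestrict f) hy
  simpa only [id, hF, Real.dist_eq, abs_sub_comm] using hn y hy

lemma abs_sub_lt_of_abs_deriv_sub_le {f f' p p' : ℝ → ℝ} {c d ε : ℝ}
    (hf : ∀ y, HasDerivAt f (f' y) y)
    (hp : ∀ y ∈ Icc c d, HasDerivWithinAt p (p' y) (Icc c d) y)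
    (hc : |f c - p c| < ε / 2)
    (hderiv : ∀ y ∈ Icc c d, |f' y - p' y| ≤ ε / 2 / (d - c + 1)) {y : ℝ} (hy : y ∈ Icc c d) :
    |f y - p y| < ε := by
  have hlen : 0 < d - c + 1 := by linarith [hy.1, hy.2]
  have hε : 0 < ε / 2 := (abs_nonneg _).trans_lt hc
  have hmean : |f y - p y - (f c - p c)| ≤ ε / 2 / (d - c + 1) * (y - c) :=
    norm_image_sub_le_of_norm_deriv_le_segment'
      (fun z hz => (hf z).hasDerivWithinAt.sub (hp z hz))
      (fun z hz => hderiv z (Ico_subset_Icc_self hz)) y hy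
  have hprod : ε / 2 / (d - c + 1) * (y - c) ≤ ε / 2 := by
    rw [div_mul_eq_mul_div, div_le_iff₀ hlen]
    gcongr
    linarith [hy.2]
  linarith [abs_sub_abs_le_abs_sub (f y - p y) (f c - p c)]

lemma exists_isDenseC1 : ∃ G G' : ℕ × ℚ → ℝ → ℝ, IsDenseC1 G G' := by
  let g : ℕ → C(ℝ, ℝ) := TopologicalSpace.denseSeq C(ℝ, ℝ)
  have hderiv (i : ℕ × ℚ) (y : ℝ) :
      HasDerivAt (fun y => (i.2 : ℝ) + ∫ t in (0 : ℝ)..y, g i.1 t) (g i.1 y) y :=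
    ((g i.1).continuous.integral_hasStrictDerivAt 0 y).hasDerivAt.const_add _
  refine ⟨fun i y => i.2 + ∫ t in (0 : ℝ)..y, g i.1 t, fun i => g i.1, hderiv,
    fun i => (g i.1).continuous, fun c d p p' hp hp' ε hε => ?_⟩
  rcases lt_or_ge d c with hdc | hcd
  · exact ⟨(0, 0), fun y hy => absurd hdc (hy.1.trans hy.2).not_gt⟩
  have hlen : 1 ≤ d - c + 1 := by linarith
  obtain ⟨n, hn⟩ := exists_nat_approx_of_denseRange
    (TopologicalSpace.denseRange_denseSeq C(ℝ, ℝ)) hcd hp' (show 0 < ε / 2 / (d - c + 1) by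
      positivity)
  obtain ⟨s, hs_gt, hs_lt⟩ := exists_rat_btwn (show
    p c - (∫ t in (0 : ℝ)..c, g n t) - ε / 2 < p c - ∫ t in (0 : ℝ)..c, g n t by linarith)
  have hstart : |s + (∫ t in (0 : ℝ)..c, g n t) - p c| < ε / 2 := by
    rw [abs_lt]
    constructor <;> linarith
  refine ⟨(n, s), fun y hy => ⟨abs_sub_lt_of_abs_deriv_sub_le (hderiv (n, s)) hp hstart
    (fun z hz => (hn z hz).le) hy, (hn y hy).trans_le ?_⟩⟩
  exact (div_le_self (by linarith) hlen).trans (by linarith)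

variable {M : ℝ → ℝ} {a : ℝ → ℝ} {H : ℝ → ℝ → ℝ} {nu c d R ε : ℝ} {p : ℝ → ℝ}

lemma SolvesOn.continuousOn_deriv (h : Admissible M a H) (hp : SolvesOn a H nu c d p)
    (ha : ∀ y ∈ Icc c d, 0 < a y) : ContinuousOn (fun y => (nu - H y (p y)) / a y) (Icc c d) :=
  (continuousOn_const.sub (h.continuous_H.comp_continuousOn (f := fun y => (y, p y))
    (continuousOn_id.prodMk hp.continuousOn))).div h.continuous_a.continuousOn
    fun y hy => (ha y hy).ne'

lemma Admissible.exists_residual_lt (h : Admissible M a H) (R : ℝ) (hε : 0 < ε) :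
    ∃ θ ∈ Ioc 0 ε, ∀ (y s v k : ℝ), 0 < a y → |s| ≤ R → |v - s| < θ →
      |k - (nu - H y s) / a y| < θ → |a y * k + H y v - nu| < ε := by
  obtain ⟨L, hL, hHL⟩ := h.H_lip (R + 1)
  refine ⟨min (min ε 1) (ε / (1 + L)), ⟨by positivity, (min_le_left _ _).trans (min_le_left _ _)⟩,
    fun y s v k hay hs hv hk => ?_⟩
  have hv_one : |v - s| < 1 := hv.trans_le ((min_le_left _ _).trans (min_le_right _ _))
  have hvR : |v| ≤ R + 1 := by linarith [abs_sub_abs_le_abs_sub v s]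
  have hdiffusion : a y * |k - (nu - H y s) / a y| < ε / (1 + L) :=
    (mul_le_of_le_one_left (abs_nonneg _) (h.a_le_one y)).trans_lt (hk.trans_le (min_le_right _ _))
  have hHdiff : |H y v - H y s| ≤ L * (ε / (1 + L)) := by
    refine (hHL y y v s hvR (by linarith)).trans ?_
    rw [sub_self, abs_zero, zero_add]
    gcongr
    exact hv.le.trans (min_le_right _ _)
  calc |a y * k + H y v - nu|
      = |a y * (k - (nu - H y s) / a y) + (H y v - H y s)| := by
        congr 1
        field_simp
        ring
    _ ≤ a y * |k - (nu - H y s) / a y| + |H y v - H y s| := by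
        rw [← abs_of_pos hay, ← abs_mul, abs_of_pos hay]
        exact abs_add_le _ _
    _ < ε / (1 + L) + L * (ε / (1 + L)) := add_lt_add_of_lt_of_le hdiffusion hHdiff
    _ = ε := by field_simp

lemma SolvesOn.exists_test_slope (h : Admissible M a H) (hp : SolvesOn a H nu c d p)
    (ha : ∀ y ∈ Icc c d, 0 < a y) (hR : ∀ y ∈ Icc c d, |p y| ≤ R) {ι : Type*} {G G' : ι → ℝ → ℝ}
    (hG : IsDenseC1 G G') (hε : 0 < ε) :
    ∃ i, ∀ y ∈ Icc c d, |G i y - p y| < ε ∧ |a y * G' i y + H y (G i y) - nu| < ε := by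
  obtain ⟨θ, ⟨hθ, hθε⟩, hresidual⟩ := h.exists_residual_lt R hε
  obtain ⟨i, hi⟩ := hG.exists_approx c d p _ hp (hp.continuousOn_deriv h ha) θ hθ
  exact ⟨i, fun y hy => ⟨(hi y hy).1.trans_le hθε,
    hresidual y (p y) _ _ (ha y hy) (hR y hy) (hi y hy).1 (hi y hy).2⟩⟩

end TestSlopes

section MeasurableForall

variable {Ω X : Type*} [MeasurableSpace Ω] [TopologicalSpace X] [SecondCountableTopology X]
  {K : Set X} {f g : X → Ω → ℝ}

lemma measurable_forall_mem_le (K : Set X) (hf : ∀ ω, Continuous fun y => f y ω)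
    (hg : ∀ ω, Continuous fun y => g y ω) (hf_meas : ∀ y, Measurable (f y))
    (hg_meas : ∀ y, Measurable (g y)) : Measurable fun ω => ∀ y ∈ K, f y ω ≤ g y ω := by
  obtain ⟨s, hs, hsd⟩ := TopologicalSpace.exists_countable_dense K
  have := hs.to_subtype
  have hdense : (fun ω => ∀ y ∈ K, f y ω ≤ g y ω) = fun ω => ∀ y : s, f y ω ≤ g y ω := by
    ext ω
    refine ⟨fun h y => h _ y.1.2, fun h y hy => ?_⟩
    have hclosed : IsClosed {y : K | f y ω ≤ g y ω} :=
      isClosed_le ((hf ω).comp continuous_subtype_val) ((hg ω).comp continuous_subtype_val)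
    exact hclosed.closure_subset_iff.2 (fun y hy => h ⟨y, hy⟩) (hsd ⟨y, hy⟩)
  rw [hdense]
  exact .forall fun y => .le' (hf_meas y) (hg_meas y)

lemma measurable_forall_mem_lt (hK : IsCompact K) (hf : ∀ ω, Continuous fun y => f y ω)
    (hg : ∀ ω, Continuous fun y => g y ω) (hf_meas : ∀ y, Measurable (f y))
    (hg_meas : ∀ y, Measurable (g y)) : Measurable fun ω => ∀ y ∈ K, f y ω < g y ω := by
  have hgap : (fun ω => ∀ y ∈ K, f y ω < g y ω) =
      fun ω => ∃ k : ℕ, ∀ y ∈ K, f y ω + 1 / ((k : ℝ) + 1) ≤ g y ω := by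
    ext ω
    constructor
    · intro h
      obtain ⟨δ, hδ, hle⟩ := hK.exists_forall_le' (f := fun y => g y ω - f y ω)
        ((hg ω).sub (hf ω)).continuousOn fun y hy => sub_pos.2 (h y hy)
      obtain ⟨k, hk⟩ := exists_nat_one_div_lt hδ
      exact ⟨k, fun y hy => by linarith [hle y hy]⟩
    · rintro ⟨k, hk⟩ y hy
      linarith [hk y hy, Nat.one_div_pos_of_nat (α := ℝ) (n := k)]
  rw [hgap]
  exact .exists fun k => measurable_forall_mem_le K (fun ω => (hf ω).add_const _) hg
    (fun y => (hf_meas y).add_const _) hg_meas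

lemma measurable_exists_mem_eq_zero (hK : IsCompact K) (hf : ∀ ω, Continuous fun y => f y ω)
    (hf_meas : ∀ y, Measurable (f y)) (hf_nonneg : ∀ y ω, 0 ≤ f y ω) :
    Measurable fun ω => ∃ y ∈ K, f y ω = 0 := by
  have hnot : (fun ω => ∃ y ∈ K, f y ω = 0) = fun ω => ¬∀ y ∈ K, 0 < f y ω := by
    ext ω
    push Not
    simp only [(hf_nonneg _ ω).ge_iff_eq']
  rw [hnot]
  exact (measurable_forall_mem_lt hK (fun _ => continuous_const) hf (fun _ => measurable_const)
    hf_meas).not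

end MeasurableForall

section LowNearZeros

variable {M : ℝ → ℝ} {a : ℝ → ℝ} {H : ℝ → ℝ → ℝ} {mu nu z : ℝ}

/-- Near the zeros of the diffusion the Hamiltonian takes values below `mu`, locally uniformly. All
quantifiers are countable, so that this is a measurable condition on random data. -/
def LowNearZeros (a : ℝ → ℝ) (H : ℝ → ℝ → ℝ) (mu : ℝ) : Prop :=
  ∀ N : ℕ, ∃ k : ℕ, ∀ x : ℚ, |(x : ℝ)| ≤ N → a x < 1 / ((k : ℝ) + 1) → ∃ q : ℚ, H x q < mu

lemma measurable_lowNearZeros {Ω : Type*} [MeasurableSpace Ω] {a : ℝ → Ω → ℝ} {H : ℝ → ℝ → Ω → ℝ}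
    (ha_meas : ∀ x, Measurable (a x)) (hH_meas : ∀ x p, Measurable (H x p)) (mu : ℝ) :
    Measurable fun ω => LowNearZeros (fun x => a x ω) (fun x p => H x p ω) mu :=
  .forall fun _ => .exists fun _ => .forall fun x => measurable_const.imp <|
    (Measurable.lt (ha_meas x) measurable_const).imp <|
      .exists fun q => .lt (hH_meas x q) measurable_const

lemma LowNearZeros.exists_lt (hlow : LowNearZeros a H mu) (h : Admissible M a H) (hmu : mu < nu)
    (hz : a z = 0) : ∃ q, H z q < nu := by
  obtain ⟨N, hN⟩ := exists_nat_gt |z|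
  obtain ⟨k, hk⟩ := hlow N
  obtain ⟨L, -, hL⟩ := h.H_lip (M mu)
  have hdist : Continuous fun x => L * |z - x| := by fun_prop
  have hnear : ∀ᶠ x : ℝ in 𝓝 z, |x| < N ∧ a x < 1 / ((k : ℝ) + 1) ∧ L * |z - x| < nu - mu :=
    ((continuous_abs.tendsto z).eventually_lt_const hN).and <|
      ((h.continuous_a.tendsto' z 0 hz).eventually_lt_const Nat.one_div_pos_of_nat).and <|
        (hdist.tendsto' z 0 (by simp)).eventually_lt_const (sub_pos.2 hmu)
  obtain ⟨x, hxN, hxa, hxz⟩ := Rat.denseRange_cast.mem_nhds hnear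
  obtain ⟨q, hq⟩ := hk x hxN.le hxa
  have hqM := (h.abs_lt_of_H_le hq.le).le
  have hlip := (abs_le.1 (hL z x q q hqM hqM)).2
  rw [sub_self, abs_zero, add_zero] at hlip
  exact ⟨q, by linarith⟩

lemma Admissible.lowNearZeros (h : Admissible M a H) (hlow : ∀ z, a z = 0 → ∃ q, H z q < mu) :
    LowNearZeros a H mu := by
  intro N
  let S : Set ℝ := Icc (-N : ℝ) N ∩ ⋂ q : ℚ, {x | mu ≤ H x q}
  have hS : IsCompact S := isCompact_Icc.inter_right <| isClosed_iInter fun q =>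
    isClosed_le continuous_const (h.continuous_H_comp continuous_id continuous_const)
  have hpos (x) (hx : x ∈ S) : 0 < a x := h.a_pos fun hx0 => by
    obtain ⟨p, hp⟩ := hlow x hx0
    have hnear : ∀ᶠ q in 𝓝 p, H x q < mu :=
      ((h.continuous_H_comp continuous_const continuous_id).tendsto p).eventually_lt_const hp
    obtain ⟨q, hq⟩ := Rat.denseRange_cast.mem_nhds hnear
    have hle : mu ≤ H x q := mem_iInter.1 hx.2 q
    exact hle.not_gt hq
  obtain ⟨δ, hδ, hle⟩ := hS.exists_forall_le' h.continuous_a.continuousOn hpos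
  obtain ⟨k, hk⟩ := exists_nat_one_div_lt hδ
  refine ⟨k, fun x hx hxa => ?_⟩
  by_contra! hHx
  linarith [hle x ⟨abs_le.1 hx, mem_iInter.2 hHx⟩]

end LowNearZeros

section CriticalValue

variable {M : ℝ → ℝ} {ι : Type*} {G G' : ι → ℝ → ℝ} {a : ℝ → ℝ} {H : ℝ → ℝ → ℝ} {mu nu lam R : ℝ}

/-- A countable version of `HasBarriers`, with barriers taken from the family `G` on intervals with
rational endpoints. -/
def HasTestBarriers (G G' : ι → ℝ → ℝ) (a : ℝ → ℝ) (H : ℝ → ℝ → ℝ) (mu R : ℝ) : Prop :=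
  LowNearZeros a H mu ∧ ∀ c d : ℚ, (∀ y ∈ Icc (c : ℝ) d, 0 < a y) →
    ∃ i, (∀ y ∈ Icc (c : ℝ) d, |G i y| ≤ R) ∧ ∀ y ∈ Icc (c : ℝ) d, a y * G' i y + H y (G i y) ≤ mu

lemma continuous_residual (h : Admissible M a H) (hG : IsDenseC1 G G') (i : ι) :
    Continuous fun y => a y * G' i y + H y (G i y) :=
  (h.continuous_a.mul (hG.continuous_deriv i)).add
    (h.continuous_H_comp continuous_id (hG.continuous i))

lemma exists_rat_Icc_superset {c d : ℝ} (hcd : c ≤ d) {U : Set ℝ} (hU : IsOpen U)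
    (hsub : Icc c d ⊆ U) : ∃ c' d' : ℚ, Icc c d ⊆ Icc (c' : ℝ) d' ∧ Icc (c' : ℝ) d' ⊆ U := by
  have hc : U ∈ 𝓝 c := hU.mem_nhds (hsub ⟨le_rfl, hcd⟩)
  have hd : U ∈ 𝓝 d := hU.mem_nhds (hsub ⟨hcd, le_rfl⟩)
  obtain ⟨l, hlc, hl⟩ := exists_Ioc_subset_of_mem_nhds hc (exists_lt c)
  obtain ⟨r, hdr, hr⟩ := exists_Ico_subset_of_mem_nhds hd (exists_gt d)
  obtain ⟨c', hlc', hc'⟩ := exists_rat_btwn hlc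
  obtain ⟨d', hd', hdr'⟩ := exists_rat_btwn hdr
  refine ⟨c', d', Icc_subset_Icc hc'.le hd'.le, fun y hy => ?_⟩
  rcases le_total y c with hyc | hcy
  · exact hl ⟨hlc'.trans_le hy.1, hyc⟩
  rcases le_total y d with hyd | hdy
  · exact hsub ⟨hcy, hyd⟩
  · exact hr ⟨hdy, hy.2.trans_lt hdr'⟩

lemma HasTestBarriers.hasBarriers (hbar : HasTestBarriers G G' a H mu R) (h : Admissible M a H)
    (hG : IsDenseC1 G G') (hmu : mu < nu) : HasBarriers a H nu R where
  zero z hz := (hbar.1.exists_lt h hmu hz).imp fun _ hq => hq.le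
  barrier c d hcd ha := by
    obtain ⟨c', d', hsub, hpos⟩ :=
      exists_rat_Icc_superset hcd (isOpen_lt continuous_const h.continuous_a) ha
    obtain ⟨i, hiR, hi⟩ := hbar.2 c' d' hpos
    exact ⟨G i, G' i, fun y _ => (hG.hasDerivAt i y).hasDerivWithinAt,
      fun y hy => hiR y (hsub hy), fun y hy => (hi y (hsub hy)).trans hmu.le⟩

lemma IsViscositySupersolution.hasTestBarriers (h : Admissible M a H) (hG : IsDenseC1 G G')
    {w : ℝ → ℝ} (hw : IsViscositySupersolution a H mu w) (hmu : mu < nu) (hR : M nu + 2 ≤ R) :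
    HasTestBarriers G G' a H nu R := by
  obtain ⟨mu', hmu', hmunu⟩ := exists_between hmu
  refine ⟨h.lowNearZeros fun z hz => hw.exists_H_lt_of_a_eq_zero h hz hmu, fun c d hpos => ?_⟩
  rcases le_or_gt (c : ℝ) d with hcd | hdc
  · obtain ⟨p, hp, hpR⟩ := hw.exists_solvesOn h hmu'
      ((h.mono_M hmunu.le).trans_lt (lt_add_one _)) hcd hpos
    obtain ⟨i, hi⟩ := hp.exists_test_slope h hpos hpR hG
      (lt_min one_pos (sub_pos.2 hmunu))
    refine ⟨i, fun y hy => ?_, fun y hy => ?_⟩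
    · have hclose := (hi y hy).1.trans_le (min_le_left _ _)
      linarith [abs_sub_abs_le_abs_sub (G i y) (p y), hpR y hy]
    · linarith [(abs_lt.1 ((hi y hy).2.trans_le (min_le_right _ _))).2]
  · obtain ⟨i, -⟩ := hG.exists_approx d c (fun _ => 0) (fun _ => 0)
      (fun y _ => hasDerivWithinAt_const y _ 0) continuousOn_const 1 one_pos
    simp only [Icc_eq_empty_of_lt hdc, mem_empty_iff_false, false_imp_iff, implies_true, and_self]
    exact ⟨i, trivial⟩

lemma Admissible.criticalValue_lt_iff (h : Admissible M a H) (hbc : HasBoundedComponents a)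
    (hG : IsDenseC1 G G') : criticalValue a H < lam ↔
      ∃ mu : ℚ, (mu : ℝ) < lam ∧ HasTestBarriers G G' a H mu (M lam + 2) := by
  obtain ⟨⟨x, hx⟩, hz⟩ := (hasBoundedComponents_iff h.a_nonneg).1 hbc
  constructor
  · intro hlt
    obtain ⟨mu₀, hmu₀, w, hw⟩ := h.exists_supersolution_of_criticalValue_lt hlt
    obtain ⟨mu, hmu, hmulam⟩ := exists_rat_btwn hmu₀
    exact ⟨mu, hmulam, hw.hasTestBarriers h hG hmu (by gcongr; exact h.mono_M hmulam.le)⟩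
  · rintro ⟨mu, hmu, hbar⟩
    obtain ⟨nu, hmunu, hnulam⟩ := exists_between hmu
    obtain ⟨nu', hnunu', hnu'lam⟩ := exists_between hnulam
    obtain ⟨p, hp, hpR⟩ := h.exists_isUpperProfile hz hnunu'
      (by linarith [h.mono_M hnu'lam.le] : M nu' ≤ M lam + 2) (hbar.hasBarriers h hG hmunu)
    obtain ⟨u, -, hu, -, -⟩ := hp.exists_solution h hpR
    obtain ⟨⟨z, -, hz0⟩, -⟩ := hz x (h.a_pos hx)
    exact (csInf_le (h.bddBelow_supersolution hz0) ⟨u, hu.2⟩).trans_lt hnu'lam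

/-- The set `{criticalValue < lam}` is only described up to the exceptional `ω` at which the
components are unbounded; there the critical value may be a junk infimum. -/
theorem exists_measurable_criticalValue_lt {Ω : Type*} [MeasurableSpace Ω] {a : ℝ → Ω → ℝ}
    {H : ℝ → ℝ → Ω → ℝ} (hadm : ∀ ω, Admissible M (fun x => a x ω) (fun x p => H x p ω))
    (ha_meas : ∀ x, Measurable (a x)) (hH_meas : ∀ x p, Measurable (H x p)) (lam : ℝ) :
    ∃ E : Ω → Prop, Measurable E ∧ ∀ ω, HasBoundedComponents (fun x => a x ω) →
      (criticalValue (fun x => a x ω) (fun x p => H x p ω) < lam ↔ E ω) := by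
  obtain ⟨G, G', hG⟩ := exists_isDenseC1
  have hac (ω) := (hadm ω).continuous_a
  refine ⟨fun ω => ∃ mu : ℚ, (mu : ℝ) < lam ∧
    HasTestBarriers G G' (fun x => a x ω) (fun x p => H x p ω) mu (M lam + 2),
    .exists fun mu => measurable_const.and <| (measurable_lowNearZeros ha_meas hH_meas mu).and <|
      .forall fun c => .forall fun d => .imp ?_ <| .exists fun i => measurable_const.and ?_,
    fun ω hω => (hadm ω).criticalValue_lt_iff hω hG⟩
  · exact measurable_forall_mem_lt isCompact_Icc (fun _ => continuous_const) hac
      (fun _ => measurable_const) ha_meas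
  · exact measurable_forall_mem_le _ (fun ω => continuous_residual (hadm ω) hG i)
      (fun _ => continuous_const) (fun y => ((ha_meas y).mul_const _).add (hH_meas y _))
      fun _ => measurable_const

end CriticalValue

section UpperProfile

variable {M : ℝ → ℝ} {ι : Type*} {G G' : ι → ℝ → ℝ} {a : ℝ → ℝ} {H : ℝ → ℝ → ℝ}
  {lam nu R l r c d x t : ℝ} {p : ℝ → ℝ}

/-- A slope of the family `G`, starting above `R` at a rational point to the left of `x`, ends below
`t` at `x` although it exceeds the level `lam` in between. -/
def HasTestAbove (G G' : ι → ℝ → ℝ) (a : ℝ → ℝ) (H : ℝ → ℝ → ℝ) (lam R x t : ℝ) : Prop :=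
  ∃ c : ℚ, (c : ℝ) ≤ x ∧ (∀ y ∈ Icc (c : ℝ) x, 0 < a y) ∧ ∃ i, R ≤ G i c ∧
    (∀ y ∈ Icc (c : ℝ) x, lam < a y * G' i y + H y (G i y)) ∧ G i x < t

lemma measurable_hasTestAbove {Ω : Type*} [MeasurableSpace Ω] [Countable ι] {a : ℝ → Ω → ℝ}
    {H : ℝ → ℝ → Ω → ℝ} (hadm : ∀ ω, Admissible M (fun x => a x ω) (fun x p => H x p ω))
    (ha_meas : ∀ x, Measurable (a x)) (hH_meas : ∀ x p, Measurable (H x p))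
    (hG : IsDenseC1 G G') (lam R x t : ℝ) :
    Measurable fun ω => HasTestAbove G G' (fun x => a x ω) (fun x p => H x p ω) lam R x t := by
  refine .exists fun c => measurable_const.and <| .and ?_ <| .exists fun i =>
    measurable_const.and <| .and ?_ measurable_const
  · exact measurable_forall_mem_lt isCompact_Icc (fun _ => continuous_const)
      (fun ω => (hadm ω).continuous_a) (fun _ => measurable_const) ha_meas
  · exact measurable_forall_mem_lt isCompact_Icc (fun _ => continuous_const)
      (fun ω => continuous_residual (hadm ω) hG i) (fun _ => measurable_const)
      fun y => ((ha_meas y).mul_const _).add (hH_meas y _)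

lemma IsUpperProfile.exists_solvesOn_above (hp : IsUpperProfile a H lam p) (h : Admissible M a H)
    (hI : IsComponent a l r) (hc : l < c) (hcd : c ≤ d) (hd : d < r) (hnu : lam < nu)
    (hR : M nu ≤ R) (hpR : ∀ x, |p x| ≤ R) :
    ∃ q, q c = R ∧ SolvesOn a H nu c d q ∧ ∀ y ∈ Icc c d, |q y| ≤ R ∧ p y ≤ q y := by
  have hpos (y) (hy : y ∈ Icc c d) : 0 < a y := hI.pos y ⟨hc.trans_le hy.1, hy.2.trans_lt hd⟩
  refine h.exists_solvesOn_of_barrier hcd hpos hR hnu ((hp.solvesOnIoo hI).solvesOn hc hd)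
    (fun y _ => hpR y) fun y hy => ?_
  rw [mul_div_cancel₀ _ (hpos y hy).ne']
  linarith

lemma IsUpperProfile.eq_of_le (hp : IsUpperProfile a H lam p) (h : Admissible M a H)
    (hI : IsComponent a l r) {q : ℝ → ℝ} (hq : SolvesOnIoo a H lam l r q)
    (hpR : ∀ y ∈ Ioo l r, |p y| ≤ R) (hqR : ∀ y ∈ Ioo l r, |q y| ≤ R)
    (hpq : ∀ y ∈ Ioo l r, p y ≤ q y) : ∀ y ∈ Ioo l r, p y = q y := by
  obtain ⟨Q, hQ, hqQ⟩ := h.exists_tendsto_left hI.lt hI.left hI.pos hq hqR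
  have hroot := hp.root l hI.left
  have hpl := hp.tendsto_nhdsGT l
  have hQp : Q = p l := le_antisymm (hroot.le_of_H_le h hQ.le) <|
    le_of_tendsto_of_tendsto hpl hqQ (by filter_upwards [Ioo_mem_nhdsGT hI.lt] using hpq)
  exact (hp.solvesOnIoo hI).eq_of_tendsto h hI.lt hI.pos hroot hq hpl (hQp ▸ hqQ) hpR hqR

/-- Otherwise a limit of solutions at levels decreasing to `lam` would be a solution at level `lam`
above the profile and different from it. -/
lemma IsUpperProfile.exists_solvesOn_lt (hp : IsUpperProfile a H lam p) (h : Admissible M a H)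
    (hI : IsComponent a l r) (hx : x ∈ Ioo l r) (hR : M (lam + 1) ≤ R) (hpR : ∀ x, |p x| ≤ R)
    (hpt : p x < t) :
    ∃ c : ℚ, l < c ∧ (c : ℝ) < x ∧ ∃ nu > lam, ∃ q, q c = R ∧ SolvesOn a H nu c x q ∧
      (∀ y ∈ Icc (c : ℝ) x, |q y| ≤ R) ∧ q x < t := by
  by_contra! hcon
  obtain ⟨c, -, hc, hc_lim⟩ :=
    Rat.denseRange_cast.exists_seq_strictAnti_tendsto_of_lt (Rat.cast_mono (K := ℝ)) hx.1
  obtain ⟨d, -, hd, hd_lim⟩ := exists_seq_strictMono_tendsto' hx.2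
  have hlevel (n : ℕ) : 0 < 1 / ((n : ℝ) + 1) ∧ 1 / ((n : ℝ) + 1) ≤ 1 :=
    ⟨Nat.one_div_pos_of_nat, by
      simpa using Nat.one_div_le_one_div (α := ℝ) (Nat.zero_le n)⟩
  have hlevel_lim : Tendsto (fun n : ℕ => lam + 1 / ((n : ℝ) + 1)) atTop (𝓝 lam) := by
    simpa using tendsto_one_div_add_atTop_nhds_zero_nat.const_add lam
  have hq_exists (n : ℕ) := hp.exists_solvesOn_above h hI (hc n).1 ((hc n).2.trans (hd n).1).le
    (hd n).2 (lt_add_of_pos_right lam (hlevel n).1)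
    ((h.mono_M (by gcongr; exact (hlevel n).2)).trans hR) hpR
  choose q hqc hq hqR using hq_exists
  have htq (n : ℕ) : t ≤ q n x := hcon (c n) (hc n).1 (hc n).2 _
    (lt_add_of_pos_right lam (hlevel n).1) (q n) (hqc n) ((hq n).mono le_rfl (hd n).1.le)
    fun y hy => (hqR n y ⟨hy.1, hy.2.trans (hd n).1.le⟩).1
  obtain ⟨Q, hQ, hle_Q⟩ := h.exists_limit_solution hI.pos hc_lim hd_lim hlevel_lim hq
    fun n y hy => (hqR n y hy).1
  have hpQ (y) (hy : y ∈ Ioo l r) : p y ≤ Q y := hle_Q y hy _ <| by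
    filter_upwards [hc_lim.eventually (Iic_mem_nhds hy.1), hd_lim.eventually (Ici_mem_nhds hy.2)]
      with n hcy hyd using (hqR n y ⟨hcy, hyd⟩).2
  have heq := hp.eq_of_le h hI (fun y hy => (hQ y hy).1) (fun y _ => hpR y)
    (fun y hy => (hQ y hy).2) hpQ x hx
  exact hpt.not_ge (heq ▸ hle_Q x hx t (.of_forall htq))

lemma IsUpperProfile.lt_iff_hasTestAbove (hp : IsUpperProfile a H lam p) (h : Admissible M a H)
    (hz : HasZerosOnBothSides a) (hG : IsDenseC1 G G') (hR : M (lam + 1) ≤ R)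
    (hpR : ∀ x, |p x| ≤ R) (hx : 0 < a x) :
    p x < t ↔ HasTestAbove G G' a H lam R x t := by
  constructor
  · intro hpt
    obtain ⟨l, r, hI, hxI⟩ := hz.exists_isComponent h hx
    obtain ⟨c, hlc, hcx, nu, hnu, q, hqc, hq, hqR, hqt⟩ := hp.exists_solvesOn_lt h hI hxI
      (R := R + 1) (by linarith) (fun y => (hpR y).trans (by linarith)) hpt
    have hpos (y) (hy : y ∈ Icc (c : ℝ) x) : 0 < a y :=
      hI.pos y ⟨hlc.trans_le hy.1, hy.2.trans_lt hxI.2⟩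
    obtain ⟨i, hi⟩ := hq.exists_test_slope h hpos hqR hG
      (lt_min (lt_min one_pos (sub_pos.2 hqt)) (sub_pos.2 hnu))
    refine ⟨c, hcx.le, hpos, i, ?_, fun y hy => ?_, ?_⟩
    · have hstart := (hi c (left_mem_Icc.2 hcx.le)).1.trans_le
        ((min_le_left _ _).trans (min_le_left _ _))
      linarith [(abs_lt.1 hstart).1]
    · linarith [(abs_lt.1 ((hi y hy).2.trans_le (min_le_right _ _))).1]
    · have hend := (hi x (right_mem_Icc.2 hcx.le)).1.trans_le
        ((min_le_left _ _).trans (min_le_right _ _))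
      linarith [(abs_lt.1 hend).2]
  · rintro ⟨c, hcx, hpos, i, hstart, hlevel, hend⟩
    refine lt_of_le_of_lt ?_ hend
    refine le_of_deriv_lt_of_eq (fun y hy => (hp.ode y (hpos y hy)).hasDerivWithinAt)
      (fun y _ => (hG.hasDerivAt i y).hasDerivWithinAt) ((le_of_abs_le (hpR c)).trans hstart)
      (fun y hy heq => ?_) x ⟨hcx, le_rfl⟩
    rw [div_lt_iff₀ (hpos y hy), heq]
    linarith [hlevel y hy]

lemma IsUpperRoot.lt_iff {P : ℝ} (hP : IsUpperRoot H lam x P) (h : Admissible M a H) :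
    P < t ↔ lam < H x t ∧ ∃ q : ℚ, (q : ℝ) < t ∧ H x q < lam := by
  constructor
  · intro hlt
    obtain ⟨q₀, hq₀, hlow⟩ := hP.H_lt h
    obtain ⟨q, hq₀q, hqP⟩ := exists_rat_btwn hq₀
    exact ⟨hP.lt_H h hlt, q, hqP.trans hlt, hlow q hq₀q.le hqP⟩
  · rintro ⟨ht, q, hqt, hq⟩
    exact hP.lt_of_lt_H h hqt hq ht

theorem exists_measurable_profile_lt {Ω : Type*} [MeasurableSpace Ω] {a : ℝ → Ω → ℝ}
    {H : ℝ → ℝ → Ω → ℝ} (hadm : ∀ ω, Admissible M (fun x => a x ω) (fun x p => H x p ω))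
    (ha_meas : ∀ x, Measurable (a x)) (hH_meas : ∀ x p, Measurable (H x p))
    (hR : M (lam + 1) ≤ R) (x t : ℝ) :
    ∃ E : Ω → Prop, Measurable E ∧ ∀ ω p, HasZerosOnBothSides (fun x => a x ω) →
      IsUpperProfile (fun x => a x ω) (fun x p => H x p ω) lam p →
        (∀ x, |p x| ≤ R) → (p x < t ↔ E ω) := by
  obtain ⟨G, G', hG⟩ := exists_isDenseC1
  refine ⟨fun ω => (a x ω = 0 ∧ lam < H x t ω ∧ ∃ q : ℚ, (q : ℝ) < t ∧ H x q ω < lam) ∨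
    0 < a x ω ∧ HasTestAbove G G' (fun x => a x ω) (fun x p => H x p ω) lam R x t,
    ?_, fun ω p hz hp hpR => ?_⟩
  · exact ((Measurable.eq (ha_meas x) measurable_const).and <|
      (Measurable.lt measurable_const (hH_meas x t)).and <| .exists fun q : ℚ =>
        measurable_const.and (.lt (hH_meas x q) measurable_const)).or <|
      (Measurable.lt measurable_const (ha_meas x)).and
        (measurable_hasTestAbove hadm ha_meas hH_meas hG _ _ _ _)
  · rcases ((hadm ω).a_nonneg x).eq_or_lt' with hx | hx
    · simp only [hx, lt_irrefl, true_and, false_and, or_false, (hp.root x hx).lt_iff (hadm ω)]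
    · simp only [hx, hx.ne', true_and, false_and, false_or,
        hp.lt_iff_hasTestAbove (hadm ω) hz hG hR hpR hx]

end UpperProfile

section Symmetries

variable {a : ℝ → ℝ} {H : ℝ → ℝ → ℝ} {lam : ℝ}

lemma criticalValue_translate (z : ℝ) :
    criticalValue (fun x => a (x + z)) (fun x p => H (x + z) p) = criticalValue a H := by
  unfold criticalValue
  congr 1
  ext lam
  refine ⟨fun ⟨u, hu⟩ => ⟨fun x => u (x + -z), ?_⟩, fun ⟨u, hu⟩ => ⟨_, hu.translate z⟩⟩
  simpa using hu.translate (-z)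

lemma criticalValue_reflect :
    criticalValue (fun x => a (-x)) (fun x p => H (-x) (-p)) = criticalValue a H := by
  unfold criticalValue
  congr 1
  ext lam
  refine ⟨fun ⟨u, hu⟩ => ⟨fun x => u (-x), ?_⟩, fun ⟨u, hu⟩ => ⟨_, hu.reflect⟩⟩
  simpa using hu.reflect

lemma HasZerosOnBothSides.translate (hz : HasZerosOnBothSides a) (z : ℝ) :
    HasZerosOnBothSides fun x => a (x + z) := by
  intro x hx
  obtain ⟨⟨l, hl, hl0⟩, r, hr, hr0⟩ := hz _ hx
  exact ⟨⟨l - z, by linarith, by simpa using hl0⟩, r - z, by linarith, by simpa using hr0⟩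

lemma HasZerosOnBothSides.reflect (hz : HasZerosOnBothSides a) :
    HasZerosOnBothSides fun x => a (-x) := by
  intro x hx
  obtain ⟨⟨l, hl, hl0⟩, r, hr, hr0⟩ := hz _ hx
  exact ⟨⟨-r, by linarith, by simpa using hr0⟩, -l, by linarith, by simpa using hl0⟩

lemma HasBoundedComponents.translate (ha : ∀ x, 0 ≤ a x) (h : HasBoundedComponents a) (z : ℝ) :
    HasBoundedComponents fun x => a (x + z) := by
  obtain ⟨⟨x, hx⟩, hz⟩ := (hasBoundedComponents_iff ha).1 h
  exact (hasBoundedComponents_iff fun x => ha _).2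
    ⟨⟨x - z, by simpa using hx⟩, hz.translate z⟩

lemma HasBoundedComponents.reflect (ha : ∀ x, 0 ≤ a x) (h : HasBoundedComponents a) :
    HasBoundedComponents fun x => a (-x) := by
  obtain ⟨⟨x, hx⟩, hz⟩ := (hasBoundedComponents_iff ha).1 h
  exact (hasBoundedComponents_iff fun x => ha _).2 ⟨⟨-x, by simpa using hx⟩, hz.reflect⟩

lemma IsUpperProfile.translate {p : ℝ → ℝ} (hp : IsUpperProfile a H lam p) (z : ℝ) :
    IsUpperProfile (fun x => a (x + z)) (fun x p => H (x + z) p) lam (fun x => p (x + z)) where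
  cont := hp.cont.comp (continuous_add_const z)
  bdd := hp.bdd.imp fun _ h _ => h _
  ode x hx := (hp.ode (x + z) hx).comp_add_const x z
  root x hx := hp.root (x + z) hx

end Symmetries

section StationaryMedia

variable {Ω : Type*} [MeasurableSpace Ω] {P : Measure Ω} {τ : ℝ → Ω → Ω} {M : ℝ → ℝ}
  {a : ℝ → Ω → ℝ} {H : ℝ → ℝ → Ω → ℝ} {lam0 : ℝ}

/-- A random diffusion and Hamiltonian, stationary with respect to `τ`, with admissible
realizations. Joint measurability follows from that of the slices, the realizations being
continuous. -/
structure IsStationaryMedium (τ : ℝ → Ω → Ω) (M : ℝ → ℝ) (a : ℝ → Ω → ℝ) (H : ℝ → ℝ → Ω → ℝ) :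
    Prop where
  admissible : ∀ ω, Admissible M (fun x => a x ω) (fun x p => H x p ω)
  measurable_a : ∀ x, Measurable (a x)
  measurable_H : ∀ x p, Measurable (H x p)
  stationary_a : ∀ x y ω, a (x + y) ω = a x (τ y ω)
  stationary_H : ∀ x y p ω, H (x + y) p ω = H x p (τ y ω)

lemma isStationaryMedium_of_sqcHamiltonianClass {κ α₀ α₁ γ η : ℝ} (hκ : 0 < κ) (hα₀ : 0 < α₀)
    (hα₁ : 0 < α₁) (hγ : 2 < γ) (ha_meas : Measurable fun q : ℝ × Ω => a q.1 q.2)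
    (hH_meas : Measurable fun q : ℝ × ℝ × Ω => H q.1 q.2.1 q.2.2)
    (ha_range : ∀ x ω, 0 ≤ a x ω ∧ a x ω ≤ 1)
    (ha_stat : ∀ x y ω, a (x + y) ω = a x (τ y ω))
    (hH_stat : ∀ x y p ω, H (x + y) p ω = H x p (τ y ω))
    (ha_sqrt : ∀ ω x y, |√(a x ω) - √(a y ω)| ≤ κ * |x - y|)
    (hH : ∀ ω, SqcHamiltonianClass α₀ α₁ γ η fun x p => H x p ω) :
    IsStationaryMedium τ (coercivityBound α₀ γ) a H where
  admissible ω := (hH ω).admissible hκ hα₀ hα₁ hγ (fun x => ha_range x ω) (ha_sqrt ω)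
  measurable_a _ := ha_meas.comp measurable_prodMk_left
  measurable_H _ _ := hH_meas.comp
    (measurable_const.prodMk (measurable_const.prodMk measurable_id))
  stationary_a := ha_stat
  stationary_H := hH_stat

lemma IsStationaryMedium.reflect (hmed : IsStationaryMedium τ M a H) :
    IsStationaryMedium (fun x => τ (-x)) M (fun x => a (-x)) (fun x p => H (-x) (-p)) where
  admissible ω := (hmed.admissible ω).reflect
  measurable_a x := hmed.measurable_a _
  measurable_H x p := hmed.measurable_H _ _
  stationary_a x y ω := by rw [neg_add, hmed.stationary_a]
  stationary_H x y p ω := by rw [neg_add, hmed.stationary_H]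

lemma IsStationaryMedium.measurableSet_exists_ge_eq_zero (hmed : IsStationaryMedium τ M a H)
    (s : ℝ) : MeasurableSet {ω | ∃ y ≥ s, a y ω = 0} := by
  have hunion : {ω | ∃ y ≥ s, a y ω = 0} = {ω | ∃ k : ℕ, ∃ y ∈ Icc s (s + k), a y ω = 0} := by
    ext ω
    refine ⟨fun ⟨y, hy, hy0⟩ => ?_, fun ⟨k, y, hy, hy0⟩ => ⟨y, hy.1, hy0⟩⟩
    obtain ⟨k, hk⟩ := exists_nat_ge (y - s)
    exact ⟨k, y, ⟨hy, by linarith⟩, hy0⟩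
  rw [hunion]
  exact measurableSet_setOfPred.2 <| .exists fun k => measurable_exists_mem_eq_zero isCompact_Icc
    (fun ω => (hmed.admissible ω).continuous_a) hmed.measurable_a
    fun x ω => (hmed.admissible ω).a_nonneg x

lemma IsStationaryMedium.preimage_exists_ge_eq_zero (hmed : IsStationaryMedium τ M a H) (s : ℝ) :
    τ s ⁻¹' {ω | ∃ y ≥ 0, a y ω = 0} = {ω | ∃ y ≥ s, a y ω = 0} := by
  ext ω
  simp only [mem_preimage, mem_ofPred_eq, ← hmed.stationary_a]
  exact ⟨fun ⟨y, hy, hy0⟩ => ⟨y + s, by linarith, hy0⟩,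
    fun ⟨y, hy, hy0⟩ => ⟨y - s, by linarith, by simpa using hy0⟩⟩

/-- The decreasing events `{∃ y ≥ s, a y = 0}` all have the same probability, hence coincide up to
null sets. -/
lemma IsStationaryMedium.ae_exists_gt_eq_zero [IsFiniteMeasure P]
    (hmed : IsStationaryMedium τ M a H) (hτ : ∀ x, MeasurePreserving (τ x) P P)
    (hzero : ∀ᵐ ω ∂P, ∃ x, a x ω = 0) : ∀ᵐ ω ∂P, ∀ x, ∃ y > x, a y ω = 0 := by
  have hmeas (s : ℝ) : P {ω | ∃ y ≥ s, a y ω = 0} = P {ω | ∃ y ≥ 0, a y ω = 0} := by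
    rw [← hmed.preimage_exists_ge_eq_zero s, (hτ s).measure_preimage
      (hmed.measurableSet_exists_ge_eq_zero 0).nullMeasurableSet]
  have hshift (n : ℕ) : {ω | ∃ y ≥ (n : ℝ), a y ω = 0} =ᵐ[P] {ω | ∃ y ≥ -(n : ℝ), a y ω = 0} :=
    ae_eq_of_subset_of_measure_ge
      (fun ω ⟨y, hy, hy0⟩ => ⟨y, by linarith [n.cast_nonneg (α := ℝ)], hy0⟩)
      ((hmeas _).trans (hmeas _).symm).le
      (hmed.measurableSet_exists_ge_eq_zero _).nullMeasurableSet (measure_ne_top _ _)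
  filter_upwards [hzero, ae_all_iff.2 fun n => (hshift n).mem_iff] with ω ⟨z, hz⟩ hω x
  obtain ⟨n, hn⟩ := exists_nat_gt (max x (-z))
  obtain ⟨y, hy, hy0⟩ := (hω n).2 ⟨z, by linarith [le_max_right x (-z)], hz⟩
  exact ⟨y, by linarith [le_max_left x (-z)], hy0⟩

lemma IsStationaryMedium.ae_hasBoundedComponents [IsFiniteMeasure P]
    (hmed : IsStationaryMedium τ M a H) (hτ : ∀ x, MeasurePreserving (τ x) P P)
    (hne : ∀ᵐ ω ∂P, ∃ x, a x ω ≠ 0) (hzero : ∀ᵐ ω ∂P, ∃ x, a x ω = 0) :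
    ∀ᵐ ω ∂P, HasBoundedComponents fun x => a x ω := by
  filter_upwards [hne, hmed.ae_exists_gt_eq_zero hτ hzero,
    hmed.reflect.ae_exists_gt_eq_zero (fun x => hτ (-x))
      (hzero.mono fun ω ⟨x, hx⟩ => ⟨-x, by simpa using hx⟩)] with ω hneω hright hleft
  refine (hasBoundedComponents_iff (hmed.admissible ω).a_nonneg).2
    ⟨hneω, fun x _ => ⟨?_, hright x⟩⟩
  obtain ⟨y, hy, hy0⟩ := hleft (-x)
  exact ⟨-y, by linarith, hy0⟩

lemma IsStationaryMedium.criticalValue_flow (hmed : IsStationaryMedium τ M a H) (z : ℝ) (ω : Ω) :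
    criticalValue (fun x => a x (τ z ω)) (fun x p => H x p (τ z ω)) =
      criticalValue (fun x => a x ω) (fun x p => H x p ω) := by
  simp only [← hmed.stationary_a, ← hmed.stationary_H]
  exact criticalValue_translate (a := fun x => a x ω) (H := fun x p => H x p ω) z

lemma IsStationaryMedium.measurable_criticalValue [P.IsComplete]
    (hmed : IsStationaryMedium τ M a H) (hbc : ∀ᵐ ω ∂P, HasBoundedComponents fun x => a x ω) :
    Measurable fun ω => criticalValue (fun x => a x ω) (fun x p => H x p ω) := by
  refine measurable_of_Iio fun t => ?_
  obtain ⟨E, hE, hiff⟩ := exists_measurable_criticalValue_lt hmed.admissible hmed.measurable_a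
    hmed.measurable_H t
  refine NullMeasurableSet.measurable_of_complete
    ((measurableSet_setOfPred.2 hE).nullMeasurableSet.congr ?_) (μ := P)
  filter_upwards [hbc] with ω hω
  exact propext (hiff ω hω).symm

lemma IsStationaryMedium.flow_mem_regularSet (hmed : IsStationaryMedium τ M a H)
    (hτ_zero : ∀ ω, τ 0 ω = ω) (hτ_add : ∀ x y ω, τ (x + y) ω = τ x (τ y ω)) (z : ℝ) (ω : Ω) :
    τ z ω ∈ regularSet a H lam0 ↔ ω ∈ regularSet a H lam0 := by
  have hflow (z ω) (hω : ω ∈ regularSet a H lam0) : τ z ω ∈ regularSet a H lam0 := by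
    refine ⟨?_, (hmed.criticalValue_flow z ω).trans hω.2⟩
    simp only [← hmed.stationary_a]
    exact hω.1.translate (hmed.admissible ω).a_nonneg z
  refine ⟨fun hω => ?_, hflow z ω⟩
  have hback := hflow (-z) _ hω
  rwa [← hτ_add, neg_add_cancel, hτ_zero] at hback

end StationaryMedia

section Correctors

variable {Ω : Type*} {M : ℝ → ℝ} {a : ℝ → Ω → ℝ} {H : ℝ → ℝ → Ω → ℝ} {lam0 lam R : ℝ}
  {Ωhat : Set Ω} {v : Ω → ℝ → ℝ} {p : Ω → ℝ → ℝ} {U : ℝ → Ω → ℝ}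

lemma hasZerosOnBothSides_of_mem_regularSet {ω : Ω}
    (h : Admissible M (fun x => a x ω) (fun x p => H x p ω)) (hω : ω ∈ regularSet a H lam0) :
    HasZerosOnBothSides fun x => a x ω :=
  ((hasBoundedComponents_iff h.a_nonneg).1 hω.1).2

lemma exists_isCriticalFamily (hadm : ∀ ω, Admissible M (fun x => a x ω) (fun x p => H x p ω))
    (hΩ : Ωhat ⊆ regularSet a H lam0) : ∃ v, IsCriticalFamily a H lam0 Ωhat v := by
  classical
  have hsol (ω) (hω : ω ∈ Ωhat) : ∃ w, IsLip w ∧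
      IsViscositySolution (fun x => a x ω) (fun x p => H x p ω) lam0 w ∧ w 0 = 0 :=
    (hΩ hω).2 ▸ (hadm ω).exists_critical_solution
      (hasZerosOnBothSides_of_mem_regularSet (hadm ω) (hΩ hω))
  choose w hw using hsol
  refine ⟨fun ω => if hω : ω ∈ Ωhat then w ω hω else 0, fun ω hω => ?_, fun ω hω x => ?_⟩
  · simpa only [dif_pos hω] using hw ω hω
  · simp only [dif_neg hω, Pi.zero_apply]

/-- The slopes of the correctors at level `lam`: the upper profile for `ω ∈ Ωhat`, zero for the
others. -/
structure IsSlopeFamily (a : ℝ → Ω → ℝ) (H : ℝ → ℝ → Ω → ℝ) (Ωhat : Set Ω) (lam R : ℝ)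
    (p : Ω → ℝ → ℝ) : Prop where
  isUpperProfile : ∀ ω ∈ Ωhat, IsUpperProfile (fun x => a x ω) (fun x p => H x p ω) lam (p ω)
  abs_le : ∀ ω ∈ Ωhat, ∀ x, |p ω x| ≤ R
  eq_zero : ∀ ω ∉ Ωhat, p ω = 0

lemma exists_isSlopeFamily (hadm : ∀ ω, Admissible M (fun x => a x ω) (fun x p => H x p ω))
    (hΩ : Ωhat ⊆ regularSet a H lam0) (hlam : lam0 < lam) :
    ∃ p, IsSlopeFamily a H Ωhat lam (M lam + 1) p := by
  classical
  have hprofile (ω) (hω : ω ∈ Ωhat) := (hadm ω).exists_isUpperProfile_of_criticalValue_lt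
    (hasZerosOnBothSides_of_mem_regularSet (hadm ω) (hΩ hω)) ((hΩ hω).2.trans_lt hlam)
  choose p hp hpR using hprofile
  exact ⟨fun ω => if hω : ω ∈ Ωhat then p ω hω else 0,
    fun ω hω => by simpa only [dif_pos hω] using hp ω hω,
    fun ω hω => by simpa only [dif_pos hω] using hpR ω hω, fun ω hω => dif_neg hω⟩

lemma IsSlopeFamily.continuous (hp : IsSlopeFamily a H Ωhat lam R p) (ω : Ω) :
    Continuous (p ω) := by
  by_cases hω : ω ∈ Ωhat
  · exact (hp.isUpperProfile ω hω).cont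
  · exact hp.eq_zero ω hω ▸ continuous_zero

lemma IsSlopeFamily.mem_correctorsPlus_iff (hp : IsSlopeFamily a H Ωhat lam R p)
    (hadm : ∀ ω, Admissible M (fun x => a x ω) (fun x p => H x p ω))
    (hΩ : Ωhat ⊆ regularSet a H lam0) (hv : IsCriticalFamily a H lam0 Ωhat v) (hlam : lam0 < lam)
    {ω : Ω} {u : ℝ → ℝ} :
    u ∈ correctorsPlus a H Ωhat v lam ω ↔ ∀ x, HasDerivAt u (p ω x) x := by
  by_cases hω : ω ∈ Ωhat
  · have h := hadm ω
    have hz := hasZerosOnBothSides_of_mem_regularSet h (hΩ hω)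
    have hpω := hp.isUpperProfile ω hω
    obtain ⟨hv_lip, hv_sol, -⟩ := hv.1 ω hω
    constructor
    · rintro (⟨-, hu_lip, hu, hle⟩ | ⟨hnot, -⟩)
      · exact hpω.hasDerivAt_of_ae_le h hz hlam hv_sol hv_lip hu hu_lip hle
      · exact absurd hω hnot
    · refine fun hu => .inl ⟨hω, ⟨_, lipschitzWith_of_hasDerivAt hu (hp.abs_le ω hω)⟩,
        hpω.isViscositySolution h hu, ?_⟩
      filter_upwards [hpω.ae_deriv_le h hz hlam hv_sol hv_lip] with x hx
      rwa [(hu x).deriv]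
  · simp only [correctorsPlus, hω, false_and, false_or, not_false_iff, true_and, mem_ofPred_eq,
      hp.eq_zero ω hω, Pi.zero_apply]
    refine ⟨?_, fun hu => ⟨u 0, funext fun x => is_const_of_deriv_eq_zero
      (fun x => (hu x).differentiableAt) (fun x => (hu x).deriv) x 0⟩⟩
    rintro ⟨c, rfl⟩ x
    exact hasDerivAt_const x c

lemma existsUnique_hasDerivAt {p : ℝ → ℝ} (hp : Continuous p) :
    ∃! u : ℝ → ℝ, (∀ x, HasDerivAt u (p x) x) ∧ u 0 = 0 := by
  refine ⟨fun x => ∫ t in (0 : ℝ)..x, p t,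
    ⟨fun x => (hp.integral_hasStrictDerivAt 0 x).hasDerivAt, intervalIntegral.integral_same⟩, ?_⟩
  rintro u ⟨hu, hu0⟩
  funext x
  rw [intervalIntegral.integral_eq_sub_of_hasDerivAt (fun t _ => hu t)
    (hp.intervalIntegrable _ _), hu0, sub_zero]

theorem existsUnique_correctorsPlus
    (hadm : ∀ ω, Admissible M (fun x => a x ω) (fun x p => H x p ω))
    (hΩ : Ωhat ⊆ regularSet a H lam0) (hv : IsCriticalFamily a H lam0 Ωhat v) (hlam : lam0 < lam)
    (ω : Ω) : ∃! u, u ∈ correctorsPlus a H Ωhat v lam ω ∧ u 0 = 0 := by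
  obtain ⟨p, hp⟩ := exists_isSlopeFamily hadm hΩ hlam
  simpa only [hp.mem_correctorsPlus_iff hadm hΩ hv hlam] using
    existsUnique_hasDerivAt (hp.continuous ω)

section Regularity

variable [MeasurableSpace Ω] {P : Measure Ω} {τ : ℝ → Ω → Ω}

lemma IsSlopeFamily.measurable [P.IsComplete] (hp : IsSlopeFamily a H Ωhat lam R p)
    (hmed : IsStationaryMedium τ M a H) (hΩ : Ωhat ⊆ regularSet a H lam0)
    (hae : ∀ᵐ ω ∂P, ω ∈ Ωhat) (x : ℝ) : Measurable fun ω => p ω x := by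
  refine measurable_of_Iio fun t => ?_
  obtain ⟨E, hE, hiff⟩ := exists_measurable_profile_lt hmed.admissible hmed.measurable_a
    hmed.measurable_H (le_max_right R (M (lam + 1))) x t
  refine NullMeasurableSet.measurable_of_complete
    ((measurableSet_setOfPred.2 hE).nullMeasurableSet.congr ?_) (μ := P)
  filter_upwards [hae] with ω hω
  exact propext (hiff ω _ (hasZerosOnBothSides_of_mem_regularSet (hmed.admissible ω) (hΩ hω))
    (hp.isUpperProfile ω hω) fun x => le_max_of_le_left (hp.abs_le ω hω x)).symm

lemma IsSlopeFamily.apply_add (hp : IsSlopeFamily a H Ωhat lam R p)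
    (hmed : IsStationaryMedium τ M a H) (hΩ : Ωhat ⊆ regularSet a H lam0) {z : ℝ} {ω : Ω}
    (hω : τ z ω ∈ Ωhat ↔ ω ∈ Ωhat) (x : ℝ) : p ω (x + z) = p (τ z ω) x := by
  by_cases hmem : ω ∈ Ωhat
  · have hshift := (hp.isUpperProfile ω hmem).translate z
    simp only [hmed.stationary_a, hmed.stationary_H] at hshift
    exact congrFun (hshift.unique (hmed.admissible _)
      (hasZerosOnBothSides_of_mem_regularSet (hmed.admissible _) (hΩ (hω.2 hmem)))
      (hp.isUpperProfile _ (hω.2 hmem))) x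
  · rw [hp.eq_zero ω hmem, hp.eq_zero _ (hω.not.2 hmem)]
    rfl

lemma measurable_prod_of_hasDerivAt (hp_meas : ∀ x, Measurable fun ω => p ω x)
    (hp_cont : ∀ ω, Continuous (p ω)) (hU : ∀ ω x, HasDerivAt (fun y => U y ω) (p ω x) x)
    (hU0 : ∀ ω, U 0 ω = 0) : Measurable fun q : ℝ × Ω => U q.1 q.2 := by
  have hp : StronglyMeasurable fun q : Ω × ℝ => p q.1 q.2 :=
    ((measurable_uncurry_of_continuous_of_measurable (u := fun x ω => p ω x) hp_cont
      hp_meas).comp measurable_swap).stronglyMeasurable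
  refine measurable_uncurry_of_continuous_of_measurable (u := U)
    (fun ω => continuous_iff_continuousAt.2 fun x => (hU ω x).continuousAt) fun x => ?_
  have hint : U x = fun ω => ∫ t in (0 : ℝ)..x, p ω t := funext fun ω => by
    rw [intervalIntegral.integral_eq_sub_of_hasDerivAt (fun t _ => hU ω t)
      ((hp_cont ω).intervalIntegrable _ _), hU0, sub_zero]
  rw [hint]
  exact (hp.integral_prod_right.sub hp.integral_prod_right).measurable

theorem correctorsPlus_regularity [P.IsComplete] (hmed : IsStationaryMedium τ M a H)
    (hτ : ∀ x, MeasurePreserving (τ x) P P) (hΩ : Ωhat ⊆ regularSet a H lam0)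
    (hae : ∀ᵐ ω ∂P, ω ∈ Ωhat) (hv : IsCriticalFamily a H lam0 Ωhat v) (hlam : lam0 < lam)
    (hU : ∀ ω, (fun x => U x ω) ∈ correctorsPlus a H Ωhat v lam ω ∧ U 0 ω = 0) :
    (∀ ω, ContDiff ℝ 1 fun x => U x ω) ∧ (Measurable fun q : ℝ × Ω => U q.1 q.2) ∧
      HasStationaryDeriv P τ Ωhat U := by
  obtain ⟨p, hp⟩ := exists_isSlopeFamily hmed.admissible hΩ hlam
  have hderiv (ω) : ∀ x, HasDerivAt (fun y => U y ω) (p ω x) x :=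
    (hp.mem_correctorsPlus_iff hmed.admissible hΩ hv hlam).1 (hU ω).1
  have hderiv_eq (ω) : deriv (fun y => U y ω) = p ω := funext fun x => (hderiv ω x).deriv
  refine ⟨fun ω => ?_, measurable_prod_of_hasDerivAt (hp.measurable hmed hΩ hae) hp.continuous
    hderiv fun ω => (hU ω).2, fun z => ?_, fun hinv z ω x => ?_⟩
  · rw [contDiff_one_iff_deriv, hderiv_eq ω]
    exact ⟨fun x => (hderiv ω x).differentiableAt, hp.continuous ω⟩
  · filter_upwards [hae, (hτ z).quasiMeasurePreserving.ae hae] with ω hω hzω x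
    rw [hderiv_eq, hderiv_eq, hp.apply_add hmed hΩ (iff_of_true hzω hω)]
  · rw [hderiv_eq, hderiv_eq, hp.apply_add hmed hΩ (hinv z ω)]

lemma HasStationaryDeriv.of_reflect
    (hU : HasStationaryDeriv P (fun x => τ (-x)) Ωhat fun x => U (-x)) :
    HasStationaryDeriv P τ Ωhat U := by
  have hneg (z ω x) (h : deriv (fun y => U (-y) ω) (-x + -z) =
      deriv (fun y => U (-y) (τ (- -z) ω)) (-x)) :
      deriv (fun y => U y ω) (x + z) = deriv (fun y => U y (τ z ω)) x := by
    rw [deriv_comp_neg (fun y => U y ω), deriv_comp_neg (fun y => U y (τ (- -z) ω)), neg_inj] at h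
    simpa only [neg_add, neg_neg] using h
  refine ⟨fun z => ?_, fun hinv z ω x => hneg z ω x (hU.2 (fun z => hinv (-z)) (-z) ω (-x))⟩
  filter_upwards [hU.1 (-z)] with ω hω x using hneg z ω x (hω (-x))

end Regularity

end Correctors

section Reflection

variable {Ω : Type*} {M : ℝ → ℝ} {a : ℝ → Ω → ℝ} {H : ℝ → ℝ → Ω → ℝ} {lam0 lam : ℝ}
  {Ωhat : Set Ω} {v : Ω → ℝ → ℝ}

lemma mem_regularSet_reflect (ha : ∀ x ω, 0 ≤ a x ω) {ω : Ω} (hω : ω ∈ regularSet a H lam0) :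
    ω ∈ regularSet (fun x => a (-x)) (fun x p => H (-x) (-p)) lam0 :=
  ⟨hω.1.reflect fun x => ha x ω,
    (criticalValue_reflect (a := fun x => a x ω) (H := fun x p => H x p ω)).trans hω.2⟩

lemma IsLip.reflect {u : ℝ → ℝ} (hu : IsLip u) : IsLip fun x => u (-x) := by
  obtain ⟨K, hK⟩ := hu
  refine ⟨K, LipschitzWith.of_dist_le_mul fun x y => ?_⟩
  simpa only [dist_neg_neg] using hK.dist_le_mul (-x) (-y)

lemma IsCriticalFamily.reflect (hv : IsCriticalFamily a H lam0 Ωhat v) :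
    IsCriticalFamily (fun x => a (-x)) (fun x p => H (-x) (-p)) lam0 Ωhat fun ω x => v ω (-x) :=
  ⟨fun ω hω => ⟨(hv.1 ω hω).1.reflect, (hv.1 ω hω).2.1.reflect, by simpa using (hv.1 ω hω).2.2⟩,
    fun ω hω x => hv.2 ω hω _⟩

lemma ae_neg {p : ℝ → Prop} (hp : ∀ᵐ x, p x) : ∀ᵐ x, p (-x) :=
  (Measure.measurePreserving_neg (volume : Measure ℝ)).quasiMeasurePreserving.ae hp

lemma mem_correctorsMinus_iff {u : ℝ → ℝ} {ω : Ω} : u ∈ correctorsMinus a H Ωhat v lam ω ↔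
    (fun x => u (-x)) ∈ correctorsPlus (fun x => a (-x)) (fun x p => H (-x) (-p)) Ωhat
      (fun ω x => v ω (-x)) lam ω := by
  refine or_congr (and_congr_right fun _ => and_congr ⟨fun hu => hu.reflect, fun hu => ?_⟩
    (and_congr ⟨fun hu => hu.reflect, fun hu => ?_⟩ ?_))
    (and_congr_right fun _ => exists_congr fun c => ?_)
  · simpa using hu.reflect
  · simpa using hu.reflect
  · simp only [deriv_comp_neg, neg_le_neg_iff]
    exact ⟨ae_neg, fun hle => by simpa using ae_neg hle⟩
  · exact ⟨fun hu => by rw [hu], fun hu => funext fun x => by simpa using congrFun hu (-x)⟩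

theorem existsUnique_correctorsMinus
    (hadm : ∀ ω, Admissible M (fun x => a x ω) (fun x p => H x p ω))
    (hΩ : Ωhat ⊆ regularSet a H lam0) (hv : IsCriticalFamily a H lam0 Ωhat v) (hlam : lam0 < lam)
    (ω : Ω) : ∃! u, u ∈ correctorsMinus a H Ωhat v lam ω ∧ u 0 = 0 := by
  obtain ⟨u, ⟨hu, hu0⟩, huniq⟩ := existsUnique_correctorsPlus (fun ω => (hadm ω).reflect)
    (fun ω hω => mem_regularSet_reflect (fun x ω => (hadm ω).a_nonneg x) (hΩ hω)) hv.reflect hlam ω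
  refine ⟨fun x => u (-x), ⟨mem_correctorsMinus_iff.2 (by simpa using hu), by simpa using hu0⟩, ?_⟩
  rintro w ⟨hw, hw0⟩
  have hwu := huniq (fun x => w (-x)) ⟨mem_correctorsMinus_iff.1 hw, by simpa using hw0⟩
  exact funext fun x => by simpa using congrFun hwu (-x)

theorem correctorsMinus_regularity [MeasurableSpace Ω] {P : Measure Ω} [P.IsComplete]
    {τ : ℝ → Ω → Ω} (hmed : IsStationaryMedium τ M a H) (hτ : ∀ x, MeasurePreserving (τ x) P P)
    (hΩ : Ωhat ⊆ regularSet a H lam0) (hae : ∀ᵐ ω ∂P, ω ∈ Ωhat)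
    (hv : IsCriticalFamily a H lam0 Ωhat v) (hlam : lam0 < lam) {U : ℝ → Ω → ℝ}
    (hU : ∀ ω, (fun x => U x ω) ∈ correctorsMinus a H Ωhat v lam ω ∧ U 0 ω = 0) :
    (∀ ω, ContDiff ℝ 1 fun x => U x ω) ∧ (Measurable fun q : ℝ × Ω => U q.1 q.2) ∧
      HasStationaryDeriv P τ Ωhat U := by
  obtain ⟨hU_diff, hU_meas, hU_stat⟩ := correctorsPlus_regularity (U := fun x => U (-x))
    hmed.reflect (fun x => hτ (-x))
    (fun ω hω => mem_regularSet_reflect (fun x ω => (hmed.admissible ω).a_nonneg x) (hΩ hω)) hae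
    hv.reflect hlam fun ω => ⟨mem_correctorsMinus_iff.1 (hU ω).1, by simpa using (hU ω).2⟩
  refine ⟨fun ω => ?_, ?_, hU_stat.of_reflect⟩
  · simpa [Function.comp_def] using (hU_diff ω).comp contDiff_neg
  · simpa [Function.comp_def] using hU_meas.comp (measurable_fst.neg.prodMk measurable_snd)

end Reflection

theorem theorem5p1_general {Ω : Type*} [MeasurableSpace Ω] {P : Measure Ω} [IsFiniteMeasure P]
    [P.IsComplete] {τ : ℝ → Ω → Ω} (hτ : IsErgodicFlow P τ) {M : ℝ → ℝ} {a : ℝ → Ω → ℝ}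
    {H : ℝ → ℝ → Ω → ℝ} (hmed : IsStationaryMedium τ M a H)
    (hne : ∀ᵐ ω ∂P, ∃ x, a x ω ≠ 0) (hzero : ∀ᵐ ω ∂P, ∃ x, a x ω = 0) :
    ∃ lam0 : ℝ,
      (∀ᵐ ω ∂P, criticalValue (fun x => a x ω) (fun x p => H x p ω) = lam0) ∧
      (∀ᵐ ω ∂P, ω ∈ regularSet a H lam0) ∧
      (∀ z ω, τ z ω ∈ regularSet a H lam0 ↔ ω ∈ regularSet a H lam0) ∧
      ∀ Ωhat : Set Ω, Ωhat ⊆ regularSet a H lam0 → (∀ᵐ ω ∂P, ω ∈ Ωhat) →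
        (∃ v, IsCriticalFamily a H lam0 Ωhat v) ∧
        ∀ v, IsCriticalFamily a H lam0 Ωhat v → ∀ lam, lam0 < lam →
          (∀ ω, ∃! u, u ∈ correctorsPlus a H Ωhat v lam ω ∧ u 0 = 0) ∧
          (∀ ω, ∃! u, u ∈ correctorsMinus a H Ωhat v lam ω ∧ u 0 = 0) ∧
          (∀ U : ℝ → Ω → ℝ,
            (∀ ω, (fun x => U x ω) ∈ correctorsPlus a H Ωhat v lam ω ∧ U 0 ω = 0) →
              (∀ ω, ContDiff ℝ 1 (fun x => U x ω)) ∧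
              Measurable (fun q : ℝ × Ω => U q.1 q.2) ∧
              HasStationaryDeriv P τ Ωhat U) ∧
          (∀ U : ℝ → Ω → ℝ,
            (∀ ω, (fun x => U x ω) ∈ correctorsMinus a H Ωhat v lam ω ∧ U 0 ω = 0) →
              (∀ ω, ContDiff ℝ 1 (fun x => U x ω)) ∧
              Measurable (fun q : ℝ × Ω => U q.1 q.2) ∧
              HasStationaryDeriv P τ Ωhat U) := by
  have hbc := hmed.ae_hasBoundedComponents hτ.measurePreserving hne hzero
  obtain ⟨lam0, hlam0⟩ := hτ.ergodic _ (hmed.measurable_criticalValue hbc)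
    fun z => .of_forall (hmed.criticalValue_flow z)
  refine ⟨lam0, hlam0, hbc.and hlam0, hmed.flow_mem_regularSet hτ.zero hτ.add,
    fun Ωhat hΩ hae => ⟨exists_isCriticalFamily hmed.admissible hΩ, fun v hv lam hlam =>
      ⟨existsUnique_correctorsPlus hmed.admissible hΩ hv hlam,
        existsUnique_correctorsMinus hmed.admissible hΩ hv hlam, fun U hU => ?_, fun U hU => ?_⟩⟩⟩
  · exact correctorsPlus_regularity hmed hτ.measurePreserving hΩ hae hv hlam hU
  · exact correctorsMinus_regularity hmed hτ.measurePreserving hΩ hae hv hlam hU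

theorem theorem5p1 {Ω : Type*} [MeasurableSpace Ω] (P : Measure Ω) [IsProbabilityMeasure P]
    [P.IsComplete] (τ : ℝ → Ω → Ω) (hτ : IsErgodicFlow P τ)
    (a : ℝ → Ω → ℝ) (H : ℝ → ℝ → Ω → ℝ) (κ α₀ α₁ γ η : ℝ)
    (hκ : 0 < κ) (hα₀ : 0 < α₀) (hα₁ : 0 < α₁) (hγ : 2 < γ) (hη : 0 < η)
    (ha_meas : Measurable (fun q : ℝ × Ω => a q.1 q.2))
    (hH_meas : Measurable (fun q : ℝ × ℝ × Ω => H q.1 q.2.1 q.2.2))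
    (ha_range : ∀ x ω, 0 ≤ a x ω ∧ a x ω ≤ 1)
    (ha_stat : ∀ x y ω, a (x + y) ω = a x (τ y ω))
    (hH_stat : ∀ x y p ω, H (x + y) p ω = H x p (τ y ω))
    (hA1 : ∀ᵐ ω ∂P, (∃ x, a x ω ≠ 0) ∧ IsLeast (Set.range fun x => a x ω) 0)
    (hA2 : ∀ ω x y, |√(a x ω) - √(a y ω)| ≤ κ * |x - y|)
    (hH : ∀ ω, SqcHamiltonianClass α₀ α₁ γ η (fun x p => H x p ω)) :
    ∃ lam0 : ℝ,
      (∀ᵐ ω ∂P, criticalValue (fun x => a x ω) (fun x p => H x p ω) = lam0) ∧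
      (∀ᵐ ω ∂P, ω ∈ regularSet a H lam0) ∧
      (∀ z ω, τ z ω ∈ regularSet a H lam0 ↔ ω ∈ regularSet a H lam0) ∧
      ∀ Ωhat : Set Ω, Ωhat ⊆ regularSet a H lam0 → (∀ᵐ ω ∂P, ω ∈ Ωhat) →
        (∃ v, IsCriticalFamily a H lam0 Ωhat v) ∧
        ∀ v, IsCriticalFamily a H lam0 Ωhat v → ∀ lam, lam0 < lam →
          (∀ ω, ∃! u, u ∈ correctorsPlus a H Ωhat v lam ω ∧ u 0 = 0) ∧
          (∀ ω, ∃! u, u ∈ correctorsMinus a H Ωhat v lam ω ∧ u 0 = 0) ∧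
          (∀ U : ℝ → Ω → ℝ,
            (∀ ω, (fun x => U x ω) ∈ correctorsPlus a H Ωhat v lam ω ∧ U 0 ω = 0) →
              (∀ ω, ContDiff ℝ 1 (fun x => U x ω)) ∧
              Measurable (fun q : ℝ × Ω => U q.1 q.2) ∧
              HasStationaryDeriv P τ Ωhat U) ∧
          (∀ U : ℝ → Ω → ℝ,
            (∀ ω, (fun x => U x ω) ∈ correctorsMinus a H Ωhat v lam ω ∧ U 0 ω = 0) →
              (∀ ω, ContDiff ℝ 1 (fun x => U x ω)) ∧
              Measurable (fun q : ℝ × Ω => U q.1 q.2) ∧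
              HasStationaryDeriv P τ Ωhat U) := by
  exact theorem5p1_general hτ (isStationaryMedium_of_sqcHamiltonianClass hκ hα₀ hα₁ hγ ha_meas
    hH_meas ha_range ha_stat hH_stat hA2 hH) (hA1.mono fun ω h => h.1) (hA1.mono fun ω h => h.2.1)
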